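/- Let $T>0$, $0<H\le \tfrac12$, $I=[0,T]$, $\mathcal O=(0,1)$. Let $W=\{W(t,x):(t,x)\in I\times\overline{\mathcal O}\}$ be a centred Gaussian random field on a probability space $(\Omega,\mathscr F,\mathbb P)$ with $$\mathbb E[W(s,x)W(t,y)]=(s\wedge t)\,\frac{x^{2H}+y^{2H}-|x-y|^{2H}}{2},$$ and let $\xi=\partial^2W/\partial t\,\partial x$ be the associated noise. The integral with respect to $\xi$ of a step function $\sum_{i,j}f_{ij}\chi_{(a_i,a_{i+1}]\times(b_j,b_{j+1}]}$ is $\sum_{i,j}f_{ij}\big(W(a_{i+1},b_{j+1})-W(a_i,b_{j+1})-W(a_{i+1},b_j)+W(a_i,b_j)\big)$. The integral is extended to the Hilbert space of integrands (limits of step functions) with squared norm $$\frac{H(1-2H)}2\int_I\int_{\mathcal O}\int_{\mathcal O}\frac{|f(s,x)-f(s,y)|^2}{|x-y|^{2-2H}}\,dx\,dy\,ds+H\int_I\int_{\mathcal O}f(s,x)^2\big(x^{2H-1}+(1-x)^{2H-1}\big)\,dx\,ds$$ (the first term being $0$ when $H=\frac12$), by taking limits in $L^2(\Omega)$. For $\alpha\ge1$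 let $\lambda_\alpha=(\alpha\pi)^2$ and $\varphi_\alpha(x)=\sqrt2\sin(\sqrt{\lambda_\alpha}x)$. Let $$G_t(x,y)=\sum_{\alpha=1}^\infty\phi_\alpha(t)\varphi_\alpha(x)\varphi_\alpha(y),$$ where $\phi_\alpha(t)=e^{-\lambda_\alpha t}$ for the stochastic heat equation (SHE) and $\phi_\alpha(t)=\sin(\sqrt{\lambda_\alpha}t)/\sqrt{\lambda_\alpha}$ for the stochastic wave equation (SWE), both with homogeneous Dirichlet boundary condition. For integers $m,n\ge1$ put $k=T/m$, $h=1/n$, $I_i=(ik,(i+1)k]$, $\mathcal O_j=(jh,(j+1)h]$, and $$\tilde\xi(s,y)=\sum_{i=0}^{m-1}\sum_{j=0}^{n-1}\Big[\frac1{kh}\int_{I_i}\int_{\mathcal O_j}\xi(d\sigma,dz)\Big]\chi_{I_i\times\mathcal O_j}(s,y).$$ Define the stochastic convolution and its Wong–Zakai approximation by $$S(t,x)=\int_0^t\int_{\mathcal O}G_{t-s}(x,y)\,\xi(ds,dy),\qquad \tilde S(t,x)=\int_0^t\int_{\mathcal O}G_{t-s}(x,y)\,\tilde\xi(s,y)\,dy\,ds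 .$$ For both equations $S$ exists: for each $t\in I$ the integral defining $S(t,x)$ exists for almost every $x\in\mathcal O$ and has a version that is jointly measurable in $(x,\omega)$; in the bounds below $S$ is any such version. Theorem. For every real $p\ge2$ there is a constant $C=C(p,T,H)$ such that for all $m,n\ge1$: for SHE, $$\sup_{t\in I}\Big(\mathbb E\big[\|S(t)-\tilde S(t)\|_{L^2(\mathcal O)}^p\big]\Big)^{1/p}\le C\big(h^H+k^{1/4}h^{H-1/2}\big),$$ and for SWE, $$\sup_{t\in I}\Big(\mathbb E\big[\|S(t)-\tilde S(t)\|_{L^2(\mathcal O)}^p\big]\Big)^{1/p}\le C\big(h^H+k^{1/2}h^{H-1/2}\big).$$ -/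

import Mathlib

open MeasureTheory ProbabilityTheory Filter Topology Set
open scoped ENNReal

noncomputable section

namespace WongZakai

/-- `W` is a (centred) fractional Gaussian sheet on `[0,T] × [0,1]`: Brownian in time and
fractional Brownian with Hurst index `H` in space. -/
structure IsFractionalSheet {Ω : Type*} [MeasurableSpace Ω] (H T : ℝ) (P : Measure Ω)
    (W : ℝ → ℝ → Ω → ℝ) : Prop where
  gaussian : IsGaussianProcess
    (fun (z : Icc (0 : ℝ) T × Icc (0 : ℝ) 1) => W z.1 z.2) P
  mean_zero : ∀ t ∈ Icc (0 : ℝ) T, ∀ x ∈ Icc (0 : ℝ) 1, ∫ ω, W t x ω ∂P = 0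
  cov : ∀ s ∈ Icc (0 : ℝ) T, ∀ t ∈ Icc (0 : ℝ) T, ∀ x ∈ Icc (0 : ℝ) 1, ∀ y ∈ Icc (0 : ℝ) 1,
    ∫ ω, W s x ω * W t y ω ∂P =
      min s t * ((x ^ (2 * H) + y ^ (2 * H) - |x - y| ^ (2 * H)) / 2)

/-- The rectangular increment of `W` over `(a, a'] × (b, b']`, that is, the integral of the
indicator function of this rectangle with respect to the noise `ξ(ds,dy)`. -/
def rectIncr {Ω : Type*} (W : ℝ → ℝ → Ω → ℝ) (a a' b b' : ℝ) (ω : Ω) : ℝ :=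
  W a' b' ω - W a b' ω - W a' b ω + W a b ω

/-- Step functions on `[0,T] × [0,1]`: grids `0 = a₀ < ⋯ < a_M = T` and `0 = b₀ < ⋯ < b_N = 1`
and a coefficient for each cell `(aᵢ, aᵢ₊₁] × (bⱼ, bⱼ₊₁]`.  Only the values of `a`, `b`, `c` at
indices up to `M`, `N` are used. -/
structure StepFun (T : ℝ) where
  M : ℕ
  N : ℕ
  a : ℕ → ℝ
  b : ℕ → ℝ
  c : ℕ → ℕ → ℝ
  a_zero : a 0 = 0
  a_last : a M = T
  a_lt : ∀ i < M, a i < a (i + 1)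
  b_zero : b 0 = 0
  b_last : b N = 1
  b_lt : ∀ j < N, b j < b (j + 1)

/-- The function `∑ᵢⱼ cᵢⱼ χ_{(aᵢ, aᵢ₊₁] × (bⱼ, bⱼ₊₁]}`. -/
def StepFun.toFun {T : ℝ} (f : StepFun T) (s y : ℝ) : ℝ :=
  ∑ i ∈ Finset.range f.M, ∑ j ∈ Finset.range f.N,
    (Ioc (f.a i) (f.a (i + 1)) ×ˢ Ioc (f.b j) (f.b (j + 1))).indicator
      (fun _ => f.c i j) (s, y)

/-- The integral `∫∫ f(s,y) ξ(ds,dy)` of a step function, as a Riemann sum. -/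
def StepFun.integral {Ω : Type*} {T : ℝ} (f : StepFun T) (W : ℝ → ℝ → Ω → ℝ) (ω : Ω) : ℝ :=
  ∑ i ∈ Finset.range f.M, ∑ j ∈ Finset.range f.N,
    f.c i j * rectIncr W (f.a i) (f.a (i + 1)) (f.b j) (f.b (j + 1)) ω

/-- The square of the norm of the Hilbert space `𝓗` of integrands of the white-fractional noise,
`H(1-2H)/2 ∫∫∫ |f(s,x)-f(s,y)|² / |x-y|^{2-2H} + H ∫∫ f(s,x)² (x^{2H-1} + (1-x)^{2H-1})`,
with values in `[0,∞]`.  For `H = 1/2` the first coefficient is `0`, and `0 * ∞ = 0` in `ℝ≥0∞`, so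
that the expression is then the square of the norm of `L²([0,T] × (0,1))`. -/
def noiseNormSq (H T : ℝ) (f : ℝ → ℝ → ℝ) : ℝ≥0∞ :=
  ENNReal.ofReal (H * (1 - 2 * H) / 2) *
      (∫⁻ s in Icc 0 T, ∫⁻ x in Ioo 0 1, ∫⁻ y in Ioo 0 1,
        ENNReal.ofReal ((f s x - f s y) ^ 2 / |x - y| ^ (2 - 2 * H))) +
    ENNReal.ofReal H *
      (∫⁻ s in Icc 0 T, ∫⁻ x in Ioo 0 1,
        ENNReal.ofReal (f s x ^ 2 * (x ^ (2 * H - 1) + (1 - x) ^ (2 * H - 1))))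

/-- `X` is (a version of) the stochastic integral `∫_I ∫_𝒪 f(s,y) ξ(ds,dy)`: the function `f` is the
limit, in the norm of `𝓗`, of step functions whose integrals converge to `X` in `L²(Ω)`. -/
def IsStochasticIntegral {Ω : Type*} [MeasurableSpace Ω] (H T : ℝ) (P : Measure Ω)
    (W : ℝ → ℝ → Ω → ℝ) (f : ℝ → ℝ → ℝ) (X : Ω → ℝ) : Prop :=
  AEMeasurable (fun z : ℝ × ℝ => f z.1 z.2)
      (volume.restrict (Icc (0 : ℝ) T ×ˢ Ioo (0 : ℝ) 1)) ∧
    MemLp X 2 P ∧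
    ∃ F : ℕ → StepFun T,
      Tendsto (fun r => noiseNormSq H T (fun s y => f s y - (F r).toFun s y)) atTop (𝓝 0) ∧
      Tendsto (fun r => eLpNorm (fun ω => X ω - (F r).integral W ω) 2 P) atTop (𝓝 0)

/-- The two equations: `∂ₜu - ∂ₓₓu = b(u) + ξ` (heat) and `∂ₜₜu - ∂ₓₓu = b(u) + ξ` (wave). -/
inductive EquationKind
  | heat
  | wave

/-- The square root `√λ_α = απ` for the eigenvalue `λ_α = (απ)²` of the Dirichlet Laplacian on
`(0,1)`. -/
def freq (α : ℕ) : ℝ := α * Real.pi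

/-- The Dirichlet eigenfunction `φ_α(x) = √2 sin(√λ_α x)`. -/
def eigenfun (α : ℕ) (x : ℝ) : ℝ := √2 * Real.sin (freq α * x)

/-- The temporal factor `e^{-λ_α t}` (heat) or `sin(√λ_α t) / √λ_α` (wave). -/
def timeFactor (L : EquationKind) (α : ℕ) (t : ℝ) : ℝ :=
  match L with
  | .heat => Real.exp (-(freq α ^ 2) * t)
  | .wave => Real.sin (freq α * t) / freq α

/-- The Green's function `G_t(x,y) = ∑_{α ≥ 1} ϕ_α(t) φ_α(x) φ_α(y)`, the sum of the series being the
limit of its partial sums (for the wave equation the series converges only conditionally). -/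
def green (L : EquationKind) (t x y : ℝ) : ℝ :=
  limUnder atTop (fun N : ℕ =>
    ∑ α ∈ Finset.Icc 1 N, timeFactor L α t * eigenfun α x * eigenfun α y)

/-- The kernel `(s,y) ↦ G_{t-s}(x,y)`, which is set to zero for `s > t`. -/
def kernel (L : EquationKind) (t x s y : ℝ) : ℝ :=
  if s ≤ t then green L (t - s) x y else 0

/-- `S` is (a version of) the stochastic convolution `S(t,x) = ∫_0^t ∫_𝒪 G_{t-s}(x,y) ξ(ds,dy)`,
jointly measurable in `(x,ω)` for each `t ∈ [0,T]`, so that the `L²(0,1)`-norm of `S(t)` is a random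
variable.  The identity is only asked for almost every `x ∈ (0,1)`. -/
def IsStochasticConvolution {Ω : Type*} [MeasurableSpace Ω] (L : EquationKind) (H T : ℝ)
    (P : Measure Ω) (W : ℝ → ℝ → Ω → ℝ) (S : ℝ → ℝ → Ω → ℝ) : Prop :=
  ∀ t ∈ Icc (0 : ℝ) T,
    AEStronglyMeasurable (fun z : ℝ × Ω => S t z.1 z.2)
      ((volume.restrict (Ioo (0 : ℝ) 1)).prod P) ∧
    ∀ᵐ x ∂(volume.restrict (Ioo (0 : ℝ) 1)),
      IsStochasticIntegral H T P W (fun s y => kernel L t x s y) (S t x)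

/-- The Wong–Zakai approximation of the noise for the uniform grids with `m` time steps of size
`k = T/m` and `n` space steps of size `h = 1/n`. -/
def noiseApprox {Ω : Type*} (T : ℝ) (W : ℝ → ℝ → Ω → ℝ) (m n : ℕ) (s y : ℝ) (ω : Ω) : ℝ :=
  ∑ i ∈ Finset.range m, ∑ j ∈ Finset.range n,
    (Ioc (i * (T / m)) ((i + 1) * (T / m)) ×ˢ
        Ioc (j * (1 / n : ℝ)) ((j + 1) * (1 / n : ℝ))).indicator
      (fun _ => 1 / ((T / m) * (1 / n)) *
        rectIncr W (i * (T / m)) ((i + 1) * (T / m)) (j * (1 / n)) ((j + 1) * (1 / n)) ω)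
      (s, y)

/-- The approximate convolution `S̃(t,x) = ∫_0^t ∫_𝒪 G_{t-s}(x,y) ξ̃(s,y) dy ds`. -/
def convApprox {Ω : Type*} (L : EquationKind) (T : ℝ) (W : ℝ → ℝ → Ω → ℝ) (m n : ℕ)
    (t x : ℝ) (ω : Ω) : ℝ :=
  ∫ s in Ioc 0 t, ∫ y in Ioo 0 1, green L (t - s) x y * noiseApprox T W m n s y ω

/-- `sup_{t ∈ [0,T]} (𝔼[‖u(t)‖_{L²(0,1)}^p])^{1/p}`, with values in `[0,∞]`. -/
def supMoment {Ω : Type*} [MeasurableSpace Ω] (p T : ℝ) (P : Measure Ω)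
    (u : ℝ → ℝ → Ω → ℝ) : ℝ≥0∞ :=
  ⨆ t ∈ Icc (0 : ℝ) T,
    (∫⁻ ω, eLpNorm (fun x => u t x ω) 2 (volume.restrict (Ioo (0 : ℝ) 1)) ^ p ∂P) ^ (1 / p)

end WongZakai

end

open MeasureTheory ProbabilityTheory Filter Topology Set
open scoped ENNReal

noncomputable section

namespace WongZakai

/-! Integrating the kernel against the cell averages of the noise is the same as integrating the
cell averages of the kernel against the noise (`convApprox_eq_integral_kernelStep`). So, with `A`
the averaging over cells, `S - S̃` is for almost every `x` the stochastic integral of the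
deterministic function `G - AG`.

Integrals of step functions are centred Gaussian, and their variance is the squared norm of the
integrand: on indicator functions of rectangles `(0,t] × (0,x]` the integrals that define the norm
reproduce the covariance of `W` (`spaceNormSq_sum_cut`, `noiseNormSq_sheetFun`). Gaussian moments
are powers of the variance, so all that matters is the integral over `x` of the squared norm of `G -
AG`. A weighted Hölder inequality (`lintegral_rpow_lintegral_le`) then gives the `p`-th moment of
the `L²`-norm.

The `φ_α` are orthonormal, so Parseval in `x` turns this integral into the sum over `α` of the
squared norms of `g_α ⊗ φ_α - Ag_α ⊗ Aφ_α`, where `g_α` is the temporal factor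
(`lintegral_noiseNormSq_sum_eigenfun`). The splitting `g ⊗ (φ - Aφ) + (g - Ag) ⊗ Aφ` and the product
form of the norm bound each term by a multiple of `min(h^{1+2H}, α^{-1-2H}) + h^{2H-1} min(κ²,
α^{-2})`, with `κ = √k` for heat and `κ = k` for wave (`noiseNormSq_modeError_le`). Summing over `α`
(`sum_min_rpow_le`) gives `h^{2H} + κ h^{2H-1}`, whose square root is the rate.

The Green's function enters as a pointwise limit of partial sums for `s ≠ t`, and Fatou's lemma
passes to it the bounds that are uniform in the number of modes. Along rapidly refined grids the
same estimate makes the integrals of the averaged kernels converge in mean square over `(0,1) × Ω`,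
and this proves that `S` exists. -/

/-- The square of the norm of the space `𝓗` of integrands of the fractional noise on `(0,1)`. -/
def spaceNormSq (H : ℝ) (v : ℝ → ℝ) : ℝ≥0∞ :=
  ENNReal.ofReal (H * (1 - 2 * H) / 2) *
      (∫⁻ x in Ioo 0 1, ∫⁻ y in Ioo 0 1,
        ENNReal.ofReal ((v x - v y) ^ 2 / |x - y| ^ (2 - 2 * H))) +
    ENNReal.ofReal H *
      (∫⁻ x in Ioo 0 1,
        ENNReal.ofReal (v x ^ 2 * (x ^ (2 * H - 1) + (1 - x) ^ (2 * H - 1))))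

/-! ### The norm of the space of integrands -/

section Norms

variable {H T : ℝ}

lemma measurable_lintegral_seminorm {β : Type*} [MeasurableSpace β] {f : β → ℝ → ℝ}
    (hf : Measurable (Function.uncurry f)) :
    Measurable fun s => ∫⁻ x in Ioo 0 1, ∫⁻ y in Ioo 0 1,
      ENNReal.ofReal ((f s x - f s y) ^ 2 / |x - y| ^ (2 - 2 * H)) := by
  refine Measurable.lintegral_prod_right (f := fun s x => ∫⁻ y in Ioo 0 1,
      ENNReal.ofReal ((f s x - f s y) ^ 2 / |x - y| ^ (2 - 2 * H))) ?_
  refine Measurable.lintegral_prod_right' (f := fun q : (β × ℝ) × ℝ =>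
      ENNReal.ofReal ((f q.1.1 q.1.2 - f q.1.1 q.2) ^ 2 / |q.1.2 - q.2| ^ (2 - 2 * H))) ?_
  have h1 : Measurable fun q : (β × ℝ) × ℝ => f q.1.1 q.1.2 := hf.comp measurable_fst
  have h2 : Measurable fun q : (β × ℝ) × ℝ => f q.1.1 q.2 :=
    hf.comp (measurable_fst.fst.prodMk measurable_snd)
  fun_prop

lemma measurable_lintegral_weight {β : Type*} [MeasurableSpace β] {f : β → ℝ → ℝ}
    (hf : Measurable (Function.uncurry f)) :
    Measurable fun s => ∫⁻ x in Ioo 0 1,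
      ENNReal.ofReal (f s x ^ 2 * (x ^ (2 * H - 1) + (1 - x) ^ (2 * H - 1))) := by
  refine Measurable.lintegral_prod_right' (f := fun q : β × ℝ =>
      ENNReal.ofReal (f q.1 q.2 ^ 2 * (q.2 ^ (2 * H - 1) + (1 - q.2) ^ (2 * H - 1)))) ?_
  have h1 : Measurable fun q : β × ℝ => f q.1 q.2 := hf
  fun_prop

lemma measurable_spaceNormSq {β : Type*} [MeasurableSpace β] {f : β → ℝ → ℝ}
    (hf : Measurable (Function.uncurry f)) :
    Measurable fun s => spaceNormSq H (f s) :=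
  ((measurable_lintegral_seminorm hf).const_mul _).add ((measurable_lintegral_weight hf).const_mul _)

lemma noiseNormSq_eq_lintegral {f : ℝ → ℝ → ℝ} (hf : Measurable (Function.uncurry f)) :
    noiseNormSq H T f = ∫⁻ s in Icc 0 T, spaceNormSq H (f s) := by
  unfold noiseNormSq spaceNormSq
  rw [lintegral_add_left ((measurable_lintegral_seminorm hf).const_mul _),
    lintegral_const_mul _ (measurable_lintegral_seminorm hf),
    lintegral_const_mul _ (measurable_lintegral_weight hf)]

lemma spaceNormSq_const_mul (c : ℝ) (v : ℝ → ℝ) :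
    spaceNormSq H (fun y => c * v y) = ENNReal.ofReal (c ^ 2) * spaceNormSq H v := by
  have e1 : ∀ a b r : ℝ, ENNReal.ofReal ((c * a - c * b) ^ 2 / r) =
      ENNReal.ofReal (c ^ 2) * ENNReal.ofReal ((a - b) ^ 2 / r) := fun a b r => by
    rw [← ENNReal.ofReal_mul (sq_nonneg c)]; congr 1; ring
  have e2 : ∀ a r : ℝ, ENNReal.ofReal ((c * a) ^ 2 * r) =
      ENNReal.ofReal (c ^ 2) * ENNReal.ofReal (a ^ 2 * r) := fun a r => by
    rw [← ENNReal.ofReal_mul (sq_nonneg c)]; congr 1; ring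
  unfold spaceNormSq
  simp_rw [e1, e2, lintegral_const_mul' _ _ (ENNReal.ofReal_ne_top (r := c ^ 2))]
  ring

/-- The pointwise bound `(a + b)² ≤ 2a² + 2b²` stands in for the triangle inequality; it costs only
constants and avoids square roots. -/
lemma spaceNormSq_add_le {v w : ℝ → ℝ} (hv : Measurable v) :
    spaceNormSq H (fun y => v y + w y) ≤ 2 * spaceNormSq H v + 2 * spaceNormSq H w := by
  have key (a b r : ℝ) (hr : 0 ≤ r) : ENNReal.ofReal ((a + b) ^ 2 * r) ≤
      2 * ENNReal.ofReal (a ^ 2 * r) + 2 * ENNReal.ofReal (b ^ 2 * r) := by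
    rw [← mul_add, ← ENNReal.ofReal_add (by positivity) (by positivity),
      show (2 : ℝ≥0∞) = ENNReal.ofReal 2 by simp, ← ENNReal.ofReal_mul (by norm_num)]
    apply ENNReal.ofReal_le_ofReal
    nlinarith [mul_nonneg (sq_nonneg (a - b)) hr]
  have m1 (x : ℝ) : Measurable fun y => ENNReal.ofReal ((v x - v y) ^ 2 / |x - y| ^ (2 - 2 * H)) := by
    fun_prop
  have m2 : Measurable fun x => ∫⁻ y in Ioo 0 1,
      ENNReal.ofReal ((v x - v y) ^ 2 / |x - y| ^ (2 - 2 * H)) := by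
    refine Measurable.lintegral_prod_right' (f := fun q : ℝ × ℝ =>
      ENNReal.ofReal ((v q.1 - v q.2) ^ 2 / |q.1 - q.2| ^ (2 - 2 * H))) ?_
    fun_prop
  have e1 : (∫⁻ x in Ioo 0 1, ∫⁻ y in Ioo 0 1,
        ENNReal.ofReal (((v x + w x) - (v y + w y)) ^ 2 / |x - y| ^ (2 - 2 * H))) ≤
      2 * (∫⁻ x in Ioo 0 1, ∫⁻ y in Ioo 0 1,
        ENNReal.ofReal ((v x - v y) ^ 2 / |x - y| ^ (2 - 2 * H))) +
      2 * (∫⁻ x in Ioo 0 1, ∫⁻ y in Ioo 0 1,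
        ENNReal.ofReal ((w x - w y) ^ 2 / |x - y| ^ (2 - 2 * H))) := by
    rw [← lintegral_const_mul _ m2, ← lintegral_const_mul' _ _ (by simp),
      ← lintegral_add_left (m2.const_mul _)]
    refine lintegral_mono fun x => ?_
    rw [← lintegral_const_mul _ (m1 x), ← lintegral_const_mul' _ _ (by simp),
      ← lintegral_add_left ((m1 x).const_mul _)]
    refine lintegral_mono fun y => ?_
    rw [show v x + w x - (v y + w y) = (v x - v y) + (w x - w y) by ring]
    simp only [div_eq_mul_inv]
    exact key _ _ _ (by positivity)
  have m3 : Measurable fun x => ENNReal.ofReal (v x ^ 2 * (x ^ (2 * H - 1) + (1 - x) ^ (2 * H - 1))) := by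
    fun_prop
  have e2 : (∫⁻ x in Ioo 0 1,
        ENNReal.ofReal ((v x + w x) ^ 2 * (x ^ (2 * H - 1) + (1 - x) ^ (2 * H - 1)))) ≤
      2 * (∫⁻ x in Ioo 0 1,
        ENNReal.ofReal (v x ^ 2 * (x ^ (2 * H - 1) + (1 - x) ^ (2 * H - 1)))) +
      2 * (∫⁻ x in Ioo 0 1,
        ENNReal.ofReal (w x ^ 2 * (x ^ (2 * H - 1) + (1 - x) ^ (2 * H - 1)))) := by
    rw [← lintegral_const_mul _ m3, ← lintegral_const_mul' _ _ (by simp),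
      ← lintegral_add_left (m3.const_mul _)]
    refine setLIntegral_mono' measurableSet_Ioo fun x hx => ?_
    have := hx.1.le
    have : 0 ≤ 1 - x := by linarith [hx.2]
    exact key _ _ _ (by positivity)
  unfold spaceNormSq
  calc _ ≤ _ := add_le_add (mul_le_mul_right e1 _) (mul_le_mul_right e2 _)
    _ = _ := by ring

lemma noiseNormSq_add_le {f g : ℝ → ℝ → ℝ} (hf : Measurable (Function.uncurry f))
    (hg : Measurable (Function.uncurry g)) :
    noiseNormSq H T (fun s y => f s y + g s y) ≤
      2 * noiseNormSq H T f + 2 * noiseNormSq H T g := by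
  rw [noiseNormSq_eq_lintegral hf, noiseNormSq_eq_lintegral hg, noiseNormSq_eq_lintegral
    (f := fun s y => f s y + g s y) (hf.add hg),
    ← lintegral_const_mul _ (measurable_spaceNormSq hf),
    ← lintegral_const_mul _ (measurable_spaceNormSq hg),
    ← lintegral_add_left ((measurable_spaceNormSq hf).const_mul _)]
  refine lintegral_mono fun s => spaceNormSq_add_le ?_
  exact hf.comp measurable_prodMk_left

/-- The noise is white in time, so its norm is the tensor product of `L²` in time and the fractional
norm in space. This decouples the temporal and spatial estimates of each mode. -/
lemma noiseNormSq_mul {u v : ℝ → ℝ} (hu : Measurable u) (hv : Measurable v) :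
    noiseNormSq H T (fun s y => u s * v y) =
      (∫⁻ s in Icc 0 T, ENNReal.ofReal (u s ^ 2)) * spaceNormSq H v := by
  rw [noiseNormSq_eq_lintegral (f := fun s y => u s * v y) (by unfold Function.uncurry; fun_prop)]
  simp_rw [spaceNormSq_const_mul]
  rw [lintegral_mul_const _ (by fun_prop)]

lemma noiseNormSq_neg (f : ℝ → ℝ → ℝ) :
    noiseNormSq H T (fun s y => - f s y) = noiseNormSq H T f := by
  have e1 : ∀ a b : ℝ, (-a - -b) ^ 2 = (a - b) ^ 2 := fun a b => by ring
  simp only [noiseNormSq, e1, neg_sq]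

/-- The fundamental theorem of calculus for a nonnegative, possibly unbounded derivative. -/
lemma lintegral_ofReal_deriv {g g' : ℝ → ℝ} {a b : ℝ} (hab : a ≤ b) (hc : ContinuousOn g (Icc a b))
    (hd : ∀ x ∈ Ioo a b, HasDerivAt g (g' x) x) (hn : ∀ x ∈ Ioo a b, 0 ≤ g' x) :
    ∫⁻ x in Ioo a b, ENNReal.ofReal (g' x) = ENNReal.ofReal (g b - g a) := by
  have hi := intervalIntegral.integrableOn_deriv_of_nonneg hc hd hn
  rw [← intervalIntegral.integral_eq_sub_of_hasDerivAt_of_le hab hc hd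
    ((intervalIntegrable_iff_integrableOn_Ioc_of_le hab).2 hi),
    intervalIntegral.integral_of_le hab, ← restrict_Ioo_eq_restrict_Ioc,
    ofReal_integral_eq_lintegral_ofReal (hi.mono_set Ioo_subset_Ioc_self)]
  exact (ae_restrict_iff' measurableSet_Ioo).2 (Eventually.of_forall hn)

end Norms

/-! ### The fractional norm of indicator functions and the covariance of fractional Brownian motion
-/

/-- The covariance function of fractional Brownian motion. -/
def fbmCov (H x y : ℝ) : ℝ := (x ^ (2 * H) + y ^ (2 * H) - |x - y| ^ (2 * H)) / 2

/-- The indicator function of `(0,b]`. -/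
def cut (b : ℝ) : ℝ → ℝ := (Ioc 0 b).indicator fun _ => 1

lemma cut_apply (b x : ℝ) : cut b x = if 0 < x ∧ x ≤ b then 1 else 0 := by
  simp [cut, indicator_apply]

@[fun_prop]
lemma measurable_cut (b : ℝ) : Measurable (cut b) :=
  measurable_const.indicator measurableSet_Ioc

section Gram

variable {H T : ℝ}

lemma Ioc_inter_Ioo_ae_eq {b : ℝ} (hb : b ≤ 1) :
    (Ioc 0 b ∩ Ioo 0 1 : Set ℝ) =ᵐ[volume] (Ioo 0 b : Set ℝ) := by
  have h := (Ioo_ae_eq_Ioc (μ := volume) (a := (0 : ℝ)) (b := b)).symm.inter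
    (ae_eq_refl (Ioo (0 : ℝ) 1))
  rwa [inter_eq_left.2 (Ioo_subset_Ioo_right hb)] at h

/-- The product of differences is `1` when one of the points is at most `b` and the other exceeds
`d`, and `0` otherwise. The integral is therefore twice that of `(y - x)^{2H-2}` over `(0,b) ×
(d,1)`. It is finite even for `b = d`, since the inner integral leaves only the integrable
singularity `(d - x)^{2H-1}`. -/
lemma lintegral_seminorm_cut (hH : 0 < H) (hH' : H < 1 / 2) {b d : ℝ} (hb : 0 ≤ b) (hbd : b ≤ d)
    (hd : d ≤ 1) :
    ∫⁻ x in Ioo 0 1, ∫⁻ y in Ioo 0 1, ENNReal.ofReal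
      ((cut b x - cut b y) * (cut d x - cut d y) * (|x - y| ^ (2 - 2 * H))⁻¹) =
    ENNReal.ofReal
      ((d ^ (2 * H) - (d - b) ^ (2 * H) - 1 + (1 - b) ^ (2 * H)) / (H * (1 - 2 * H))) := by
  have h12 : 0 < 1 - 2 * H := by linarith
  -- `F` is the half of the integrand with `x ≤ b` and `y > d`; the other half is its mirror image.
  let F : ℝ → ℝ → ℝ≥0∞ := fun x y =>
    (Ioc 0 b).indicator (fun x => (Ioo d 1).indicator
      (fun y => ENNReal.ofReal ((y - x) ^ (2 * H - 2))) y) x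
  have hFm : Measurable (Function.uncurry F) := by
    have : Function.uncurry F = (Ioc 0 b ×ˢ Ioo d 1).indicator
        (fun z => ENNReal.ofReal ((z.2 - z.1) ^ (2 * H - 2))) := by
      ext ⟨x, y⟩
      simp only [Function.uncurry, F, indicator_apply, mem_prod]
      split_ifs <;> simp_all
    rw [this]
    exact Measurable.indicator (by fun_prop) (measurableSet_Ioc.prod measurableSet_Ioo)
  have hpt : ∀ x ∈ Ioo (0 : ℝ) 1, ∀ y ∈ Ioo (0 : ℝ) 1, ENNReal.ofReal
      ((cut b x - cut b y) * (cut d x - cut d y) * (|x - y| ^ (2 - 2 * H))⁻¹) = F x y + F y x := by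
    intro x hx y hy
    simp only [cut_apply, F, indicator_apply, mem_Ioc, mem_Ioo, hx.1, hy.1, hx.2, hy.2, true_and,
      and_true]
    have e1 : ∀ u v : ℝ, u < v → (v - u) ^ (2 * H - 2) = (|u - v| ^ (2 - 2 * H))⁻¹ := by
      intro u v huv
      rw [abs_sub_comm, abs_of_pos (by linarith), ← Real.rpow_neg (by linarith)]
      congr 1; ring
    by_cases h1 : x ≤ b
    · have h2 : x ≤ d := h1.trans hbd
      by_cases h3 : y ≤ b
      · have h4 : y ≤ d := h3.trans hbd
        simp [h1, h2, h3, h4, not_lt.2 h2, not_lt.2 h4]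
      · by_cases h4 : y ≤ d
        · simp [h1, h2, h3, h4]
        · simp only [h1, h2, h3, h4, e1 x y (by linarith), not_lt.2 h2, not_le.1 h4]
          norm_num
    · by_cases h3 : y ≤ b
      · have h4 : y ≤ d := h3.trans hbd
        by_cases h2 : x ≤ d
        · simp [h1, h2, h3, h4]
        · simp only [h1, h2, h3, h4, e1 y x (by linarith), abs_sub_comm y x, not_lt.2 h4, not_le.1 h2]
          norm_num
      · simp [h1, h3]
  have hinner : ∀ x ∈ Ioo 0 b, ∫⁻ y in Ioo 0 1, F x y =
      ENNReal.ofReal (((d - x) ^ (2 * H - 1) - (1 - x) ^ (2 * H - 1)) / (1 - 2 * H)) := by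
    intro x hx
    simp only [F, indicator_of_mem (Ioo_subset_Ioc_self hx)]
    rw [setLIntegral_indicator measurableSet_Ioo, inter_eq_left.2 (Ioo_subset_Ioo_left (hb.trans hbd)),
      lintegral_ofReal_deriv (g := fun y => -((y - x) ^ (2 * H - 1) / (1 - 2 * H))) hd]
    · congr 1; ring
    · refine ContinuousOn.neg (ContinuousOn.div_const (ContinuousOn.rpow_const (by fun_prop) ?_) _)
      intro y hy; left; linarith [hy.1, hx.2]
    · intro y hy
      have := (((hasDerivAt_id y).sub_const x).rpow_const (p := 2 * H - 1)
        (Or.inl (by simp; linarith [hy.1, hx.2]))).div_const (1 - 2 * H) |>.neg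
      refine this.congr_deriv ?_
      rw [show 2 * H - 1 - 1 = 2 * H - 2 by ring]
      simp only [id]
      field_simp
      ring_nf
    · intro y hy; exact Real.rpow_nonneg (by linarith [hy.1, hx.2]) _
  have hF : ∫⁻ x in Ioo 0 1, ∫⁻ y in Ioo 0 1, F x y = ENNReal.ofReal
      ((d ^ (2 * H) - (d - b) ^ (2 * H) - 1 + (1 - b) ^ (2 * H)) / (2 * (H * (1 - 2 * H)))) := by
    have : ∀ x, ∫⁻ y in Ioo 0 1, F x y = (Ioc 0 b).indicator (fun x => ∫⁻ y in Ioo 0 1, F x y) x := by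
      intro x
      by_cases hx : x ∈ Ioc 0 b
      · simp [hx]
      · simp [hx, F]
    rw [lintegral_congr this]
    have hbs := Ioc_inter_Ioo_ae_eq (b := b) (hbd.trans hd)
    rw [setLIntegral_indicator measurableSet_Ioc, setLIntegral_congr hbs,
      setLIntegral_congr_fun measurableSet_Ioo hinner,
      lintegral_ofReal_deriv (g := fun x => (-(d - x) ^ (2 * H) + (1 - x) ^ (2 * H)) /
        (2 * H * (1 - 2 * H))) hb]
    · congr 1
      simp only [sub_zero, Real.one_rpow]
      field_simp
      ring
    · refine ContinuousOn.div_const (ContinuousOn.add (ContinuousOn.neg (ContinuousOn.rpow_const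
        (by fun_prop) ?_)) (ContinuousOn.rpow_const (by fun_prop) ?_)) _ <;>
      · intro y hy; right; linarith
    · intro x hx
      have h1 := ((hasDerivAt_id x).const_sub d).rpow_const (p := 2 * H)
        (Or.inl (by simp; linarith [hx.2]))
      have h2 := ((hasDerivAt_id x).const_sub 1).rpow_const (p := 2 * H)
        (Or.inl (by simp; linarith [hx.2]))
      refine ((h1.neg.add h2).div_const (2 * H * (1 - 2 * H))).congr_deriv ?_
      simp only [id]
      field_simp
      ring
    · intro x hx
      refine div_nonneg (sub_nonneg.2 ?_) h12.le
      exact Real.rpow_le_rpow_of_nonpos (by linarith [hx.2]) (by linarith) (by linarith)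
  have hx1 : ∀ x ∈ Ioo (0 : ℝ) 1, ∫⁻ y in Ioo 0 1, ENNReal.ofReal
      ((cut b x - cut b y) * (cut d x - cut d y) * (|x - y| ^ (2 - 2 * H))⁻¹) =
      ∫⁻ y in Ioo 0 1, (F x y + F y x) := fun x hx =>
    setLIntegral_congr_fun measurableSet_Ioo (hpt x hx)
  rw [setLIntegral_congr_fun measurableSet_Ioo hx1]
  have hm1 : ∀ x, Measurable (F x) := fun x => hFm.comp measurable_prodMk_left
  simp_rw [lintegral_add_left (hm1 _)]
  rw [lintegral_add_left (Measurable.lintegral_prod_right hFm),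
    lintegral_lintegral_swap (f := fun x y => F y x) (hFm.comp measurable_swap).aemeasurable, hF,
    ← two_mul, show (2 : ℝ≥0∞) = ENNReal.ofReal 2 by simp, ← ENNReal.ofReal_mul (by norm_num)]
  congr 1
  field_simp

lemma lintegral_weight_cut (hH : 0 < H) {b d : ℝ} (hb : 0 ≤ b) (hbd : b ≤ d) (hd : d ≤ 1) :
    ∫⁻ x in Ioo 0 1, ENNReal.ofReal
      (cut b x * cut d x * (x ^ (2 * H - 1) + (1 - x) ^ (2 * H - 1))) =
    ENNReal.ofReal ((b ^ (2 * H) + 1 - (1 - b) ^ (2 * H)) / (2 * H)) := by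
  have : ∀ x, ENNReal.ofReal (cut b x * cut d x * (x ^ (2 * H - 1) + (1 - x) ^ (2 * H - 1))) =
      (Ioc 0 b).indicator (fun x => ENNReal.ofReal (x ^ (2 * H - 1) + (1 - x) ^ (2 * H - 1))) x := by
    intro x
    by_cases hx : x ∈ Ioc 0 b
    · simp [hx.1, hx.2, cut_apply, hx.2.trans hbd]
    · simp [hx, cut]
  have hbs := Ioc_inter_Ioo_ae_eq (b := b) (hbd.trans hd)
  simp_rw [this]
  rw [setLIntegral_indicator measurableSet_Ioc, setLIntegral_congr hbs,
      lintegral_ofReal_deriv (g := fun x => (x ^ (2 * H) - (1 - x) ^ (2 * H)) / (2 * H)) hb]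
  · congr 1
    simp [hH.ne']
    ring
  · refine ContinuousOn.div_const (ContinuousOn.sub (ContinuousOn.rpow_const
        (by fun_prop) ?_) (ContinuousOn.rpow_const (by fun_prop) ?_)) _ <;>
    · intro y hy; right; linarith
  · intro x hx
    have h1 := ((hasDerivAt_id x)).rpow_const (p := 2 * H)
        (Or.inl (by simp; linarith [hx.1]))
    have h2 := ((hasDerivAt_id x).const_sub 1).rpow_const (p := 2 * H)
        (Or.inl (by simp; linarith [hx.2]))
    refine ((h1.sub h2).div_const (2 * H)).congr_deriv ?_
    simp only [id]
    field_simp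
    ring
  · intro x hx
    have := hx.1.le
    have : 0 ≤ 1 - x := by linarith [hx.2]
    positivity

/-- The square integral of a finite linear combination in terms of the Gram matrix. -/
lemma lintegral_sq_sum_eq_gram {α ι : Type*} [MeasurableSpace α] {μ : Measure α} {u : ι → α → ℝ}
    {r : α → ℝ} {s : Finset ι} {a : ι → ℝ} {Q : ι → ι → ℝ} (hu : ∀ i, Measurable (u i))
    (hr : Measurable r) (hr0 : ∀ᵐ x ∂μ, 0 ≤ r x)
    (hn : ∀ i ∈ s, ∀ j ∈ s, ∀ᵐ x ∂μ, 0 ≤ u i x * u j x * r x) (hQ : ∀ i ∈ s, ∀ j ∈ s, 0 ≤ Q i j)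
    (hg : ∀ i ∈ s, ∀ j ∈ s, ∫⁻ x, ENNReal.ofReal (u i x * u j x * r x) ∂μ = ENNReal.ofReal (Q i j)) :
    ∫⁻ x, ENNReal.ofReal ((∑ i ∈ s, a i * u i x) ^ 2 * r x) ∂μ =
      ENNReal.ofReal (∑ i ∈ s, ∑ j ∈ s, a i * a j * Q i j) ∧
    0 ≤ ∑ i ∈ s, ∑ j ∈ s, a i * a j * Q i j := by
  -- The coefficients may have either sign, so the square can only be expanded under the Bochner
  -- integral; integrability comes from the finite values in `hg`.
  have hint : ∀ i ∈ s, ∀ j ∈ s, Integrable (fun x => u i x * u j x * r x) μ := by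
    intro i hi j hj
    refine ⟨by fun_prop, ?_⟩
    rw [hasFiniteIntegral_iff_ofReal (hn i hi j hj), hg i hi j hj]
    exact ENNReal.ofReal_lt_top
  have hval : ∀ i ∈ s, ∀ j ∈ s, ∫ x, u i x * u j x * r x ∂μ = Q i j := by
    intro i hi j hj
    rw [integral_eq_lintegral_of_nonneg_ae (hn i hi j hj) (by fun_prop), hg i hi j hj,
      ENNReal.toReal_ofReal (hQ i hi j hj)]
  have hexp : ∀ x, (∑ i ∈ s, a i * u i x) ^ 2 * r x =
      ∑ i ∈ s, ∑ j ∈ s, a i * a j * (u i x * u j x * r x) := by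
    intro x
    rw [sq, Finset.sum_mul_sum, Finset.sum_mul]
    refine Finset.sum_congr rfl fun i _ => ?_
    rw [Finset.sum_mul]
    exact Finset.sum_congr rfl fun j _ => by ring
  have hI : Integrable (fun x => (∑ i ∈ s, a i * u i x) ^ 2 * r x) μ := by
    simp_rw [hexp]
    exact integrable_finsetSum _ fun i hi => integrable_finsetSum _ fun j hj =>
      (hint i hi j hj).const_mul _
  have hnn : ∀ᵐ x ∂μ, 0 ≤ (∑ i ∈ s, a i * u i x) ^ 2 * r x := by
    filter_upwards [hr0] with x hx
    positivity
  have hv : ∫ x, (∑ i ∈ s, a i * u i x) ^ 2 * r x ∂μ = ∑ i ∈ s, ∑ j ∈ s, a i * a j * Q i j := by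
    simp_rw [hexp]
    rw [integral_finsetSum _ fun i hi => integrable_finsetSum _ fun j hj =>
      (hint i hi j hj).const_mul _]
    refine Finset.sum_congr rfl fun i hi => ?_
    rw [integral_finsetSum _ fun j hj => (hint i hi j hj).const_mul _]
    refine Finset.sum_congr rfl fun j hj => ?_
    rw [integral_const_mul, hval i hi j hj]
  rw [← hv]
  exact ⟨(ofReal_integral_eq_lintegral_ofReal hI hnn).symm, integral_nonneg_of_ae hnn⟩

/-- On the positive axis both indicators are nonincreasing, so their increments never have opposite
signs. -/
lemma cut_sub_mul_cut_sub_nonneg (b d x y : ℝ) (hx : 0 < x) (hy : 0 < y) :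
    0 ≤ (cut b x - cut b y) * (cut d x - cut d y) := by
  simp only [cut_apply, hx, hy, true_and]
  split_ifs <;> norm_num <;> linarith

/-- The pair `q`, `1 - p` has the same sum as the pair `q - p`, `1` and lies between its members, so
concavity of the power favours it. It is needed for the sign of the Gram entries of the seminorm. -/
lemma rpow_add_rpow_le_of_concave {p q s : ℝ} (hp : 0 ≤ p) (hpq : p ≤ q) (hq : q ≤ 1) (hs : 0 ≤ s)
    (hs1 : s ≤ 1) : (q - p) ^ s + 1 ≤ q ^ s + (1 - p) ^ s := by
  by_cases h1 : q - p = 1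
  · have hp0 : p = 0 := by linarith
    have hq1 : q = 1 := by linarith
    simp [hp0, hq1]
  have hr : 0 < 1 - (q - p) := by
    rcases lt_or_eq_of_le (show q - p ≤ 1 by linarith) with h | h
    · linarith
    · exact absurd h h1
  have hc := Real.concaveOn_rpow hs hs1
  -- This is the weight of `1` when `q` is written as a convex combination of `1` and `q - p`; the
  -- complementary weights yield `1 - p`.
  have l0 : 0 ≤ p / (1 - (q - p)) := by positivity
  have l1 : 0 ≤ 1 - p / (1 - (q - p)) := by
    rw [sub_nonneg, div_le_one hr]; linarith
  have c1 := hc.2 (x := 1) (y := q - p) (by simp) (by simpa using hpq) l0 l1 (by ring)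
  have c2 := hc.2 (x := 1) (y := q - p) (by simp) (by simpa using hpq) l1 l0 (by ring)
  have e1 : p / (1 - (q - p)) * 1 + (1 - p / (1 - (q - p))) * (q - p) = q := by
    field_simp; ring
  have e2 : (1 - p / (1 - (q - p))) * 1 + p / (1 - (q - p)) * (q - p) = 1 - p := by
    field_simp; ring
  simp only [smul_eq_mul, e1, e2, Real.one_rpow] at c1 c2
  linarith

/-- The isometry in space. For `b ≤ d` the seminorm contributes `(d^{2H} - (d-b)^{2H} - 1 +
(1-b)^{2H}) / 2` and the weight `(b^{2H} + 1 - (1-b)^{2H}) / 2`; the boundary terms at `1` cancel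
and `fbmCov` remains. For `H = 1/2` the weight alone gives `min b d`. The nonnegativity is stated as
well, so that `ENNReal.ofReal` can later be taken out of the time integral. -/
lemma spaceNormSq_sum_cut (hH : 0 < H) (hH' : H ≤ 1 / 2) {ι : Type*} (s : Finset ι) (a b : ι → ℝ)
    (hb : ∀ i ∈ s, b i ∈ Icc (0 : ℝ) 1) :
    spaceNormSq H (fun y => ∑ i ∈ s, a i * cut (b i) y) =
      ENNReal.ofReal (∑ i ∈ s, ∑ j ∈ s, a i * a j * fbmCov H (b i) (b j)) ∧
    0 ≤ ∑ i ∈ s, ∑ j ∈ s, a i * a j * fbmCov H (b i) (b j) := by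
  let Q2 : ι → ι → ℝ := fun i j =>
    ((min (b i) (b j)) ^ (2 * H) + 1 - (1 - min (b i) (b j)) ^ (2 * H)) / (2 * H)
  let Q1 : ι → ι → ℝ := fun i j =>
    ((max (b i) (b j)) ^ (2 * H) - (max (b i) (b j) - min (b i) (b j)) ^ (2 * H) - 1 +
      (1 - min (b i) (b j)) ^ (2 * H)) / (H * (1 - 2 * H))
  have hmin : ∀ i ∈ s, ∀ j ∈ s, 0 ≤ min (b i) (b j) ∧ max (b i) (b j) ≤ 1 := fun i hi j hj =>
    ⟨le_min (hb i hi).1 (hb j hj).1, max_le (hb i hi).2 (hb j hj).2⟩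
  have hw : ∀ᵐ x ∂(volume.restrict (Ioo (0 : ℝ) 1)), 0 ≤ x ^ (2 * H - 1) + (1 - x) ^ (2 * H - 1) := by
    refine (ae_restrict_iff' measurableSet_Ioo).2 (Eventually.of_forall fun x hx => ?_)
    have := hx.1.le
    have : 0 ≤ 1 - x := by linarith [hx.2]
    positivity
  -- The Gram entries were computed for ordered pairs; products of indicators are symmetric, so
  -- passing to minimum and maximum changes nothing.
  have hcm : ∀ b d x, cut (min b d) x * cut (max b d) x = cut b x * cut d x := fun b d x => by
    rcases le_total b d with h | h <;> simp [h, mul_comm]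
  have E2 := lintegral_sq_sum_eq_gram (μ := volume.restrict (Ioo (0 : ℝ) 1)) (s := s) (a := a)
    (u := fun i => cut (b i)) (r := fun x => x ^ (2 * H - 1) + (1 - x) ^ (2 * H - 1)) (Q := Q2)
    (by fun_prop) (by fun_prop) hw
    (fun i _ j _ => by
      filter_upwards [hw] with x hx
      refine mul_nonneg (mul_nonneg ?_ ?_) hx <;> (rw [cut_apply]; split_ifs <;> norm_num))
    (fun i hi j hj => by
      have h := hmin i hi j hj
      refine div_nonneg ?_ (by positivity)
      have : (1 - min (b i) (b j)) ^ (2 * H) ≤ 1 :=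
        Real.rpow_le_one (by linarith [min_le_max (a := b i) (b := b j)]) (by linarith) (by linarith)
      have := Real.rpow_nonneg h.1 (2 * H)
      linarith)
    (fun i hi j hj => by
      rw [← lintegral_weight_cut hH (hmin i hi j hj).1 min_le_max (hmin i hi j hj).2]
      simp_rw [hcm])
  rcases hH'.lt_or_eq with hlt | rfl
  · have h12 : 0 < 1 - 2 * H := by linarith
    have hcs : ∀ b d x y, (cut (min b d) x - cut (min b d) y) * (cut (max b d) x - cut (max b d) y)
        = (cut b x - cut b y) * (cut d x - cut d y) := fun b d x => by
      rcases le_total b d with h | h <;> simp [h, mul_comm]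
    have hpos : ∀ᵐ z ∂((volume.restrict (Ioo (0 : ℝ) 1)).prod (volume.restrict (Ioo (0 : ℝ) 1))),
        0 < z.1 ∧ 0 < z.2 := by
      rw [Measure.prod_restrict]
      exact (ae_restrict_iff' (measurableSet_Ioo.prod measurableSet_Ioo)).2
        (Eventually.of_forall fun z hz => ⟨hz.1.1, hz.2.1⟩)
    have E1 := lintegral_sq_sum_eq_gram
      (μ := (volume.restrict (Ioo (0 : ℝ) 1)).prod (volume.restrict (Ioo (0 : ℝ) 1))) (s := s) (a := a)
      (u := fun i z => cut (b i) z.1 - cut (b i) z.2) (r := fun z => (|z.1 - z.2| ^ (2 - 2 * H))⁻¹)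
      (Q := Q1) (by fun_prop) (by fun_prop) (Eventually.of_forall fun z => by positivity)
      (fun i _ j _ => by
        filter_upwards [hpos] with z hz
        exact mul_nonneg (cut_sub_mul_cut_sub_nonneg _ _ _ _ hz.1 hz.2) (by positivity))
      (fun i hi j hj => by
        have h := hmin i hi j hj
        have hmm := min_le_max (a := b i) (b := b j)
        refine div_nonneg ?_ (by positivity)
        set p := min (b i) (b j)
        set q := max (b i) (b j)
        have := rpow_add_rpow_le_of_concave (p := p) (q := q) (s := 2 * H) h.1 hmm h.2 (by linarith)
          (by linarith)
        linarith)
      (fun i hi j hj => by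
        rw [← lintegral_seminorm_cut hH hlt (hmin i hi j hj).1 min_le_max (hmin i hi j hj).2]
        rw [lintegral_prod _ (by fun_prop)]
        simp_rw [hcs])
    have hR : ∑ i ∈ s, ∑ j ∈ s, a i * a j * fbmCov H (b i) (b j) =
        H * (1 - 2 * H) / 2 * ∑ i ∈ s, ∑ j ∈ s, a i * a j * Q1 i j +
          H * ∑ i ∈ s, ∑ j ∈ s, a i * a j * Q2 i j := by
      simp only [Finset.mul_sum, ← Finset.sum_add_distrib]
      refine Finset.sum_congr rfl fun i _ => Finset.sum_congr rfl fun j _ => ?_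
      simp only [Q1, Q2, fbmCov]
      rcases le_total (b i) (b j) with h | h
      · rw [min_eq_left h, max_eq_right h, abs_sub_comm, abs_of_nonneg (sub_nonneg.2 h)]
        field_simp; ring
      · rw [min_eq_right h, max_eq_left h, abs_of_nonneg (sub_nonneg.2 h)]
        field_simp; ring
    rw [hR]
    have hc : 0 ≤ H * (1 - 2 * H) / 2 := by positivity
    refine ⟨?_, add_nonneg (mul_nonneg hc E1.2) (mul_nonneg hH.le E2.2)⟩
    rw [ENNReal.ofReal_add (mul_nonneg hc E1.2) (mul_nonneg hH.le E2.2), ENNReal.ofReal_mul hc,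
      ENNReal.ofReal_mul hH.le, ← E1.1, ← E2.1, lintegral_prod _ (by fun_prop)]
    simp only [spaceNormSq, div_eq_mul_inv, ← Finset.sum_sub_distrib, mul_sub]
  · have hR : ∑ i ∈ s, ∑ j ∈ s, a i * a j * fbmCov (1 / 2) (b i) (b j) =
        1 / 2 * ∑ i ∈ s, ∑ j ∈ s, a i * a j * Q2 i j := by
      simp only [Finset.mul_sum]
      refine Finset.sum_congr rfl fun i _ => Finset.sum_congr rfl fun j _ => ?_
      simp only [Q2, fbmCov]
      rcases le_total (b i) (b j) with h | h
      · rw [min_eq_left h, abs_sub_comm, abs_of_nonneg (sub_nonneg.2 h)]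
        norm_num; ring
      · rw [min_eq_right h, abs_of_nonneg (sub_nonneg.2 h)]
        norm_num; ring
    rw [hR]
    refine ⟨?_, mul_nonneg hH.le E2.2⟩
    rw [ENNReal.ofReal_mul hH.le, ← E2.1]
    simp [spaceNormSq]

end Gram

/-! ### The isometry and Gaussian moments of stochastic integrals -/

section Isometry

/-- The integral of the combination `∑ l_z χ_{(0,t_z] × (0,x_z]}` with respect to the noise. -/
def sheetInt {Ω : Type*} {T : ℝ} (W : ℝ → ℝ → Ω → ℝ) :
    ((Icc (0 : ℝ) T × Icc (0 : ℝ) 1) →₀ ℝ) →ₗ[ℝ] (Ω → ℝ) :=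
  Finsupp.linearCombination ℝ fun z => W z.1 z.2

/-- The function `∑ l_z χ_{(0,t_z] × (0,x_z]}`. -/
def sheetFun {T : ℝ} : ((Icc (0 : ℝ) T × Icc (0 : ℝ) 1) →₀ ℝ) →ₗ[ℝ] (ℝ → ℝ → ℝ) :=
  Finsupp.linearCombination ℝ fun z s y => cut z.1 s * cut z.2 y

variable {Ω : Type*} {H T : ℝ} {W : ℝ → ℝ → Ω → ℝ}

lemma sheetInt_apply (l : (Icc (0 : ℝ) T × Icc (0 : ℝ) 1) →₀ ℝ) (ω : Ω) :
    sheetInt W l ω = ∑ z ∈ l.support, l z * W z.1 z.2 ω := by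
  simp [sheetInt, Finsupp.linearCombination_apply, Finsupp.sum, Finset.sum_apply]

lemma sheetFun_apply (l : (Icc (0 : ℝ) T × Icc (0 : ℝ) 1) →₀ ℝ) (s y : ℝ) :
    sheetFun l s y = ∑ z ∈ l.support, l z * cut z.1 s * cut z.2 y := by
  simp [sheetFun, Finsupp.linearCombination_apply, Finsupp.sum, Finset.sum_apply, mul_assoc]

lemma StepFun.a_mem (F : StepFun T) {i : ℕ} (hi : i ≤ F.M) : F.a i ∈ Icc 0 T := by
  have mono : ∀ i j, i ≤ j → j ≤ F.M → F.a i ≤ F.a j := by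
    intro i j hij
    induction j, hij using Nat.le_induction with
    | base => exact fun _ => le_rfl
    | succ j _ ih => exact fun h => (ih (by omega)).trans (F.a_lt j (by omega)).le
  have h0 := mono 0 i (Nat.zero_le _) hi
  have h1 := mono i F.M hi le_rfl
  rw [F.a_zero] at h0
  rw [F.a_last] at h1
  exact ⟨h0, h1⟩

lemma StepFun.b_mem (F : StepFun T) {j : ℕ} (hj : j ≤ F.N) : F.b j ∈ Icc (0 : ℝ) 1 := by
  have mono : ∀ i j, i ≤ j → j ≤ F.N → F.b i ≤ F.b j := by
    intro i j hij
    induction j, hij using Nat.le_induction with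
    | base => exact fun _ => le_rfl
    | succ j _ ih => exact fun h => (ih (by omega)).trans (F.b_lt j (by omega)).le
  have h0 := mono 0 j (Nat.zero_le _) hj
  have h1 := mono j F.N hj le_rfl
  rw [F.b_zero] at h0
  rw [F.b_last] at h1
  exact ⟨h0, h1⟩

/-- A step function as a combination of indicator functions of rectangles `(0,t] × (0,x]`. -/
def StepFun.toFinsupp (F : StepFun T) (hT : 0 ≤ T) : (Icc (0 : ℝ) T × Icc (0 : ℝ) 1) →₀ ℝ :=
  -- The grid points already lie in the intervals; the projections only supply the membership
  -- proofs.
  let z : ℕ → ℕ → Icc (0 : ℝ) T × Icc (0 : ℝ) 1 := fun i j =>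
    (projIcc 0 T hT (F.a i), projIcc 0 1 zero_le_one (F.b j))
  ∑ i ∈ Finset.range F.M, ∑ j ∈ Finset.range F.N, F.c i j •
    (Finsupp.single (z (i + 1) (j + 1)) 1 - Finsupp.single (z i (j + 1)) 1 -
      Finsupp.single (z (i + 1) j) 1 + Finsupp.single (z i j) 1)

/-- In the space of formal combinations of corners, step functions on unrelated grids can be
subtracted without a common refinement. Together with `StepFun.sheetFun_toFinsupp` this makes the
integral linear where it is needed. -/
lemma StepFun.sheetInt_toFinsupp (F : StepFun T) (hT : 0 ≤ T) :
    sheetInt W (F.toFinsupp hT) = F.integral W := by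
  ext ω
  simp only [StepFun.toFinsupp, map_sum, Finset.sum_apply, StepFun.integral]
  refine Finset.sum_congr rfl fun i hi => Finset.sum_congr rfl fun j hj => ?_
  rw [Finset.mem_range] at hi hj
  have a1 := projIcc_of_mem hT (F.a_mem hi.le)
  have a2 := projIcc_of_mem hT (F.a_mem (Nat.succ_le_of_lt hi))
  have b1 := projIcc_of_mem zero_le_one (F.b_mem hj.le)
  have b2 := projIcc_of_mem zero_le_one (F.b_mem (Nat.succ_le_of_lt hj))
  simp only [Nat.succ_eq_add_one] at a2 b2
  simp [a1, a2, b1, b2, sheetInt, rectIncr]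
  ring

lemma indicator_Ioc_eq_cut_sub {a a' : ℝ} (ha : 0 ≤ a) (haa : a ≤ a') (s : ℝ) :
    (Ioc a a').indicator (fun _ => (1 : ℝ)) s = cut a' s - cut a s := by
  simp only [cut_apply, indicator_apply, mem_Ioc]
  split_ifs <;> norm_num <;> grind

lemma StepFun.sheetFun_toFinsupp (F : StepFun T) (hT : 0 ≤ T) :
    sheetFun (F.toFinsupp hT) = F.toFun := by
  ext s y
  simp only [StepFun.toFinsupp, map_sum, Finset.sum_apply, StepFun.toFun]
  refine Finset.sum_congr rfl fun i hi => Finset.sum_congr rfl fun j hj => ?_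
  rw [Finset.mem_range] at hi hj
  have a1 := projIcc_of_mem hT (F.a_mem hi.le)
  have a2 := projIcc_of_mem hT (F.a_mem (Nat.succ_le_of_lt hi))
  have b1 := projIcc_of_mem zero_le_one (F.b_mem hj.le)
  have b2 := projIcc_of_mem zero_le_one (F.b_mem (Nat.succ_le_of_lt hj))
  simp only [Nat.succ_eq_add_one] at a2 b2
  have e : (Ioc (F.a i) (F.a (i + 1)) ×ˢ Ioc (F.b j) (F.b (j + 1))).indicator
      (fun _ => F.c i j) (s, y) = F.c i j * ((Ioc (F.a i) (F.a (i + 1))).indicator (fun _ => 1) s *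
        (Ioc (F.b j) (F.b (j + 1))).indicator (fun _ => 1) y) := by
    simp only [indicator_apply, mem_prod]
    split_ifs <;> simp_all
  rw [e, indicator_Ioc_eq_cut_sub (F.a_mem hi.le).1 (F.a_lt i hi).le,
    indicator_Ioc_eq_cut_sub (F.b_mem hj.le).1 (F.b_lt j hj).le]
  simp [a1, a2, b1, b2, sheetFun]
  ring

variable [MeasurableSpace Ω] {P : Measure Ω}

lemma measurable_sheetFun (l : (Icc (0 : ℝ) T × Icc (0 : ℝ) 1) →₀ ℝ) :
    Measurable (Function.uncurry (sheetFun l)) := by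
  have : Function.uncurry (sheetFun l) =
      fun z => ∑ q ∈ l.support, l q * cut q.1 z.1 * cut q.2 z.2 := by
    ext ⟨s, y⟩
    exact sheetFun_apply l s y
  rw [this]
  fun_prop

lemma integral_cut_mul_cut {t t' : ℝ} (ht : t ∈ Icc 0 T) (ht' : t' ∈ Icc 0 T) :
    ∫ s in Icc 0 T, cut t s * cut t' s = min t t' := by
  have : ∀ s, cut t s * cut t' s = (Ioc 0 (min t t')).indicator (fun _ => (1 : ℝ)) s := by
    intro s
    simp only [cut_apply, indicator_apply, mem_Ioc, le_min_iff]
    split_ifs <;> simp_all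
  simp_rw [this]
  rw [setIntegral_indicator measurableSet_Ioc, setIntegral_const, inter_eq_right.2]
  · simp [ht.1, ht'.1]
  · exact fun s hs => ⟨hs.1.le, hs.2.trans ((min_le_left _ _).trans ht.2)⟩

lemma integrable_cut_mul_cut (t t' : ℝ) :
    Integrable (fun s => cut t s * cut t' s) (volume.restrict (Icc 0 T)) := by
  refine Integrable.of_bound (by fun_prop) 1 (Eventually.of_forall fun s => ?_)
  simp only [cut_apply]
  split_ifs <;> simp

/-- At a fixed time the function is a combination of spatial indicators with coefficients `l z * cut
z.1 s`. Integration in time turns the products of temporal indicators into `min`, and the result is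
the double sum of `IsFractionalSheet.integral_sheetInt_sq`. -/
lemma noiseNormSq_sheetFun (hH : 0 < H) (hH' : H ≤ 1 / 2)
    (l : (Icc (0 : ℝ) T × Icc (0 : ℝ) 1) →₀ ℝ) :
    noiseNormSq H T (sheetFun l) = ENNReal.ofReal (∑ z ∈ l.support, ∑ z' ∈ l.support,
      l z * l z' * (min (z.1 : ℝ) z'.1 * fbmCov H z.2 z'.2)) := by
  rw [noiseNormSq_eq_lintegral (measurable_sheetFun l)]
  have h2 : ∀ s, sheetFun l s = fun y => ∑ z ∈ l.support, l z * cut z.1 s * cut z.2 y :=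
    fun s => funext fun y => sheetFun_apply l s y
  simp_rw [h2, fun s => (spaceNormSq_sum_cut hH hH' l.support (fun z => l z * cut z.1 s)
    (fun z => (z.2 : ℝ)) fun z _ => z.2.2).1]
  have hi : ∀ z z' : Icc (0 : ℝ) T × Icc (0 : ℝ) 1, Integrable
      (fun s => l z * cut z.1 s * (l z' * cut z'.1 s) * fbmCov H z.2 z'.2)
      (volume.restrict (Icc 0 T)) := fun z z' => by
    refine ((integrable_cut_mul_cut z.1 z'.1).const_mul (l z * l z' * fbmCov H z.2 z'.2)).congr
      (Eventually.of_forall fun s => ?_)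
    simp only; ring
  rw [← ofReal_integral_eq_lintegral_ofReal
    (integrable_finsetSum _ fun z _ => integrable_finsetSum _ fun z' _ => hi z z')
    (Eventually.of_forall fun s => (spaceNormSq_sum_cut hH hH' l.support (fun z => l z * cut z.1 s)
      (fun z => (z.2 : ℝ)) fun z _ => z.2.2).2)]
  congr 1
  rw [integral_finsetSum _ fun z _ => integrable_finsetSum _ fun z' _ => hi z z']
  refine Finset.sum_congr rfl fun z _ => ?_
  rw [integral_finsetSum _ fun z' _ => hi z z']
  refine Finset.sum_congr rfl fun z' _ => ?_
  have := integral_cut_mul_cut z.1.2 z'.1.2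
  rw [← this, ← integral_mul_const, ← integral_const_mul]
  congr with s
  ring

lemma IsFractionalSheet.hasGaussianLaw_sheetInt (hW : IsFractionalSheet H T P W)
    (l : (Icc (0 : ℝ) T × Icc (0 : ℝ) 1) →₀ ℝ) : HasGaussianLaw (sheetInt W l) P := by
  have := (hW.gaussian.smul fun z => l z).hasGaussianLaw_fun_sum (I := l.support)
  refine this.congr (Eventually.of_forall fun ω => ?_)
  simp [sheetInt_apply]

lemma IsFractionalSheet.memLp_two (hW : IsFractionalSheet H T P W)
    (z : Icc (0 : ℝ) T × Icc (0 : ℝ) 1) : MemLp (W z.1 z.2) 2 P :=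
  (hW.gaussian.hasGaussianLaw_eval z).memLp_two

lemma IsFractionalSheet.integral_sheetInt (hW : IsFractionalSheet H T P W)
    (l : (Icc (0 : ℝ) T × Icc (0 : ℝ) 1) →₀ ℝ) : ∫ ω, sheetInt W l ω ∂P = 0 := by
  have := hW.gaussian.isProbabilityMeasure
  simp_rw [sheetInt_apply]
  rw [integral_finsetSum _ fun z _ => ((hW.memLp_two z).integrable (by norm_num)).const_mul _]
  refine Finset.sum_eq_zero fun z _ => ?_
  rw [integral_const_mul, hW.mean_zero _ z.1.2 _ z.2.2, mul_zero]

lemma IsFractionalSheet.integral_sheetInt_sq (hW : IsFractionalSheet H T P W)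
    (l : (Icc (0 : ℝ) T × Icc (0 : ℝ) 1) →₀ ℝ) :
    ∫ ω, sheetInt W l ω ^ 2 ∂P = ∑ z ∈ l.support, ∑ z' ∈ l.support,
      l z * l z' * (min (z.1 : ℝ) z'.1 * fbmCov H z.2 z'.2) := by
  have hexp : ∀ ω, sheetInt W l ω ^ 2 = ∑ z ∈ l.support, ∑ z' ∈ l.support,
      l z * l z' * (W z.1 z.2 ω * W z'.1 z'.2 ω) := by
    intro ω
    rw [sheetInt_apply, sq, Finset.sum_mul_sum]
    exact Finset.sum_congr rfl fun z _ => Finset.sum_congr rfl fun z' _ => by ring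
  have hi : ∀ z z' : Icc (0 : ℝ) T × Icc (0 : ℝ) 1, Integrable
      (fun ω => l z * l z' * (W z.1 z.2 ω * W z'.1 z'.2 ω)) P := fun z z' =>
    ((hW.memLp_two z).integrable_mul (hW.memLp_two z')).const_mul _
  simp_rw [hexp]
  rw [integral_finsetSum _ fun z _ => integrable_finsetSum _ fun z' _ => hi z z']
  refine Finset.sum_congr rfl fun z _ => ?_
  rw [integral_finsetSum _ fun z' _ => hi z z']
  refine Finset.sum_congr rfl fun z' _ => ?_
  rw [integral_const_mul, hW.cov _ z.1.2 _ z'.1.2 _ z.2.2 _ z'.2.2]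
  rfl

/-- The `p`-th absolute moment of the standard Gaussian law. -/
def gaussMoment (p : ℝ) : ℝ≥0∞ := ∫⁻ x, ‖x‖ₑ ^ p ∂(gaussianReal 0 1)

lemma gaussMoment_ne_top {p : ℝ} (hp : 0 < p) : gaussMoment p ≠ ∞ := by
  have h := memLp_id_gaussianReal' (μ := 0) (v := 1) (ENNReal.ofReal p) ENNReal.ofReal_ne_top
  have := lintegral_rpow_enorm_lt_top_of_eLpNorm_lt_top (by simpa using hp) ENNReal.ofReal_ne_top
    h.2
  rw [ENNReal.toReal_ofReal hp.le] at this
  exact this.ne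

/-- A centred Gaussian variable has the law of its standard deviation times a standard normal one,
so the isometry in `L²(Ω)` determines every moment. -/
lemma IsFractionalSheet.lintegral_sheetInt_rpow (hW : IsFractionalSheet H T P W) (hH : 0 < H)
    (hH' : H ≤ 1 / 2) (l : (Icc (0 : ℝ) T × Icc (0 : ℝ) 1) →₀ ℝ) {p : ℝ} (hp : 0 < p) :
    ∫⁻ ω, ‖sheetInt W l ω‖ₑ ^ p ∂P = gaussMoment p * noiseNormSq H T (sheetFun l) ^ (p / 2) := by
  have hG := hW.hasGaussianLaw_sheetInt l
  have hprob := hG.isProbabilityMeasure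
  have hvar : variance (sheetInt W l) P = ∫ ω, sheetInt W l ω ^ 2 ∂P := by
    rw [variance_eq_integral hG.aemeasurable, hW.integral_sheetInt]
    simp
  have hv0 : 0 ≤ variance (sheetInt W l) P := variance_nonneg _ _
  have hlaw := hG.map_eq_gaussianReal
  rw [hW.integral_sheetInt] at hlaw
  have hlaw2 : P.map (sheetInt W l) = (gaussianReal 0 1).map
      (fun x => √(variance (sheetInt W l) P) * x) := by
    rw [hlaw, gaussianReal_map_const_mul]
    congr 1
    · simp
    · ext; simp [Real.sq_sqrt hv0, hv0]
  -- The isometry: norm and variance are the same double sum over the support.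
  have hnn : noiseNormSq H T (sheetFun l) = ENNReal.ofReal (variance (sheetInt W l) P) := by
    rw [noiseNormSq_sheetFun hH hH', hvar, hW.integral_sheetInt_sq]
  calc ∫⁻ ω, ‖sheetInt W l ω‖ₑ ^ p ∂P = ∫⁻ x, ‖x‖ₑ ^ p ∂(P.map (sheetInt W l)) := by
        rw [lintegral_map' (by fun_prop) hG.aemeasurable]
    _ = ∫⁻ x, ‖√(variance (sheetInt W l) P)‖ₑ ^ p * ‖x‖ₑ ^ p ∂(gaussianReal 0 1) := by
        rw [hlaw2, lintegral_map (by fun_prop) (by fun_prop)]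
        simp_rw [enorm_mul, ENNReal.mul_rpow_of_nonneg _ _ hp.le]
    _ = _ := by
        rw [lintegral_const_mul _ (by fun_prop), mul_comm, gaussMoment, hnn]
        congr 1
        rw [Real.enorm_eq_ofReal (Real.sqrt_nonneg _), ENNReal.ofReal_rpow_of_nonneg
          (Real.sqrt_nonneg _) hp.le, ENNReal.ofReal_rpow_of_nonneg hv0 (by positivity),
          Real.sqrt_eq_rpow, ← Real.rpow_mul hv0]
        congr 2; ring

lemma StepFun.measurable_toFun (F : StepFun T) : Measurable (Function.uncurry F.toFun) := by
  have hT : 0 ≤ T := (F.a_mem le_rfl).1.trans (F.a_mem le_rfl).2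
  rw [← F.sheetFun_toFinsupp hT]
  exact measurable_sheetFun _

/-- Moments of the difference of two integrals of step functions. -/
lemma IsFractionalSheet.lintegral_integral_sub_rpow (hW : IsFractionalSheet H T P W) (hH : 0 < H)
    (hH' : H ≤ 1 / 2) (F G : StepFun T) {p : ℝ} (hp : 0 < p) :
    ∫⁻ ω, ‖F.integral W ω - G.integral W ω‖ₑ ^ p ∂P =
      gaussMoment p * noiseNormSq H T (fun s y => F.toFun s y - G.toFun s y) ^ (p / 2) := by
  have hT : 0 ≤ T := (F.a_mem le_rfl).1.trans (F.a_mem le_rfl).2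
  have := hW.lintegral_sheetInt_rpow hH hH' (F.toFinsupp hT - G.toFinsupp hT) hp
  rw [map_sub, map_sub, F.sheetInt_toFinsupp, G.sheetInt_toFinsupp, F.sheetFun_toFinsupp,
    G.sheetFun_toFinsupp] at this
  exact this

lemma IsFractionalSheet.memLp_integral (hW : IsFractionalSheet H T P W) (F : StepFun T) :
    MemLp (F.integral W) 2 P := by
  have hT : 0 ≤ T := (F.a_mem le_rfl).1.trans (F.a_mem le_rfl).2
  rw [← F.sheetInt_toFinsupp hT]
  exact (hW.hasGaussianLaw_sheetInt _).memLp_two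

/-- Moments of the difference of a stochastic integral and the integral of a step function. -/
lemma IsFractionalSheet.lintegral_sub_integral_rpow_le (hW : IsFractionalSheet H T P W) (hH : 0 < H)
    (hH' : H ≤ 1 / 2) {f : ℝ → ℝ → ℝ} (hf : Measurable (Function.uncurry f)) {X : Ω → ℝ}
    (hX : IsStochasticIntegral H T P W f X) (F : StepFun T) {p : ℝ} (hp : 0 < p) :
    ∫⁻ ω, ‖X ω - F.integral W ω‖ₑ ^ p ∂P ≤ gaussMoment p *
      (2 * noiseNormSq H T (fun s y => f s y - F.toFun s y)) ^ (p / 2) := by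
  obtain ⟨-, hX2, G, hG, hGX⟩ := hX
  -- Convergence in `L²(Ω)` says nothing directly about `p`-th moments with `p > 2`. Almost sure
  -- convergence along a subsequence and Fatou's lemma transfer the bound for step functions to `X`.
  have hconv : TendstoInMeasure P (fun r => (G r).integral W) atTop X := by
    refine tendstoInMeasure_of_tendsto_eLpNorm (p := 2) (by norm_num)
      (fun r => (hW.memLp_integral (G r)).1) hX2.1 ?_
    refine hGX.congr fun r => ?_
    rw [eLpNorm_sub_comm]
    rfl
  obtain ⟨ns, hns, hae⟩ := hconv.exists_seq_tendsto_ae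
  set N := noiseNormSq H T (fun s y => f s y - F.toFun s y) with hN
  have hbound : ∀ r, ∫⁻ ω, ‖(G r).integral W ω - F.integral W ω‖ₑ ^ p ∂P ≤ gaussMoment p *
      (2 * noiseNormSq H T (fun s y => f s y - (G r).toFun s y) + 2 * N) ^ (p / 2) := by
    intro r
    rw [hW.lintegral_integral_sub_rpow hH hH' _ _ hp]
    gcongr
    have h1 : Measurable (Function.uncurry fun s y => f s y - (G r).toFun s y) :=
      hf.sub (G r).measurable_toFun
    have h2 : Measurable (Function.uncurry fun s y => f s y - F.toFun s y) :=
      hf.sub F.measurable_toFun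
    have h3 : Measurable (Function.uncurry fun s y => -(f s y - (G r).toFun s y)) := h1.neg
    rw [← noiseNormSq_neg fun s y => f s y - (G r).toFun s y, hN]
    convert noiseNormSq_add_le h3 h2 using 4
    ring
  calc ∫⁻ ω, ‖X ω - F.integral W ω‖ₑ ^ p ∂P
      ≤ ∫⁻ ω, liminf (fun r => ‖(G (ns r)).integral W ω - F.integral W ω‖ₑ ^ p) atTop ∂P := by
        refine lintegral_mono_ae ?_
        filter_upwards [hae] with ω hω
        refine (Tendsto.liminf_eq ?_).ge
        exact ((ENNReal.continuous_rpow_const.tendsto _).comp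
          ((hω.sub_const (F.integral W ω)).enorm))
    _ ≤ liminf (fun r => ∫⁻ ω, ‖(G (ns r)).integral W ω - F.integral W ω‖ₑ ^ p ∂P) atTop := by
        refine lintegral_liminf_le' fun r => ?_
        have := (hW.memLp_integral (G (ns r))).1.aemeasurable
        have := (hW.memLp_integral F).1.aemeasurable
        fun_prop
    _ ≤ liminf (fun r => gaussMoment p *
      (2 * noiseNormSq H T (fun s y => f s y - (G (ns r)).toFun s y) + 2 * N) ^ (p / 2)) atTop :=
        liminf_le_liminf (Eventually.of_forall fun r => hbound _)
    _ = gaussMoment p * (2 * N) ^ (p / 2) := by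
        refine Tendsto.liminf_eq ?_
        refine ENNReal.Tendsto.const_mul ?_ (Or.inr (gaussMoment_ne_top hp))
        refine (ENNReal.continuous_rpow_const.tendsto _).comp ?_
        have h0 := ENNReal.Tendsto.const_mul (a := 2) (hG.comp hns.tendsto_atTop) (Or.inr (by simp))
        simpa using h0.add_const (2 * N)

end Isometry

/-! ### Cell averages on uniform grids -/

/-- The average of `f` over the cell `(iδ, (i+1)δ]`. -/
def cellAvg (δ : ℝ) (f : ℝ → ℝ) (i : ℕ) : ℝ := 1 / δ * ∫ r in Ioc (i * δ) ((i + 1) * δ), f r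

/-- The function that is constant on each of the cells `(iδ, (i+1)δ]`, `i < n`, and has there the
average of `f`. -/
def avgStep (n : ℕ) (δ : ℝ) (f : ℝ → ℝ) (s : ℝ) : ℝ :=
  ∑ i ∈ Finset.range n, (Ioc (i * δ) ((i + 1) * δ)).indicator (fun _ => cellAvg δ f i) s

section Cells

variable {n : ℕ} {δ : ℝ}

/-- The cells are open on the left, hence the index `⌈s/δ⌉ - 1` rather than a floor; it is a natural
number since `s > 0`. -/
lemma exists_mem_cell (hδ : 0 < δ) {s : ℝ} (hs : s ∈ Ioc 0 (n * δ)) :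
    ∃ i < n, s ∈ Ioc (i * δ) ((i + 1) * δ) := by
  have h0 : 0 < s / δ := div_pos hs.1 hδ
  have hc := Nat.ceil_lt_add_one h0.le
  have hc' := Nat.le_ceil (s / δ)
  have hp : 0 < ⌈s / δ⌉₊ := Nat.ceil_pos.2 h0
  have hcn : ⌈s / δ⌉₊ ≤ n := Nat.ceil_le.2 ((div_le_iff₀ hδ).2 hs.2)
  have e : ((⌈s / δ⌉₊ - 1 : ℕ) : ℝ) = ⌈s / δ⌉₊ - 1 := by
    rw [Nat.cast_sub hp]; simp
  refine ⟨⌈s / δ⌉₊ - 1, by omega, ?_, ?_⟩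
  · rw [e, ← lt_div_iff₀ hδ]; linarith
  · rw [e, ← div_le_iff₀ hδ]; linarith

lemma eq_of_mem_cell (hδ : 0 < δ) {s : ℝ} {i j : ℕ} (hi : s ∈ Ioc (i * δ) ((i + 1) * δ))
    (hj : s ∈ Ioc (j * δ) ((j + 1) * δ)) : i = j := by
  have h1 : (i : ℝ) < j + 1 := lt_of_mul_lt_mul_right (hi.1.trans_le hj.2) hδ.le
  have h2 : (j : ℝ) < i + 1 := lt_of_mul_lt_mul_right (hj.1.trans_le hi.2) hδ.le
  norm_cast at h1 h2
  omega

lemma avgStep_of_mem (hδ : 0 < δ) (f : ℝ → ℝ) {s : ℝ} {i : ℕ} (hi : i < n)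
    (hs : s ∈ Ioc (i * δ) ((i + 1) * δ)) : avgStep n δ f s = cellAvg δ f i := by
  unfold avgStep
  rw [Finset.sum_eq_single i]
  · simp [hs.1, hs.2]
  · intro j _ hji
    exact indicator_of_notMem (fun h => hji (eq_of_mem_cell hδ h hs)) _
  · simp [hi]

@[fun_prop]
lemma measurable_avgStep (f : ℝ → ℝ) : Measurable (avgStep n δ f) := by
  unfold avgStep
  exact Finset.measurable_sum _ fun i _ => measurable_const.indicator measurableSet_Ioc

lemma cell_subset (hδ : 0 < δ) {i : ℕ} (hi : i < n) :
    Ioc (i * δ) ((i + 1) * δ) ⊆ Ioc 0 (n * δ) := by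
  refine Ioc_subset_Ioc (by positivity) (mul_le_mul_of_nonneg_right ?_ hδ.le)
  exact_mod_cast hi

lemma volume_real_cell (i : ℕ) (hδ : 0 < δ) :
    (volume : Measure ℝ).real (Ioc (i * δ) ((i + 1) * δ)) = δ := by
  rw [Real.volume_real_Ioc_of_le (by nlinarith)]; ring

lemma abs_cellAvg_le (hδ : 0 < δ) {f : ℝ → ℝ} {B : ℝ} {i : ℕ}
    (hf : ∀ x ∈ Ioc (i * δ) ((i + 1) * δ), |f x| ≤ B) : |cellAvg δ f i| ≤ B := by
  have := norm_setIntegral_le_of_norm_le_const (μ := volume) (f := f) (C := B)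
    (s := Ioc (i * δ) ((i + 1) * δ)) (by simp) hf
  rw [volume_real_cell i hδ, Real.norm_eq_abs] at this
  rw [cellAvg, abs_mul, abs_of_pos (by positivity), one_div, inv_mul_le_iff₀ hδ]
  linarith

lemma cellAvg_sub_const (hδ : 0 < δ) {f : ℝ → ℝ} {i : ℕ}
    (hf : IntegrableOn f (Ioc (i * δ) ((i + 1) * δ))) (c : ℝ) :
    cellAvg δ (fun r => f r - c) i = cellAvg δ f i - c := by
  unfold cellAvg
  rw [integral_sub hf (by simp), setIntegral_const, volume_real_cell i hδ, smul_eq_mul]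
  field_simp

lemma abs_sub_cellAvg_le (hδ : 0 < δ) {f : ℝ → ℝ} {B c : ℝ} {i : ℕ}
    (hi : IntegrableOn f (Ioc (i * δ) ((i + 1) * δ)))
    (hf : ∀ x ∈ Ioc (i * δ) ((i + 1) * δ), |f x - c| ≤ B) : |c - cellAvg δ f i| ≤ B := by
  rw [abs_sub_comm, ← cellAvg_sub_const hδ hi]
  exact abs_cellAvg_le hδ hf

/-- Countable subadditivity is enough for upper bounds, and it asks no measurability of `f`. -/
lemma lintegral_le_sum_cells (hδ : 0 < δ) (f : ℝ → ℝ≥0∞) :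
    ∫⁻ x in Ioc 0 (n * δ), f x ≤ ∑ i ∈ Finset.range n, ∫⁻ x in Ioo (i * δ) ((i + 1) * δ), f x := by
  have hsub : Ioc 0 (n * δ) ⊆ ⋃ i : Fin n, Ioc ((i : ℕ) * δ) (((i : ℕ) + 1) * δ) := by
    intro s hs
    obtain ⟨i, hi, h⟩ := exists_mem_cell hδ hs
    exact mem_iUnion.2 ⟨⟨i, hi⟩, h⟩
  calc _ ≤ ∫⁻ x in ⋃ i : Fin n, Ioc ((i : ℕ) * δ) (((i : ℕ) + 1) * δ), f x :=
        lintegral_mono_set hsub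
    _ ≤ ∑' i : Fin n, ∫⁻ x in Ioc ((i : ℕ) * δ) (((i : ℕ) + 1) * δ), f x := lintegral_iUnion_le _ _
    _ = _ := by
        rw [tsum_fintype, Finset.sum_range]
        simp_rw [restrict_Ioo_eq_restrict_Ioc]

end Cells

/-! ### The spatial norm of cellwise Lipschitz functions -/

section SpaceEstimates

variable {H : ℝ}

/-- Seen from a point `x` to the right of `a`, the singular kernel has a tail of the order of a
power of the distance from `x` to `a`, with exponent `2H - 1 > -1` when `H > 0`. That power is
integrable over a cell, so jumps at the cell boundaries have finite norm. -/
lemma setLIntegral_sub_rpow_left_le {x a K : ℝ} (hH : H < 1 / 2) (hK : 0 ≤ K) (ha : 0 ≤ a)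
    (hx : a < x) : ∫⁻ y in Ioo 0 a, ENNReal.ofReal (K * (x - y) ^ (2 * H - 2)) ≤
      ENNReal.ofReal (K / (1 - 2 * H) * (x - a) ^ (2 * H - 1)) := by
  have h12 : 0 < 1 - 2 * H := by linarith
  rw [lintegral_ofReal_deriv (g := fun y => K / (1 - 2 * H) * (x - y) ^ (2 * H - 1)) ha]
  · apply ENNReal.ofReal_le_ofReal
    have : 0 ≤ K / (1 - 2 * H) * (x - 0) ^ (2 * H - 1) :=
      mul_nonneg (by positivity) (Real.rpow_nonneg (by linarith) _)
    linarith
  · refine ContinuousOn.mul continuousOn_const (ContinuousOn.rpow_const (by fun_prop) ?_)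
    intro y hy; left; linarith [hy.2]
  · intro y hy
    have := (((hasDerivAt_id y).const_sub x).rpow_const (p := 2 * H - 1)
        (Or.inl (by simp; linarith [hy.2]))).const_mul (K / (1 - 2 * H))
    refine this.congr_deriv ?_
    simp only [id]
    rw [show 2 * H - 1 - 1 = 2 * H - 2 by ring]
    field_simp
    ring
  · intro y hy; exact mul_nonneg hK (Real.rpow_nonneg (by linarith [hy.2]) _)

lemma setLIntegral_sub_rpow_right_le {x a K : ℝ} (hH : H < 1 / 2) (hK : 0 ≤ K) (ha : a ≤ 1)
    (hx : x < a) : ∫⁻ y in Ioo a 1, ENNReal.ofReal (K * (y - x) ^ (2 * H - 2)) ≤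
      ENNReal.ofReal (K / (1 - 2 * H) * (a - x) ^ (2 * H - 1)) := by
  have h12 : 0 < 1 - 2 * H := by linarith
  rw [lintegral_ofReal_deriv (g := fun y => -(K / (1 - 2 * H) * (y - x) ^ (2 * H - 1))) ha]
  · apply ENNReal.ofReal_le_ofReal
    have : 0 ≤ K / (1 - 2 * H) * (1 - x) ^ (2 * H - 1) :=
      mul_nonneg (by positivity) (Real.rpow_nonneg (by linarith) _)
    linarith
  · refine (ContinuousOn.mul continuousOn_const (ContinuousOn.rpow_const (by fun_prop) ?_)).neg
    intro y hy; left; linarith [hy.1]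
  · intro y hy
    have := ((((hasDerivAt_id y).sub_const x).rpow_const (p := 2 * H - 1)
        (Or.inl (by simp; linarith [hy.1]))).const_mul (K / (1 - 2 * H))).neg
    refine this.congr_deriv ?_
    simp only [id]
    rw [show 2 * H - 1 - 1 = 2 * H - 2 by ring]
    field_simp
    ring
  · intro y hy; exact mul_nonneg hK (Real.rpow_nonneg (by linarith [hy.1]) _)

lemma lintegral_rpow_sub_left {a a' K : ℝ} (hH : 0 < H) (haa : a ≤ a') (hK : 0 ≤ K) :
    ∫⁻ x in Ioo a a', ENNReal.ofReal (K * (x - a) ^ (2 * H - 1)) =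
      ENNReal.ofReal (K / (2 * H) * (a' - a) ^ (2 * H)) := by
  rw [lintegral_ofReal_deriv (g := fun x => K / (2 * H) * (x - a) ^ (2 * H)) haa]
  · simp [Real.zero_rpow (by positivity : 2 * H ≠ 0)]
  · refine ContinuousOn.mul continuousOn_const (ContinuousOn.rpow_const (by fun_prop) ?_)
    intro y hy; right; linarith
  · intro y hy
    have := (((hasDerivAt_id y).sub_const a).rpow_const (p := 2 * H)
        (Or.inl (by simp; linarith [hy.1]))).const_mul (K / (2 * H))
    refine this.congr_deriv ?_
    simp only [id]
    field_simp
  · intro y hy; exact mul_nonneg hK (Real.rpow_nonneg (by linarith [hy.1]) _)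

lemma lintegral_rpow_sub_right {a a' K : ℝ} (hH : 0 < H) (haa : a ≤ a') (hK : 0 ≤ K) :
    ∫⁻ x in Ioo a a', ENNReal.ofReal (K * (a' - x) ^ (2 * H - 1)) =
      ENNReal.ofReal (K / (2 * H) * (a' - a) ^ (2 * H)) := by
  rw [lintegral_ofReal_deriv (g := fun x => -(K / (2 * H) * (a' - x) ^ (2 * H))) haa]
  · simp [Real.zero_rpow (by positivity : 2 * H ≠ 0)]
  · refine (ContinuousOn.mul continuousOn_const (ContinuousOn.rpow_const (by fun_prop) ?_)).neg
    intro y hy; right; linarith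
  · intro y hy
    have := ((((hasDerivAt_id y).const_sub a').rpow_const (p := 2 * H)
        (Or.inl (by simp; linarith [hy.2]))).const_mul (K / (2 * H))).neg
    refine this.congr_deriv ?_
    simp only [id]
    field_simp
  · intro y hy; exact mul_nonneg hK (Real.rpow_nonneg (by linarith [hy.2]) _)

/-- For `x` in a given cell, the `y` in the same cell are handled by the Lipschitz bound, which
beats the singularity and leaves `|x - y|^{2H} ≤ h^{2H}`. For all other `y` only `|v x - v y| ≤ 2B`
is used, with the tails of the singular kernel beyond the two cell edges. -/
lemma lintegral_seminorm_le (hH : 0 < H) (hH' : H < 1 / 2) {n : ℕ} (hn : 0 < n) {h : ℝ}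
    (hh : h = 1 / n) {v : ℝ → ℝ} {L B : ℝ} (hB : ∀ x ∈ Ioo (0 : ℝ) 1, |v x| ≤ B)
    (hL : ∀ i < n, ∀ x ∈ Ioc (i * h) ((i + 1) * h), ∀ y ∈ Ioc (i * h) ((i + 1) * h),
      x ∈ Ioo (0 : ℝ) 1 → y ∈ Ioo (0 : ℝ) 1 → |v x - v y| ≤ L * |x - y|) :
    ∫⁻ x in Ioo 0 1, ∫⁻ y in Ioo 0 1, ENNReal.ofReal ((v x - v y) ^ 2 / |x - y| ^ (2 - 2 * H)) ≤
      ENNReal.ofReal (L ^ 2 * h ^ (1 + 2 * H) +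
        4 * B ^ 2 / (H * (1 - 2 * H)) * h ^ (2 * H - 1)) := by
  have h12 : 0 < 1 - 2 * H := by linarith
  have hn' : (0 : ℝ) < n := by exact_mod_cast hn
  have hpos : 0 < h := by rw [hh]; positivity
  have hnh : n * h = 1 := by rw [hh]; field_simp
  have e2 : ∀ u : ℝ, 0 ≤ u → (u ^ (2 - 2 * H))⁻¹ = u ^ (2 * H - 2) := fun u hu => by
    rw [← Real.rpow_neg hu]; congr 1; ring
  have hdiff : ∀ x ∈ Ioo (0 : ℝ) 1, ∀ y ∈ Ioo (0 : ℝ) 1, (v x - v y) ^ 2 ≤ 4 * B ^ 2 := by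
    intro x hx y hy
    have h1 := abs_le.1 (hB x hx)
    have h2 := abs_le.1 (hB y hy)
    nlinarith
  set K := 4 * B ^ 2 with hK
  have hK0 : 0 ≤ K := by positivity
  have hinner : ∀ i < n, ∀ x ∈ Ioo (i * h) ((i + 1) * h), ∫⁻ y in Ioo 0 1,
      ENNReal.ofReal ((v x - v y) ^ 2 / |x - y| ^ (2 - 2 * H)) ≤
      ENNReal.ofReal (L ^ 2 * h ^ (1 + 2 * H)) +
        ENNReal.ofReal (K / (1 - 2 * H) * (x - i * h) ^ (2 * H - 1)) +
        ENNReal.ofReal (K / (1 - 2 * H) * ((i + 1) * h - x) ^ (2 * H - 1)) := by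
    intro i hi x hx
    have hi1 : ((i : ℝ) + 1) * h ≤ 1 := by
      have := mul_le_mul_of_nonneg_right (show (i : ℝ) + 1 ≤ n by exact_mod_cast hi) hpos.le
      linarith
    have hi0 : 0 ≤ (i : ℝ) * h := by positivity
    have hx01 : x ∈ Ioo (0 : ℝ) 1 := ⟨hi0.trans_lt hx.1, hx.2.trans_le hi1⟩
    have hsub : Ioo (0 : ℝ) 1 ⊆ ((Ioc (i * h) ((i + 1) * h) ∩ Ioo 0 1) ∪ Ioc 0 (i * h)) ∪
        Ioo ((i + 1) * h) 1 := by
      intro y hy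
      rcases le_or_gt y (i * h) with h1 | h1
      · exact Or.inl (Or.inr ⟨hy.1, h1⟩)
      · rcases le_or_gt y ((i + 1) * h) with h2 | h2
        · exact Or.inl (Or.inl ⟨⟨h1, h2⟩, hy⟩)
        · exact Or.inr ⟨h2, hy.2⟩
    refine (lintegral_mono_set hsub).trans ((lintegral_union_le _ _ _).trans ?_)
    refine add_le_add ((lintegral_union_le _ _ _).trans (add_le_add ?_ ?_)) ?_
    · calc _ ≤ ∫⁻ y in Ioc (i * h) ((i + 1) * h) ∩ Ioo 0 1, ENNReal.ofReal (L ^ 2 * h ^ (2 * H)) := by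
            refine setLIntegral_mono' (measurableSet_Ioc.inter measurableSet_Ioo) fun y hy => ?_
            apply ENNReal.ofReal_le_ofReal
            have hxy := hL i hi x (Ioo_subset_Ioc_self hx) y hy.1 hx01 hy.2
            rcases eq_or_ne x y with rfl | hne
            · simp; positivity
            have hr : 0 < |x - y| := abs_pos.2 (sub_ne_zero.2 hne)
            have hrh : |x - y| ≤ h := by
              rw [abs_le]; constructor <;> linarith [hx.1, hx.2, hy.1.1, hy.1.2]
            calc (v x - v y) ^ 2 / |x - y| ^ (2 - 2 * H)
                ≤ (L * |x - y|) ^ 2 / |x - y| ^ (2 - 2 * H) := by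
                  rw [← sq_abs (v x - v y)]
                  gcongr
              _ = L ^ 2 * |x - y| ^ (2 * H) := by
                  rw [mul_pow, mul_div_assoc, ← Real.rpow_natCast |x - y| 2, ← Real.rpow_sub hr]
                  congr 2; push_cast; ring
              _ ≤ L ^ 2 * h ^ (2 * H) := by gcongr
        _ ≤ ∫⁻ y in Ioc (i * h) ((i + 1) * h), ENNReal.ofReal (L ^ 2 * h ^ (2 * H)) :=
            lintegral_mono_set inter_subset_left
        _ = _ := by
            rw [setLIntegral_const, Real.volume_Ioc, ← ENNReal.ofReal_mul (by positivity)]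
            congr 1
            rw [show 1 + 2 * H = 2 * H + 1 by ring, Real.rpow_add_one hpos.ne']
            ring
    · rw [← restrict_Ioo_eq_restrict_Ioc]
      refine le_trans (setLIntegral_mono' measurableSet_Ioo fun y hy => ?_)
        (setLIntegral_sub_rpow_left_le hH' hK0 hi0 hx.1)
      apply ENNReal.ofReal_le_ofReal
      have hxy : 0 < x - y := by linarith [hy.2, hx.1]
      rw [abs_of_pos hxy, div_eq_mul_inv, e2 _ hxy.le]
      exact mul_le_mul_of_nonneg_right (hdiff x hx01 y ⟨hy.1, by linarith [hy.2, hx.1, hx01.2]⟩)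
        (by positivity)
    · refine le_trans (setLIntegral_mono' measurableSet_Ioo fun y hy => ?_)
        (setLIntegral_sub_rpow_right_le hH' hK0 hi1 hx.2)
      apply ENNReal.ofReal_le_ofReal
      have hxy : 0 < y - x := by linarith [hy.1, hx.2]
      rw [abs_sub_comm, abs_of_pos hxy, div_eq_mul_inv, e2 _ hxy.le]
      exact mul_le_mul_of_nonneg_right (hdiff x hx01 y ⟨by linarith [hy.1, hx.2, hx01.1], hy.2⟩)
        (by positivity)
  -- Each of the two tails integrates to `K / (1 - 2H) * h^{2H} / (2H)`; together they give the
  -- constant `K / (H(1 - 2H))`. One factor `h` is split off, to be cancelled by the number `n` of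
  -- cells.
  have hcell : ∀ i ∈ Finset.range n, ∫⁻ x in Ioo (i * h) ((i + 1) * h), ∫⁻ y in Ioo 0 1,
      ENNReal.ofReal ((v x - v y) ^ 2 / |x - y| ^ (2 - 2 * H)) ≤
      ENNReal.ofReal (h * (L ^ 2 * h ^ (1 + 2 * H) +
        K / (H * (1 - 2 * H)) * h ^ (2 * H - 1))) := by
    intro i hi
    have hw : ((i : ℝ) + 1) * h - i * h = h := by ring
    have hile : (i : ℝ) * h ≤ (i + 1) * h := by linarith
    refine (setLIntegral_mono' measurableSet_Ioo (hinner i (Finset.mem_range.1 hi))).trans ?_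
    rw [lintegral_add_left (by fun_prop), lintegral_add_left (by fun_prop), setLIntegral_const,
      lintegral_rpow_sub_left hH hile (by positivity), lintegral_rpow_sub_right hH hile (by positivity),
      Real.volume_Ioo, hw, ← ENNReal.ofReal_mul (by positivity),
      ← ENNReal.ofReal_add (by positivity) (by positivity),
      ← ENNReal.ofReal_add (by positivity) (by positivity)]
    apply ENNReal.ofReal_le_ofReal
    have : h ^ (2 * H) = h ^ (2 * H - 1) * h := by
      rw [← Real.rpow_add_one hpos.ne']; congr 1; ring
    rw [this]
    apply le_of_eq
    field_simp
    ring
  calc _ ≤ _ := lintegral_mono_set (t := Ioc 0 (n * h)) (by rw [hnh]; exact Ioo_subset_Ioc_self)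
    _ ≤ _ := lintegral_le_sum_cells hpos _
    _ ≤ _ := Finset.sum_le_sum hcell
    _ = _ := by
        rw [Finset.sum_const, Finset.card_range, nsmul_eq_mul, ← ENNReal.ofReal_natCast,
          ← ENNReal.ofReal_mul (by positivity), ← mul_assoc, hnh, one_mul]

lemma lintegral_weight_le (hH : 0 < H) {v : ℝ → ℝ} {B : ℝ} (hB : ∀ x ∈ Ioo (0 : ℝ) 1, |v x| ≤ B) :
    ∫⁻ x in Ioo 0 1, ENNReal.ofReal (v x ^ 2 * (x ^ (2 * H - 1) + (1 - x) ^ (2 * H - 1))) ≤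
      ENNReal.ofReal (B ^ 2 / H) := by
  calc _ ≤ ∫⁻ x in Ioo 0 1, (ENNReal.ofReal (B ^ 2 * (x - 0) ^ (2 * H - 1)) +
        ENNReal.ofReal (B ^ 2 * (1 - x) ^ (2 * H - 1))) := by
        refine setLIntegral_mono' measurableSet_Ioo fun x hx => ?_
        have h1 : 0 ≤ x ^ (2 * H - 1) := Real.rpow_nonneg hx.1.le _
        have h2 : 0 ≤ (1 - x) ^ (2 * H - 1) := Real.rpow_nonneg (by linarith [hx.2]) _
        rw [sub_zero, ← ENNReal.ofReal_add (by positivity) (by positivity), ← mul_add]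
        apply ENNReal.ofReal_le_ofReal
        refine mul_le_mul_of_nonneg_right ?_ (by positivity)
        exact sq_le_sq' (abs_le.1 (hB x hx)).1 (abs_le.1 (hB x hx)).2
    _ = _ := by
        rw [lintegral_add_left (by fun_prop), lintegral_rpow_sub_left hH zero_le_one (sq_nonneg B),
          lintegral_rpow_sub_right hH zero_le_one (sq_nonneg B),
          ← ENNReal.ofReal_add (by positivity) (by positivity)]
        simp
        congr 1
        field_simp
        ring

/-- The norm of a bounded function that is Lipschitz continuous on each cell of a uniform grid. -/
lemma spaceNormSq_le_of_cells (hH : 0 < H) (hH' : H ≤ 1 / 2) {n : ℕ} (hn : 0 < n) {h : ℝ}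
    (hh : h = 1 / n) {v : ℝ → ℝ} {L B : ℝ} (hB : ∀ x ∈ Ioo (0 : ℝ) 1, |v x| ≤ B)
    (hL : ∀ i < n, ∀ x ∈ Ioc (i * h) ((i + 1) * h), ∀ y ∈ Ioc (i * h) ((i + 1) * h),
      x ∈ Ioo (0 : ℝ) 1 → y ∈ Ioo (0 : ℝ) 1 → |v x - v y| ≤ L * |x - y|) :
    spaceNormSq H v ≤ ENNReal.ofReal (3 * (L ^ 2 * h ^ (1 + 2 * H) + B ^ 2 * h ^ (2 * H - 1))) := by
  have hn' : (1 : ℝ) ≤ n := by exact_mod_cast hn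
  have hpos : 0 < h := by rw [hh]; positivity
  have hle : h ≤ 1 := by rw [hh, div_le_one (by linarith)]; exact hn'
  -- Since `h ≤ 1` and the exponent is nonpositive, the weighted term `B²` is absorbed into `B²
  -- h^{2H-1}`.
  have h1 : 1 ≤ h ^ (2 * H - 1) := Real.one_le_rpow_of_pos_of_le_one_of_nonpos hpos hle (by linarith)
  have hp1 : 0 ≤ h ^ (1 + 2 * H) := by positivity
  have hw : ENNReal.ofReal H * (∫⁻ x in Ioo 0 1,
      ENNReal.ofReal (v x ^ 2 * (x ^ (2 * H - 1) + (1 - x) ^ (2 * H - 1)))) ≤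
      ENNReal.ofReal (B ^ 2 * h ^ (2 * H - 1)) := by
    refine (mul_le_mul_right (lintegral_weight_le hH hB) _).trans ?_
    rw [← ENNReal.ofReal_mul hH.le]
    apply ENNReal.ofReal_le_ofReal
    rw [mul_div_cancel₀ _ hH.ne']
    nlinarith [sq_nonneg B]
  have hs : ENNReal.ofReal (H * (1 - 2 * H) / 2) * (∫⁻ x in Ioo 0 1, ∫⁻ y in Ioo 0 1,
        ENNReal.ofReal ((v x - v y) ^ 2 / |x - y| ^ (2 - 2 * H))) ≤
      ENNReal.ofReal (L ^ 2 * h ^ (1 + 2 * H) + 2 * (B ^ 2 * h ^ (2 * H - 1))) := by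
    rcases hH'.lt_or_eq with hlt | rfl
    · have h12 : 0 < 1 - 2 * H := by linarith
      refine (mul_le_mul_right (lintegral_seminorm_le hH hlt hn hh hB hL) _).trans ?_
      rw [← ENNReal.ofReal_mul (by positivity)]
      apply ENNReal.ofReal_le_ofReal
      -- The prefactor of the seminorm cancels the constant that blows up as `H` tends to `1/2`, so
      -- the bound is uniform in `H`.
      have e : H * (1 - 2 * H) / 2 * (L ^ 2 * h ^ (1 + 2 * H) +
          4 * B ^ 2 / (H * (1 - 2 * H)) * h ^ (2 * H - 1)) =
          H * (1 - 2 * H) / 2 * (L ^ 2 * h ^ (1 + 2 * H)) + 2 * (B ^ 2 * h ^ (2 * H - 1)) := by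
        have := h12.ne'
        have := hH.ne'
        generalize h ^ (2 * H - 1) = r
        generalize 1 - 2 * H = u at *
        field_simp
        ring
      rw [e]
      have : H * (1 - 2 * H) / 2 ≤ 1 := by nlinarith
      have := mul_le_mul_of_nonneg_right this (mul_nonneg (sq_nonneg L) hp1)
      linarith
    · simp
  refine (add_le_add hs hw).trans ?_
  rw [← ENNReal.ofReal_add (by positivity) (by positivity)]
  apply ENNReal.ofReal_le_ofReal
  have := mul_nonneg (sq_nonneg L) hp1
  linarith

end SpaceEstimates

/-! ### Spatial errors of the eigenfunctions, orthonormality, and a sum over the modes -/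

section Eigenfunctions

variable {H : ℝ}

@[fun_prop]
lemma continuous_eigenfun (α : ℕ) : Continuous (eigenfun α) := by
  unfold eigenfun; fun_prop

lemma abs_eigenfun_le (α : ℕ) (x : ℝ) : |eigenfun α x| ≤ √2 := by
  rw [eigenfun, abs_mul, abs_of_nonneg (Real.sqrt_nonneg 2)]
  exact mul_le_of_le_one_right (Real.sqrt_nonneg 2) (Real.abs_sin_le_one _)

lemma abs_sin_sub_sin_le (a b : ℝ) : |Real.sin a - Real.sin b| ≤ |a - b| := by
  have := Real.lipschitzWith_sin.dist_le_mul a b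
  simpa [Real.dist_eq] using this

lemma abs_eigenfun_sub_le (α : ℕ) (x y : ℝ) :
    |eigenfun α x - eigenfun α y| ≤ √2 * freq α * |x - y| := by
  have hf : 0 ≤ freq α := by unfold freq; positivity
  rw [eigenfun, eigenfun, ← mul_sub, abs_mul, abs_of_nonneg (Real.sqrt_nonneg 2), mul_assoc]
  refine mul_le_mul_of_nonneg_left ((abs_sin_sub_sin_le _ _).trans ?_) (Real.sqrt_nonneg 2)
  rw [← mul_sub, abs_mul, abs_of_nonneg hf]

lemma integrableOn_eigenfun (α : ℕ) (a b : ℝ) : IntegrableOn (eigenfun α) (Ioc a b) :=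
  (continuous_eigenfun α).integrableOn_Ioc

lemma pi_sq_lt : Real.pi ^ 2 < 10 := by
  nlinarith [Real.pi_lt_d2, Real.pi_pos]

lemma le_freq (α : ℕ) : (α : ℝ) ≤ freq α := by
  unfold freq
  nlinarith [Real.pi_gt_three, (Nat.cast_nonneg α : (0 : ℝ) ≤ α)]

lemma freq_pos {α : ℕ} (hα : 0 < α) : 0 < freq α := by
  unfold freq
  positivity

variable {n : ℕ} {h : ℝ}

/-- The auxiliary grid has `α` cells, matching the wavelength: the Lipschitz constant times the mesh
is then of order one. The constant is `3(2π² + 2) ≤ 66`. -/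
lemma spaceNormSq_eigenfun_le (hH : 0 < H) (hH' : H ≤ 1 / 2) {α : ℕ} (hα : 0 < α) :
    spaceNormSq H (eigenfun α) ≤ ENNReal.ofReal (66 * (α : ℝ) ^ (1 - 2 * H)) := by
  have hα' : (0 : ℝ) < α := by exact_mod_cast hα
  refine (spaceNormSq_le_of_cells hH hH' hα rfl (fun x _ => abs_eigenfun_le α x)
    (fun _ _ x _ y _ _ _ => abs_eigenfun_sub_le α x y)).trans (ENNReal.ofReal_le_ofReal ?_)
  have h1 : (1 / (α : ℝ)) ^ (1 + 2 * H) = (α : ℝ) ^ (1 - 2 * H) / α ^ 2 := by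
    rw [one_div, Real.inv_rpow hα'.le, ← Real.rpow_neg hα'.le, ← Real.rpow_natCast, ← Real.rpow_sub hα']
    congr 1; push_cast; ring
  have h2 : (1 / (α : ℝ)) ^ (2 * H - 1) = (α : ℝ) ^ (1 - 2 * H) := by
    rw [one_div, Real.inv_rpow hα'.le, ← Real.rpow_neg hα'.le]
    congr 1; ring
  rw [h1, h2, mul_pow, Real.sq_sqrt (by norm_num), freq]
  have h3 : 0 ≤ (α : ℝ) ^ (1 - 2 * H) := by positivity
  have e : 2 * ((α : ℝ) * Real.pi) ^ 2 * ((α : ℝ) ^ (1 - 2 * H) / α ^ 2) =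
      2 * Real.pi ^ 2 * (α : ℝ) ^ (1 - 2 * H) := by field_simp
  rw [e]
  nlinarith [mul_le_mul_of_nonneg_right pi_sq_lt.le h3]

lemma spaceNormSq_avgStep_eigenfun_le (hH : 0 < H) (hH' : H ≤ 1 / 2) (hn : 0 < n) (hh : h = 1 / n)
    (α : ℕ) : spaceNormSq H (avgStep n h (eigenfun α)) ≤ ENNReal.ofReal (6 * h ^ (2 * H - 1)) := by
  have hn' : (0 : ℝ) < n := by exact_mod_cast hn
  have hpos : 0 < h := by rw [hh]; positivity
  have hnh : n * h = 1 := by rw [hh]; field_simp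
  refine (spaceNormSq_le_of_cells (L := 0) (B := √2) hH hH' hn hh (fun x hx => ?_)
    (fun i hi x hx y hy _ _ => ?_)).trans (ENNReal.ofReal_le_ofReal ?_)
  · obtain ⟨i, hi, hxi⟩ := exists_mem_cell (n := n) hpos (s := x) ⟨hx.1, by rw [hnh]; exact hx.2.le⟩
    rw [avgStep_of_mem hpos _ hi hxi]
    exact abs_cellAvg_le hpos fun y _ => abs_eigenfun_le α y
  · rw [avgStep_of_mem hpos _ hi hx, avgStep_of_mem hpos _ hi hy]
    simp
  · rw [Real.sq_sqrt (by norm_num)]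
    apply le_of_eq; ring

/-- For `α ≤ n` the grid resolves the oscillation and the Lipschitz bound gives `12π² ≤ 200`. For `α
> n` averaging gains nothing, and the separate bounds for the eigenfunction and its average give `2
* 66 + 2 * 6 ≤ 200`. The minimum records which regime applies. -/
lemma spaceNormSq_eigenfun_sub_avgStep_le (hH : 0 < H) (hH' : H ≤ 1 / 2) (hn : 0 < n)
    (hh : h = 1 / n) {α : ℕ} (hα : 0 < α) :
    spaceNormSq H (fun y => eigenfun α y - avgStep n h (eigenfun α) y) ≤
      ENNReal.ofReal (200 * α ^ 2 * min (h ^ (1 + 2 * H)) ((α : ℝ) ^ (-(1 + 2 * H)))) := by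
  have hn' : (0 : ℝ) < n := by exact_mod_cast hn
  have hα' : (0 : ℝ) < α := by exact_mod_cast hα
  have hpos : 0 < h := by rw [hh]; positivity
  have hnh : n * h = 1 := by rw [hh]; field_simp
  have hf := freq_pos hα
  have hhinv : h = (n : ℝ)⁻¹ := by rw [hh, one_div]
  rcases le_or_gt α n with hαn | hαn
  · have hmin : min (h ^ (1 + 2 * H)) ((α : ℝ) ^ (-(1 + 2 * H))) = h ^ (1 + 2 * H) := by
      apply min_eq_left
      rw [hhinv, Real.inv_rpow hn'.le, ← Real.rpow_neg hn'.le]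
      exact Real.rpow_le_rpow_of_nonpos hα' (by exact_mod_cast hαn) (by linarith)
    rw [hmin]
    refine (spaceNormSq_le_of_cells (L := √2 * freq α) (B := √2 * freq α * h) hH hH' hn hh
      (fun x hx => ?_) (fun i hi x hx y hy _ _ => ?_)).trans (ENNReal.ofReal_le_ofReal ?_)
    · obtain ⟨i, hi, hxi⟩ := exists_mem_cell (n := n) hpos (s := x) ⟨hx.1, by rw [hnh]; exact hx.2.le⟩
      rw [avgStep_of_mem hpos _ hi hxi]
      refine abs_sub_cellAvg_le hpos (integrableOn_eigenfun _ _ _) fun y hy => ?_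
      refine (abs_eigenfun_sub_le α y x).trans (mul_le_mul_of_nonneg_left ?_ (by positivity))
      rw [abs_le]; constructor <;> linarith [hxi.1, hxi.2, hy.1, hy.2]
    · rw [avgStep_of_mem hpos _ hi hx, avgStep_of_mem hpos _ hi hy, sub_sub_sub_cancel_right]
      exact abs_eigenfun_sub_le α x y
    · have e : (√2 * freq α * h) ^ 2 * h ^ (2 * H - 1) = (√2 * freq α) ^ 2 * h ^ (1 + 2 * H) := by
        rw [mul_pow _ h, mul_assoc, ← Real.rpow_natCast h 2, ← Real.rpow_add hpos]
        congr 2; push_cast; ring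
      rw [e, mul_pow, Real.sq_sqrt (by norm_num), freq, mul_pow]
      have h3 : 0 ≤ (α : ℝ) ^ 2 * h ^ (1 + 2 * H) := by positivity
      nlinarith [mul_le_mul_of_nonneg_right pi_sq_lt.le h3]
  · have hmin : min (h ^ (1 + 2 * H)) ((α : ℝ) ^ (-(1 + 2 * H))) = (α : ℝ) ^ (-(1 + 2 * H)) := by
      apply min_eq_right
      rw [hhinv, Real.inv_rpow hn'.le, ← Real.rpow_neg hn'.le]
      exact Real.rpow_le_rpow_of_nonpos hn' (by exact_mod_cast hαn.le) (by linarith)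
    have hpow : (α : ℝ) ^ 2 * (α : ℝ) ^ (-(1 + 2 * H)) = (α : ℝ) ^ (1 - 2 * H) := by
      rw [← Real.rpow_natCast, ← Real.rpow_add hα']
      congr 1; push_cast; ring
    have h1 : h ^ (2 * H - 1) ≤ (α : ℝ) ^ (1 - 2 * H) := by
      rw [hhinv, Real.inv_rpow hn'.le, ← Real.rpow_neg hn'.le, neg_sub]
      exact Real.rpow_le_rpow hn'.le (by exact_mod_cast hαn.le) (by linarith)
    rw [hmin, mul_assoc, hpow]
    have h2 := spaceNormSq_add_le (H := H) (v := eigenfun α)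
      (w := fun y => (-1) * avgStep n h (eigenfun α) y) (by fun_prop)
    rw [spaceNormSq_const_mul] at h2
    simp only [neg_mul, one_mul, ← sub_eq_add_neg, neg_sq, one_pow, ENNReal.ofReal_one] at h2
    refine h2.trans ((add_le_add (mul_le_mul_right (spaceNormSq_eigenfun_le hH hH' hα) _)
      (mul_le_mul_right (spaceNormSq_avgStep_eigenfun_le hH hH' hn hh α) _)).trans ?_)
    rw [show (2 : ℝ≥0∞) = ENNReal.ofReal 2 by simp, ← ENNReal.ofReal_mul (by norm_num),
      ← ENNReal.ofReal_mul (by norm_num), ← ENNReal.ofReal_add (by positivity) (by positivity)]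
    apply ENNReal.ofReal_le_ofReal
    have h3 : 0 ≤ (α : ℝ) ^ (1 - 2 * H) := by positivity
    linarith

lemma integral_eigenfun_mul {α β : ℕ} (hα : 0 < α) (hβ : 0 < β) :
    ∫ x in Ioo 0 1, eigenfun α x * eigenfun β x = if α = β then 1 else 0 := by
  have hcos : ∀ k : ℤ, k ≠ 0 → ∫ x in (0 : ℝ)..1, Real.cos (k * Real.pi * x) = 0 := by
    intro k hk
    have hk' : (k : ℝ) * Real.pi ≠ 0 := mul_ne_zero (by exact_mod_cast hk) Real.pi_ne_zero
    rw [intervalIntegral.integral_comp_mul_left (fun x => Real.cos x) hk']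
    simp [Real.sin_int_mul_pi]
  have e : ∀ x, eigenfun α x * eigenfun β x =
      Real.cos ((α - β : ℤ) * Real.pi * x) - Real.cos ((α + β : ℤ) * Real.pi * x) := by
    intro x
    have h2 : √2 * √2 = (2 : ℝ) := Real.mul_self_sqrt (by norm_num)
    have e1 : ((α - β : ℤ) : ℝ) * Real.pi * x = α * Real.pi * x - β * Real.pi * x := by
      push_cast; ring
    have e2 : ((α + β : ℤ) : ℝ) * Real.pi * x = α * Real.pi * x + β * Real.pi * x := by
      push_cast; ring
    rw [e1, e2, Real.cos_sub, Real.cos_add, eigenfun, eigenfun, freq, freq]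
    linear_combination (Real.sin (α * Real.pi * x) * Real.sin (β * Real.pi * x)) * h2
  simp_rw [e]
  rw [restrict_Ioo_eq_restrict_Ioc, ← intervalIntegral.integral_of_le zero_le_one,
    intervalIntegral.integral_sub (Continuous.intervalIntegrable (by fun_prop) _ _)
      (Continuous.intervalIntegrable (by fun_prop) _ _), hcos (α + β : ℤ) (by omega), sub_zero]
  split_ifs with hab
  · simp [hab]
  · exact hcos _ (by omega)

/-- Parseval for finite sums; the factor `r` makes room for the singular kernel or the weight,
neither of which depends on `x`. -/
lemma lintegral_sq_sum_eigenfun (S : Finset ℕ) (hS : ∀ α ∈ S, 0 < α) (a : ℕ → ℝ) {r : ℝ}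
    (hr : 0 ≤ r) :
    ∫⁻ x in Ioo 0 1, ENNReal.ofReal ((∑ α ∈ S, eigenfun α x * a α) ^ 2 * r) =
      ∑ α ∈ S, ENNReal.ofReal (a α ^ 2 * r) := by
  have hi : ∀ α β, IntegrableOn (fun x => eigenfun α x * eigenfun β x) (Ioo 0 1) := fun α β =>
    (Continuous.integrableOn_Icc (by fun_prop) (a := 0) (b := 1)).mono_set Ioo_subset_Icc_self
  have hexp : ∀ x, (∑ α ∈ S, eigenfun α x * a α) ^ 2 * r =
      ∑ α ∈ S, ∑ β ∈ S, a α * a β * r * (eigenfun α x * eigenfun β x) := by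
    intro x
    rw [sq, Finset.sum_mul_sum, Finset.sum_mul]
    refine Finset.sum_congr rfl fun i _ => ?_
    rw [Finset.sum_mul]
    exact Finset.sum_congr rfl fun j _ => by ring
  rw [← ofReal_integral_eq_lintegral_ofReal, ← ENNReal.ofReal_sum_of_nonneg
    (fun α _ => by positivity)]
  · congr 1
    simp_rw [hexp]
    rw [integral_finsetSum _ fun i _ => integrable_finsetSum _ fun j _ => (hi i j).const_mul _]
    refine Finset.sum_congr rfl fun α hα => ?_
    rw [integral_finsetSum _ fun j _ => (hi α j).const_mul _]
    have : ∀ β ∈ S, ∫ x in Ioo 0 1, a α * a β * r * (eigenfun α x * eigenfun β x) =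
        if α = β then a α * a β * r else 0 := by
      intro β hβ
      rw [integral_const_mul, integral_eigenfun_mul (hS α hα) (hS β hβ)]
      simp
    rw [Finset.sum_congr rfl this, Finset.sum_ite_eq, if_pos hα]
    ring
  · simp_rw [hexp]
    exact integrable_finsetSum _ fun i _ => integrable_finsetSum _ fun j _ => (hi i j).const_mul _
  · exact Eventually.of_forall fun x => by positivity

/-- Summation of `min (a ^ s) (α ^ (-s))`, for an exponent `s > 1`. -/
lemma sum_min_rpow_le {s a : ℝ} (hs : 1 < s) (ha : 0 < a) (N : ℕ) :
    ∑ α ∈ Finset.Icc 1 N, min (a ^ s) ((α : ℝ) ^ (-s)) ≤ s / (s - 1) * a ^ (s - 1) := by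
  have hs1 : 0 < s - 1 := by linarith
  have hia : 0 < a⁻¹ := by positivity
  have has : (a⁻¹) ^ (-s) = a ^ s := by rw [Real.inv_rpow ha.le, Real.rpow_neg ha.le, inv_inv]
  -- An antitone majorant, constant up to the crossover `1/a` and then `x^{-s}`. Its integral is at
  -- most `a^{s-1}` from the flat part plus `a^{s-1} / (s - 1)` from the tail.
  let f : ℝ → ℝ := fun x => (max a⁻¹ x) ^ (-s)
  have hanti : Antitone f := fun x y hxy =>
    Real.rpow_le_rpow_of_nonpos (lt_max_of_lt_left hia) (max_le_max le_rfl hxy) (by linarith)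
  have hcont : Continuous f := by
    refine Continuous.rpow_const (by fun_prop) fun x => Or.inl (lt_max_of_lt_left hia).ne'
  have hf : ∀ α ∈ Finset.Icc 1 N, min (a ^ s) ((α : ℝ) ^ (-s)) ≤ f α := by
    intro α hα
    simp only [f]
    rcases max_choice a⁻¹ (α : ℝ) with h | h <;> rw [h]
    · rw [has]; exact min_le_left _ _
    · exact min_le_right _ _
  have hap : a ^ s = a ^ (s - 1) * a := by
    rw [← Real.rpow_add_one ha.ne']; congr 1; ring
  have hpos : 0 ≤ a ^ (s - 1) := by positivity
  have hsplit : s / (s - 1) * a ^ (s - 1) = a ^ (s - 1) + a ^ (s - 1) / (s - 1) := by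
    field_simp; ring
  calc _ ≤ ∑ α ∈ Finset.Icc 1 N, f α := Finset.sum_le_sum hf
    _ = ∑ i ∈ Finset.range N, f (0 + ((i + 1 : ℕ) : ℝ)) := by
        rw [Finset.range_eq_Ico, Finset.sum_Ico_add' (fun i => f (0 + ((i : ℕ) : ℝ))) 0 N 1]
        simp only [zero_add]
        rfl
    _ ≤ ∫ x in (0 : ℝ)..0 + N, f x := (hanti.antitoneOn _).sum_le_integral
    _ ≤ _ := by
        rw [zero_add]
        have hleft : ∀ b : ℝ, b ≤ a⁻¹ → ∫ x in (0 : ℝ)..b, f x = b * a ^ s := by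
          intro b hb
          have : ∀ x ∈ uIcc 0 b, f x = a ^ s := by
            intro x hx
            have : x ≤ a⁻¹ := by
              rcases le_total 0 b with h | h
              · rw [uIcc_of_le h] at hx; exact hx.2.trans hb
              · rw [uIcc_of_ge h] at hx; exact hx.2.trans hia.le
            simp only [f, max_eq_left this, has]
          rw [intervalIntegral.integral_congr this]
          simp
        rcases le_total (N : ℝ) a⁻¹ with hN | hN
        · rw [hleft _ hN, hsplit, hap]
          have h1 : (N : ℝ) * (a ^ (s - 1) * a) ≤ a⁻¹ * (a ^ (s - 1) * a) := by gcongr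
          have h2 : a⁻¹ * (a ^ (s - 1) * a) = a ^ (s - 1) := by field_simp
          have h3 : 0 ≤ a ^ (s - 1) / (s - 1) := by positivity
          linarith
        · rw [← intervalIntegral.integral_add_adjacent_intervals (hcont.intervalIntegrable 0 a⁻¹)
            (hcont.intervalIntegrable a⁻¹ N), hleft _ le_rfl]
          have : ∀ x ∈ uIcc a⁻¹ (N : ℝ), f x = x ^ (-s) := by
            intro x hx
            rw [uIcc_of_le hN] at hx
            simp only [f, max_eq_right hx.1]
          rw [intervalIntegral.integral_congr this, integral_rpow, hsplit]
          · have h2 : a⁻¹ * a ^ s = a ^ (s - 1) := by rw [hap]; field_simp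
            have h3 : (a⁻¹) ^ (-s + 1) = a ^ (s - 1) := by
              rw [Real.inv_rpow ha.le, ← Real.rpow_neg ha.le]; congr 1; ring
            have h4 : 0 ≤ (N : ℝ) ^ (-s + 1) := by positivity
            rw [h2, h3, ← neg_div_neg_eq, neg_sub, show -(-s + 1) = s - 1 by ring]
            gcongr
            linarith
          · right
            refine ⟨by linarith, fun h => ?_⟩
            rw [uIcc_of_le hN] at h
            linarith [h.1]

end Eigenfunctions

/-! ### Temporal factors and their cell averages -/

/-- The temporal factor of the kernel `G_{t-s}`, as a function of `s`. -/
def timeKernel (L : EquationKind) (t : ℝ) (α : ℕ) (s : ℝ) : ℝ :=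
  if s ≤ t then timeFactor L α (t - s) else 0

/-- The temporal resolution for step size `k`: `√k` for the heat and `k` for the wave equation. -/
def timeRes (L : EquationKind) (k : ℝ) : ℝ :=
  match L with
  | .heat => √k
  | .wave => k

section TimeEstimates

variable {t T k : ℝ} {m : ℕ}

lemma continuous_timeFactor (L : EquationKind) (α : ℕ) : Continuous (timeFactor L α) := by
  cases L <;> unfold timeFactor <;> fun_prop

@[fun_prop]
lemma measurable_timeKernel (L : EquationKind) (t : ℝ) (α : ℕ) : Measurable (timeKernel L t α) := by
  refine Measurable.ite measurableSet_Iic ?_ measurable_const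
  exact ((continuous_timeFactor L α).comp (by fun_prop)).measurable

/-- The sine vanishes at `0`, so the cut-off at `s = t` is continuous and preserves the Lipschitz
bound. -/
lemma timeKernel_wave (t : ℝ) (α : ℕ) (s : ℝ) :
    timeKernel .wave t α s = Real.sin (freq α * max (t - s) 0) / freq α := by
  unfold timeKernel timeFactor
  split_ifs with h
  · rw [max_eq_left (by linarith)]
  · rw [max_eq_right (by linarith)]; simp

/-- The cut-off produces a jump at `s = t`. Separating it exhibits the factor as a difference of two
nondecreasing functions with values in `[0,1]`, hence of bounded variation uniformly in `α`. -/
lemma timeKernel_heat (t : ℝ) (α : ℕ) (s : ℝ) :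
    timeKernel .heat t α s =
      Real.exp (-(freq α ^ 2) * max (t - s) 0) - if s ≤ t then 0 else 1 := by
  unfold timeKernel timeFactor
  split_ifs with h
  · rw [max_eq_left (by linarith), sub_zero]
  · rw [max_eq_right (by linarith)]; simp

lemma abs_timeKernel_wave_le {α : ℕ} (hα : 0 < α) (t s : ℝ) :
    |timeKernel .wave t α s| ≤ (α : ℝ)⁻¹ := by
  have hα' : (0 : ℝ) < α := by exact_mod_cast hα
  rw [timeKernel_wave, abs_div, abs_of_pos (freq_pos hα), ← one_div]
  exact div_le_div₀ zero_le_one (Real.abs_sin_le_one _) hα' (le_freq α)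

lemma abs_timeKernel_wave_sub_le {α : ℕ} (hα : 0 < α) (t s r : ℝ) :
    |timeKernel .wave t α s - timeKernel .wave t α r| ≤ |s - r| := by
  have hf := freq_pos hα
  rw [timeKernel_wave, timeKernel_wave, ← sub_div, abs_div, abs_of_pos hf, div_le_iff₀ hf]
  refine (abs_sin_sub_sin_le _ _).trans ?_
  rw [← mul_sub, abs_mul, abs_of_pos hf, mul_comm]
  refine mul_le_mul_of_nonneg_right ((abs_max_sub_max_le_abs _ _ _).trans ?_) hf.le
  rw [sub_sub_sub_cancel_left, abs_sub_comm]

lemma timeKernel_heat_nonneg (t : ℝ) (α : ℕ) (s : ℝ) : 0 ≤ timeKernel .heat t α s := by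
  unfold timeKernel timeFactor
  split_ifs
  · positivity
  · exact le_rfl

lemma timeKernel_heat_le_one (t : ℝ) (α : ℕ) (s : ℝ) : timeKernel .heat t α s ≤ 1 := by
  unfold timeKernel timeFactor
  split_ifs with h
  · rw [Real.exp_le_one_iff]
    nlinarith [sq_nonneg (freq α)]
  · exact zero_le_one

lemma abs_timeKernel_le_one (L : EquationKind) {α : ℕ} (hα : 0 < α) (t s : ℝ) :
    |timeKernel L t α s| ≤ 1 := by
  cases L
  · rw [abs_of_nonneg (timeKernel_heat_nonneg t α s)]
    exact timeKernel_heat_le_one t α s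
  · refine (abs_timeKernel_wave_le hα t s).trans (inv_le_one_of_one_le₀ ?_)
    exact_mod_cast hα

lemma integrableOn_timeKernel (L : EquationKind) {α : ℕ} (hα : 0 < α) (t a b : ℝ) :
    IntegrableOn (timeKernel L t α) (Ioc a b) :=
  Integrable.of_bound (by fun_prop) 1 (Eventually.of_forall fun s => abs_timeKernel_le_one L hα t s)

lemma integral_timeKernel_heat_le {α : ℕ} (hα : 0 < α) (ht : t ∈ Icc 0 T) :
    ∫ s in Ioc 0 T, timeKernel .heat t α s ≤ ((α : ℝ) ^ 2)⁻¹ := by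
  have hf := freq_pos hα
  have hα' : (0 : ℝ) < α := by exact_mod_cast hα
  have e : ∀ s ∈ Ioc 0 T, timeKernel .heat t α s =
      (Ioc 0 t).indicator (fun s => Real.exp (-(freq α ^ 2) * (t - s))) s := by
    intro s hs
    by_cases h : s ≤ t
    · rw [indicator_of_mem (show s ∈ Ioc 0 t from ⟨hs.1, h⟩)]; simp [timeKernel, timeFactor, h]
    · rw [indicator_of_notMem (show s ∉ Ioc 0 t from fun h' => h h'.2)]; simp [timeKernel, h]
  rw [setIntegral_congr_fun measurableSet_Ioc e, setIntegral_indicator measurableSet_Ioc,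
    inter_eq_right.2 (Ioc_subset_Ioc_right ht.2), ← intervalIntegral.integral_of_le ht.1,
    intervalIntegral.integral_eq_sub_of_hasDerivAt
      (f := fun s => Real.exp (-(freq α ^ 2) * (t - s)) / freq α ^ 2)]
  · have h1 : freq α ^ 2 ≥ (α : ℝ) ^ 2 := pow_le_pow_left₀ hα'.le (le_freq α) 2
    have h2 : (freq α ^ 2)⁻¹ ≤ ((α : ℝ) ^ 2)⁻¹ := by gcongr
    have h3 : 0 ≤ Real.exp (-(freq α ^ 2) * (t - 0)) / freq α ^ 2 := by positivity
    simp only [sub_self, mul_zero, Real.exp_zero, one_div]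
    linarith
  · intro s _
    have := ((((hasDerivAt_id s).const_sub t).const_mul (-(freq α ^ 2))).exp).div_const (freq α ^ 2)
    refine this.congr_deriv ?_
    simp only [id]
    field_simp
  · exact Continuous.intervalIntegrable (by fun_prop) _ _

/-- For heat the factor lies in `[0,1]`, so its square is at most itself; for wave the bound `1/α`
is pointwise. The constant `1 + T` covers both. -/
lemma lintegral_timeKernel_sq_le (L : EquationKind) {α : ℕ} (hα : 0 < α) (ht : t ∈ Icc 0 T) :
    ∫⁻ s in Icc 0 T, ENNReal.ofReal (timeKernel L t α s ^ 2) ≤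
      ENNReal.ofReal ((1 + T) * ((α : ℝ) ^ 2)⁻¹) := by
  have hT : 0 ≤ T := ht.1.trans ht.2
  rw [← restrict_Ioc_eq_restrict_Icc]
  have hinv : 0 ≤ ((α : ℝ) ^ 2)⁻¹ := by positivity
  cases L
  · calc _ ≤ ∫⁻ s in Ioc 0 T, ENNReal.ofReal (timeKernel .heat t α s) := by
          refine lintegral_mono fun s => ENNReal.ofReal_le_ofReal ?_
          have := timeKernel_heat_nonneg t α s
          have := timeKernel_heat_le_one t α s
          nlinarith
      _ = ENNReal.ofReal (∫ s in Ioc 0 T, timeKernel .heat t α s) :=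
          (ofReal_integral_eq_lintegral_ofReal (integrableOn_timeKernel .heat hα t 0 T)
            (Eventually.of_forall fun s => timeKernel_heat_nonneg t α s)).symm
      _ ≤ _ := ENNReal.ofReal_le_ofReal ((integral_timeKernel_heat_le hα ht).trans (by nlinarith))
  · calc _ ≤ ∫⁻ s in Ioc 0 T, ENNReal.ofReal (((α : ℝ) ^ 2)⁻¹) := by
          refine lintegral_mono fun s => ENNReal.ofReal_le_ofReal ?_
          rw [← inv_pow]
          have := abs_le.1 (abs_timeKernel_wave_le hα t s)
          exact sq_le_sq' this.1 this.2
      _ ≤ _ := by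
          rw [setLIntegral_const, Real.volume_Ioc, ← ENNReal.ofReal_mul hinv]
          apply ENNReal.ofReal_le_ofReal
          nlinarith

lemma cellAvg_sub (f g : ℝ → ℝ) {i : ℕ} (hf : IntegrableOn f (Ioc (i * k) ((i + 1) * k)))
    (hg : IntegrableOn g (Ioc (i * k) ((i + 1) * k))) :
    cellAvg k (fun s => f s - g s) i = cellAvg k f i - cellAvg k g i := by
  unfold cellAvg
  rw [integral_sub hf hg, mul_sub]

lemma sum_setIntegral_cell (hk : 0 < k) {f : ℝ → ℝ} (hf : IntegrableOn f (Ioc 0 (m * k))) :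
    ∑ i ∈ Finset.range m, ∫ s in Ioc (i * k) ((i + 1) * k), f s = ∫ s in Ioc 0 (m * k), f s := by
  have h1 : ∀ i : ℕ, (i : ℝ) * k ≤ (i + 1) * k := fun i => by linarith
  have h2 : ∀ i ∈ Finset.range m, ∫ s in Ioc (i * k) ((i + 1) * k), f s =
      ∫ s in ((i : ℕ) : ℝ) * k..((i + 1 : ℕ) : ℝ) * k, f s := by
    intro i _
    rw [intervalIntegral.integral_of_le (by push_cast; exact h1 i)]
    push_cast; rfl
  rw [Finset.sum_congr rfl h2, intervalIntegral.sum_integral_adjacent_intervals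
    (a := fun i : ℕ => (i : ℝ) * k), intervalIntegral.integral_of_le (by simp; positivity)]
  · simp
  · intro i hi
    rw [intervalIntegrable_iff_integrableOn_Ioc_of_le (by push_cast; exact h1 i)]
    push_cast
    exact hf.mono_set (cell_subset hk hi)

/-- A bound for `∫ |f - Af|` if `|f - Af| ≤ c i` on the `i`-th cell. -/
lemma lintegral_sub_avgStep_le (hk : 0 < k) {f : ℝ → ℝ} {c : ℕ → ℝ}
    (hc : ∀ i < m, ∀ s ∈ Ioc (i * k) ((i + 1) * k), |f s - cellAvg k f i| ≤ c i) :
    ∫⁻ s in Ioc 0 (m * k), ENNReal.ofReal |f s - avgStep m k f s| ≤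
      ENNReal.ofReal (k * ∑ i ∈ Finset.range m, c i) := by
  have hc0 : ∀ i ∈ Finset.range m, 0 ≤ c i := fun i hi =>
    (abs_nonneg _).trans (hc i (Finset.mem_range.1 hi) ((i + 1) * k) ⟨by linarith, le_rfl⟩)
  refine (lintegral_le_sum_cells hk _).trans ?_
  rw [Finset.mul_sum, ENNReal.ofReal_sum_of_nonneg fun i hi => mul_nonneg hk.le (hc0 i hi)]
  refine Finset.sum_le_sum fun i hi => ?_
  have hi' := Finset.mem_range.1 hi
  calc _ ≤ ∫⁻ s in Ioo (i * k) ((i + 1) * k), ENNReal.ofReal (c i) := by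
        refine setLIntegral_mono' measurableSet_Ioo fun s hs => ENNReal.ofReal_le_ofReal ?_
        rw [avgStep_of_mem hk _ hi' (Ioo_subset_Ioc_self hs)]
        exact hc i hi' s (Ioo_subset_Ioc_self hs)
    _ = _ := by
        rw [setLIntegral_const, Real.volume_Ioo, show ((i : ℝ) + 1) * k - i * k = k by ring, mul_comm,
          ENNReal.ofReal_mul hk.le]

/-- The oscillation over a cell is at most the increment between its endpoints, and these increments
telescope over the grid. -/
lemma abs_sub_cellAvg_le_of_monotone (hk : 0 < k) {f : ℝ → ℝ} (hf : Monotone f) {i : ℕ} {s : ℝ}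
    (hs : s ∈ Ioc (i * k) ((i + 1) * k)) :
    |f s - cellAvg k f i| ≤ f (((i + 1 : ℕ) : ℝ) * k) - f ((i : ℝ) * k) := by
  push_cast
  refine abs_sub_cellAvg_le hk ?_ fun x hx => ?_
  · exact (hf.monotoneOn _).integrableOn_isCompact (isCompact_Icc (a := (i : ℝ) * k)
      (b := (i + 1) * k)) |>.mono_set Ioc_subset_Icc_self
  · have h1 := hf hx.1.le
    have h2 := hf hx.2
    have h3 := hf hs.1.le
    have h4 := hf hs.2
    rw [abs_le]; constructor <;> linarith

lemma monotone_exp_max (t c : ℝ)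
    (hc : 0 ≤ c) : Monotone fun s => Real.exp (-c * max (t - s) 0) := by
  intro s r hsr
  apply Real.exp_le_exp.2
  have : max (t - r) 0 ≤ max (t - s) 0 := max_le_max (by linarith) le_rfl
  nlinarith

lemma monotone_ite (t : ℝ) : Monotone fun s : ℝ => if s ≤ t then (0 : ℝ) else 1 := by
  intro s r hsr
  by_cases hr : r ≤ t
  · simp [hr, hsr.trans hr]
  · simp only [hr, if_false]
    split_ifs <;> norm_num

/-- Each of the two monotone parts has total increment at most `1`, and each cell has length `k`.
The bound is useful for low modes. -/
lemma lintegral_timeKernel_heat_sub_avgStep_le (hk : 0 < k) {α : ℕ} :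
    ∫⁻ s in Ioc 0 (m * k), ENNReal.ofReal |timeKernel .heat t α s -
      avgStep m k (timeKernel .heat t α) s| ≤ ENNReal.ofReal (2 * k) := by
  set f : ℝ → ℝ := fun s => Real.exp (-(freq α ^ 2) * max (t - s) 0) with hf
  set g : ℝ → ℝ := fun s => if s ≤ t then (0 : ℝ) else 1 with hg
  have hfm : Monotone f := monotone_exp_max t _ (sq_nonneg _)
  have hgm : Monotone g := monotone_ite t
  have hfg : timeKernel .heat t α = fun s => f s - g s := funext fun s => timeKernel_heat t α s
  have hint : ∀ u : ℝ → ℝ, Monotone u → ∀ i : ℕ, IntegrableOn u (Ioc (i * k) ((i + 1) * k)) :=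
    fun u hu i => (hu.monotoneOn _).integrableOn_isCompact (isCompact_Icc (a := (i : ℝ) * k)
      (b := (i + 1) * k)) |>.mono_set Ioc_subset_Icc_self
  refine (lintegral_sub_avgStep_le hk (c := fun i => (f (((i + 1 : ℕ) : ℝ) * k) - f ((i : ℝ) * k)) +
    (g (((i + 1 : ℕ) : ℝ) * k) - g ((i : ℝ) * k))) fun i _ s hs => ?_).trans
    (ENNReal.ofReal_le_ofReal ?_)
  · rw [hfg, cellAvg_sub f g (hint f hfm i) (hint g hgm i)]
    have h1 := abs_sub_cellAvg_le_of_monotone hk hfm hs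
    have h2 := abs_sub_cellAvg_le_of_monotone hk hgm hs
    rw [show f s - g s - (cellAvg k f i - cellAvg k g i) =
      (f s - cellAvg k f i) - (g s - cellAvg k g i) by ring]
    exact (abs_sub _ _).trans (add_le_add h1 h2)
  · rw [Finset.sum_add_distrib, Finset.sum_range_sub (fun i : ℕ => f ((i : ℝ) * k)),
      Finset.sum_range_sub (fun i : ℕ => g ((i : ℝ) * k)), mul_comm 2]
    refine mul_le_mul_of_nonneg_left ?_ hk.le
    have h1 : f (m * k) ≤ 1 := by
      simp only [hf, Real.exp_le_one_iff]
      have : 0 ≤ max (t - m * k) 0 := le_max_right _ _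
      nlinarith [sq_nonneg (freq α)]
    have h2 : 0 ≤ f (((0 : ℕ) : ℝ) * k) := by positivity
    have h3 : g (m * k) ≤ 1 := by simp only [hg]; split_ifs <;> norm_num
    have h4 : 0 ≤ g (((0 : ℕ) : ℝ) * k) := by simp only [hg]; split_ifs <;> norm_num
    linarith

/-- Averaging preserves the integral of a nonnegative function, so the error costs at most twice
that integral. The bound is useful for high modes. -/
lemma lintegral_timeKernel_heat_sub_avgStep_le' (hk : 0 < k) (hmk : m * k = T) {α : ℕ} (hα : 0 < α)
    (ht : t ∈ Icc 0 T) :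
    ∫⁻ s in Ioc 0 (m * k), ENNReal.ofReal |timeKernel .heat t α s -
      avgStep m k (timeKernel .heat t α) s| ≤ ENNReal.ofReal (2 * ((α : ℝ) ^ 2)⁻¹) := by
  have hnn := timeKernel_heat_nonneg t α
  have hI := integrableOn_timeKernel .heat hα t 0 (m * k)
  have hA : ∀ i, 0 ≤ cellAvg k (timeKernel .heat t α) i := fun i =>
    mul_nonneg (by positivity) (setIntegral_nonneg measurableSet_Ioc fun s _ => hnn s)
  have hint := integral_timeKernel_heat_le hα ht
  calc _ ≤ ∫⁻ s in Ioc 0 (m * k), (ENNReal.ofReal (timeKernel .heat t α s) +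
        ENNReal.ofReal (avgStep m k (timeKernel .heat t α) s)) := by
        refine lintegral_mono fun s => ?_
        have h0 : 0 ≤ avgStep m k (timeKernel .heat t α) s :=
          Finset.sum_nonneg fun i _ => indicator_nonneg (fun _ _ => hA i) _
        rw [← ENNReal.ofReal_add (hnn s) h0]
        apply ENNReal.ofReal_le_ofReal
        rw [abs_le]; constructor <;> linarith [hnn s]
    _ ≤ ENNReal.ofReal (∫ s in Ioc 0 T, timeKernel .heat t α s) +
        ENNReal.ofReal (∫ s in Ioc 0 T, timeKernel .heat t α s) := by
        rw [lintegral_add_left (by fun_prop)]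
        refine add_le_add (le_of_eq ?_) ?_
        · rw [← hmk]
          exact (ofReal_integral_eq_lintegral_ofReal hI (Eventually.of_forall hnn)).symm
        · refine (lintegral_le_sum_cells hk _).trans ?_
          rw [← hmk, ← sum_setIntegral_cell hk hI, ENNReal.ofReal_sum_of_nonneg
            fun i _ => setIntegral_nonneg measurableSet_Ioc fun s _ => hnn s]
          refine Finset.sum_le_sum fun i hi => ?_
          have : ∀ s ∈ Ioo (i * k) ((i + 1) * k), ENNReal.ofReal (avgStep m k (timeKernel .heat t α) s)
              = ENNReal.ofReal (cellAvg k (timeKernel .heat t α) i) := fun s hs => by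
            rw [avgStep_of_mem hk _ (Finset.mem_range.1 hi) (Ioo_subset_Ioc_self hs)]
          rw [setLIntegral_congr_fun measurableSet_Ioo this, setLIntegral_const, Real.volume_Ioo,
            ← ENNReal.ofReal_mul (hA i), cellAvg]
          apply ENNReal.ofReal_le_ofReal
          apply le_of_eq
          field_simp
          ring
    _ ≤ _ := by
        rw [two_mul, ENNReal.ofReal_add (by positivity) (by positivity)]
        exact add_le_add (ENNReal.ofReal_le_ofReal hint) (ENNReal.ofReal_le_ofReal hint)

/-- For heat the difference is at most `1`, so its square is dominated by the `L¹` errors, with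
constant `2`. For wave it is pointwise at most `k` and `2/α`, which gives `4T` after integration in
time. -/
lemma lintegral_timeKernel_sub_avgStep_sq_le (L : EquationKind) (hk : 0 < k) (hmk : m * k = T)
    {α : ℕ} (hα : 0 < α) (ht : t ∈ Icc 0 T) :
    ∫⁻ s in Icc 0 T, ENNReal.ofReal ((timeKernel L t α s - avgStep m k (timeKernel L t α) s) ^ 2) ≤
      ENNReal.ofReal ((2 + 4 * T) * min (timeRes L k ^ 2) ((α : ℝ) ^ 2)⁻¹) := by
  have hT : 0 ≤ T := ht.1.trans ht.2
  have hα' : (0 : ℝ) < α := by exact_mod_cast hα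
  rw [← restrict_Ioc_eq_restrict_Icc]
  have hm0 : 0 ≤ min (timeRes L k ^ 2) ((α : ℝ) ^ 2)⁻¹ := by positivity
  cases L
  · have hnn := timeKernel_heat_nonneg t α
    have h1 : ∫⁻ s in Ioc 0 T, ENNReal.ofReal
        ((timeKernel .heat t α s - avgStep m k (timeKernel .heat t α) s) ^ 2) ≤
        ∫⁻ s in Ioc 0 (m * k), ENNReal.ofReal |timeKernel .heat t α s -
          avgStep m k (timeKernel .heat t α) s| := by
      rw [← hmk]
      refine setLIntegral_mono' measurableSet_Ioc fun s hs => ENNReal.ofReal_le_ofReal ?_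
      have h2 : |timeKernel .heat t α s - avgStep m k (timeKernel .heat t α) s| ≤ 1 := by
        obtain ⟨i, hi, hsi⟩ := exists_mem_cell hk hs
        rw [avgStep_of_mem hk _ hi hsi]
        refine abs_sub_cellAvg_le hk (integrableOn_timeKernel _ hα _ _ _) fun x _ => ?_
        have := timeKernel_heat_le_one t α s
        have := timeKernel_heat_le_one t α x
        rw [abs_le]; constructor <;> linarith [hnn s, hnn x]
      rw [← sq_abs]
      nlinarith [abs_nonneg (timeKernel .heat t α s - avgStep m k (timeKernel .heat t α) s)]
    refine h1.trans ?_
    have h3 := le_min (lintegral_timeKernel_heat_sub_avgStep_le (t := t) (m := m) (α := α) hk)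
      (lintegral_timeKernel_heat_sub_avgStep_le' hk hmk hα ht)
    refine h3.trans ?_
    rw [← ENNReal.ofReal_min, ← mul_min_of_nonneg _ _ zero_le_two]
    apply ENNReal.ofReal_le_ofReal
    simp only [timeRes, Real.sq_sqrt hk.le] at hm0 ⊢
    nlinarith
  · rw [← hmk]
    calc _ ≤ ∫⁻ s in Ioc 0 (m * k), ENNReal.ofReal (4 * min (k ^ 2) ((α : ℝ) ^ 2)⁻¹) := by
          refine setLIntegral_mono' measurableSet_Ioc fun s hs => ENNReal.ofReal_le_ofReal ?_
          obtain ⟨i, hi, hsi⟩ := exists_mem_cell hk hs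
          rw [avgStep_of_mem hk _ hi hsi]
          have h1 : |timeKernel .wave t α s - cellAvg k (timeKernel .wave t α) i| ≤ k := by
            refine abs_sub_cellAvg_le hk (integrableOn_timeKernel _ hα _ _ _) fun x hx => ?_
            refine (abs_timeKernel_wave_sub_le hα t x s).trans ?_
            rw [abs_le]; constructor <;> linarith [hx.1, hx.2, hsi.1, hsi.2]
          have h2 : |timeKernel .wave t α s - cellAvg k (timeKernel .wave t α) i| ≤
              2 * (α : ℝ)⁻¹ := by
            refine abs_sub_cellAvg_le hk (integrableOn_timeKernel _ hα _ _ _) fun x hx => ?_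
            refine (abs_sub _ _).trans ?_
            linarith [abs_timeKernel_wave_le hα t s, abs_timeKernel_wave_le hα t x]
          rw [← sq_abs, mul_min_of_nonneg _ _ (by norm_num : (0 : ℝ) ≤ 4)]
          refine le_min ?_ ?_
          · nlinarith [abs_nonneg (timeKernel .wave t α s - cellAvg k (timeKernel .wave t α) i),
              pow_le_pow_left₀ (abs_nonneg _) h1 2]
          · refine (pow_le_pow_left₀ (abs_nonneg _) h2 2).trans (le_of_eq ?_)
            rw [mul_pow, inv_pow]; norm_num
      _ ≤ _ := by
          rw [setLIntegral_const, Real.volume_Ioc, hmk, sub_zero, ← ENNReal.ofReal_mul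
            (by positivity)]
          apply ENNReal.ofReal_le_ofReal
          simp only [timeRes] at hm0 ⊢
          nlinarith

end TimeEstimates

/-! ### Lower semicontinuity of the norm -/

section Fatou

variable {H T : ℝ}

lemma ennreal_le_liminf_add (u v : ℕ → ℝ≥0∞) :
    liminf u atTop + liminf v atTop ≤ liminf (fun N => u N + v N) atTop := by
  simp only [liminf_eq_iSup_iInf_of_nat]
  rw [ENNReal.iSup_add_iSup_of_monotone]
  · refine iSup_mono fun n => le_iInf₂ fun i hi => add_le_add ?_ ?_
    · exact iInf₂_le i hi
    · exact iInf₂_le i hi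
  · exact fun a b hab => biInf_mono fun i hi => le_trans hab hi
  · exact fun a b hab => biInf_mono fun i hi => le_trans hab hi

lemma ennreal_const_mul_liminf_le (c : ℝ≥0∞) (u : ℕ → ℝ≥0∞) :
    c * liminf u atTop ≤ liminf (fun N => c * u N) atTop := by
  have := ENNReal.le_liminf_mul (f := atTop) (u := fun _ : ℕ => c) (v := u)
  rwa [liminf_const] at this

/-- Fatou's lemma in the double and in the weighted integral. Pointwise convergence suffices, which
matters for the conditionally convergent wave kernel. -/
lemma spaceNormSq_le_liminf {v : ℕ → ℝ → ℝ} {w : ℝ → ℝ} (hv : ∀ N, Measurable (v N))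
    (hlim : ∀ y ∈ Ioo (0 : ℝ) 1, Tendsto (fun N => v N y) atTop (𝓝 (w y))) :
    spaceNormSq H w ≤ liminf (fun N => spaceNormSq H (v N)) atTop := by
  unfold spaceNormSq
  refine le_trans (add_le_add ?_ ?_) (ennreal_le_liminf_add _ _)
  · refine le_trans (mul_le_mul_right ?_ _) (ennreal_const_mul_liminf_le _ _)
    refine le_trans (setLIntegral_mono' measurableSet_Ioo fun x hx => ?_) (lintegral_liminf_le ?_)
    · refine le_trans (setLIntegral_mono' measurableSet_Ioo fun y hy => ?_)
        (lintegral_liminf_le fun N => ?_)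
      · refine (Tendsto.liminf_eq (ENNReal.tendsto_ofReal ?_)).ge
        exact (((hlim x hx).sub (hlim y hy)).pow 2).div_const _
      · have := hv N
        fun_prop
    · intro N
      refine Measurable.lintegral_prod_right' (f := fun q : ℝ × ℝ =>
        ENNReal.ofReal ((v N q.1 - v N q.2) ^ 2 / |q.1 - q.2| ^ (2 - 2 * H))) ?_
      have := hv N
      fun_prop
  · refine le_trans (mul_le_mul_right ?_ _) (ennreal_const_mul_liminf_le _ _)
    refine le_trans (setLIntegral_mono' measurableSet_Ioo fun x hx => ?_)
      (lintegral_liminf_le fun N => ?_)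
    · refine (Tendsto.liminf_eq (ENNReal.tendsto_ofReal ?_)).ge
      exact ((hlim x hx).pow 2).mul_const _
    · have := hv N
      fun_prop

lemma noiseNormSq_le_liminf {f : ℕ → ℝ → ℝ → ℝ} {g : ℝ → ℝ → ℝ}
    (hf : ∀ N, Measurable (Function.uncurry (f N))) (hg : Measurable (Function.uncurry g))
    (hlim : ∀ᵐ s ∂(volume.restrict (Icc 0 T)), ∀ y ∈ Ioo (0 : ℝ) 1,
      Tendsto (fun N => f N s y) atTop (𝓝 (g s y))) :
    noiseNormSq H T g ≤ liminf (fun N => noiseNormSq H T (f N)) atTop := by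
  simp_rw [noiseNormSq_eq_lintegral hg, fun N => noiseNormSq_eq_lintegral (H := H) (T := T) (hf N)]
  refine le_trans (lintegral_mono_ae ?_) (lintegral_liminf_le fun N => measurable_spaceNormSq (hf N))
  filter_upwards [hlim] with s hs
  exact spaceNormSq_le_liminf (fun N => (hf N).comp measurable_prodMk_left) hs

lemma measurable_noiseNormSq {β : Type*} [MeasurableSpace β] {f : β → ℝ → ℝ → ℝ}
    (hf : Measurable fun q : (β × ℝ) × ℝ => f q.1.1 q.1.2 q.2) :
    Measurable fun x => noiseNormSq H T (f x) := by
  have h1 : ∀ x, Measurable (Function.uncurry (f x)) := fun x =>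
    hf.comp (g := fun q : (β × ℝ) × ℝ => f q.1.1 q.1.2 q.2) (f := fun z : ℝ × ℝ => ((x, z.1), z.2))
      (by fun_prop)
  simp_rw [fun x => noiseNormSq_eq_lintegral (H := H) (T := T) (h1 x)]
  exact Measurable.lintegral_prod_right' (measurable_spaceNormSq (f := fun q : β × ℝ => f q.1 q.2) hf)

end Fatou

/-! ### Decoupling of the modes -/

section Parseval

variable {H T : ℝ} {S : Finset ℕ}

/-- The integral over `x` is moved innermost by Tonelli, and Parseval is applied for each fixed `y`,
`y'`. Only orthogonality in `x` is used: the functions `u α` need not be orthogonal in the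
fractional norm. -/
lemma lintegral_spaceNormSq_sum_eigenfun (hS : ∀ α ∈ S, 0 < α) {u : ℕ → ℝ → ℝ}
    (hu : ∀ α, Measurable (u α)) :
    ∫⁻ x in Ioo 0 1, spaceNormSq H (fun y => ∑ α ∈ S, eigenfun α x * u α y) =
      ∑ α ∈ S, spaceNormSq H (u α) := by
  let f : ℝ → ℝ → ℝ := fun x y => ∑ α ∈ S, eigenfun α x * u α y
  have hf : Measurable (Function.uncurry f) := by
    simp only [f]
    fun_prop
  have hd : ∀ x y y', f x y - f x y' = ∑ α ∈ S, eigenfun α x * (u α y - u α y') := by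
    intro x y y'
    simp only [f, ← Finset.sum_sub_distrib, mul_sub]
  have hM3 : Measurable fun q : (ℝ × ℝ) × ℝ =>
      ENNReal.ofReal ((f q.1.1 q.1.2 - f q.1.1 q.2) ^ 2 / |q.1.2 - q.2| ^ (2 - 2 * H)) := by
    simp only [f]
    fun_prop
  have e1 : ∫⁻ x in Ioo 0 1, ∫⁻ y in Ioo 0 1, ∫⁻ y' in Ioo 0 1,
      ENNReal.ofReal ((f x y - f x y') ^ 2 / |y - y'| ^ (2 - 2 * H)) =
      ∑ α ∈ S, ∫⁻ y in Ioo 0 1, ∫⁻ y' in Ioo 0 1,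
        ENNReal.ofReal ((u α y - u α y') ^ 2 / |y - y'| ^ (2 - 2 * H)) := by
    rw [lintegral_lintegral_swap (hM3.lintegral_prod_right').aemeasurable]
    rw [← lintegral_finsetSum' _ fun α _ => ?_]
    · refine lintegral_congr fun y => ?_
      rw [lintegral_lintegral_swap, ← lintegral_finsetSum' _ fun α _ => ?_]
      · refine lintegral_congr fun y' => ?_
        simp_rw [hd, div_eq_mul_inv]
        exact lintegral_sq_sum_eigenfun S hS (fun α => u α y - u α y') (by positivity)
      · have := hu α
        fun_prop
      · exact (hM3.comp (g := fun q : (ℝ × ℝ) × ℝ => ENNReal.ofReal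
          ((f q.1.1 q.1.2 - f q.1.1 q.2) ^ 2 / |q.1.2 - q.2| ^ (2 - 2 * H)))
          (f := fun z : ℝ × ℝ => ((z.1, y), z.2)) (by fun_prop)).aemeasurable
    · have := hu α
      exact (Measurable.lintegral_prod_right' (f := fun q : ℝ × ℝ =>
        ENNReal.ofReal ((u α q.1 - u α q.2) ^ 2 / |q.1 - q.2| ^ (2 - 2 * H)))
        (by fun_prop)).aemeasurable
  have e2 : ∫⁻ x in Ioo 0 1, ∫⁻ y in Ioo 0 1,
        ENNReal.ofReal (f x y ^ 2 * (y ^ (2 * H - 1) + (1 - y) ^ (2 * H - 1))) =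
      ∑ α ∈ S, ∫⁻ y in Ioo 0 1,
        ENNReal.ofReal (u α y ^ 2 * (y ^ (2 * H - 1) + (1 - y) ^ (2 * H - 1))) := by
    rw [lintegral_lintegral_swap, ← lintegral_finsetSum' _ fun α _ => ?_]
    · refine setLIntegral_congr_fun measurableSet_Ioo fun y hy => ?_
      have := hy.1.le
      have : 0 ≤ 1 - y := by linarith [hy.2]
      exact lintegral_sq_sum_eigenfun S hS (fun α => u α y) (by positivity)
    · have := hu α
      fun_prop
    · simp only [f]
      fun_prop
  unfold spaceNormSq
  rw [lintegral_add_left ((measurable_lintegral_seminorm hf).const_mul _),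
    lintegral_const_mul _ (measurable_lintegral_seminorm hf),
    lintegral_const_mul _ (measurable_lintegral_weight hf), e1, e2, Finset.sum_add_distrib,
    Finset.mul_sum, Finset.mul_sum]

lemma lintegral_noiseNormSq_sum_eigenfun (hS : ∀ α ∈ S, 0 < α) {f : ℕ → ℝ → ℝ → ℝ}
    (hf : ∀ α, Measurable (Function.uncurry (f α))) :
    ∫⁻ x in Ioo 0 1, noiseNormSq H T (fun s y => ∑ α ∈ S, eigenfun α x * f α s y) =
      ∑ α ∈ S, noiseNormSq H T (f α) := by
  have h3 : ∀ α, Measurable fun q : (ℝ × ℝ) × ℝ => f α q.1.2 q.2 := fun α =>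
    (hf α).comp (f := fun q : (ℝ × ℝ) × ℝ => (q.1.2, q.2)) (by fun_prop)
  have hm : Measurable fun q : (ℝ × ℝ) × ℝ => ∑ α ∈ S, eigenfun α q.1.1 * f α q.1.2 q.2 := by
    fun_prop
  have h2 : ∀ x, Measurable (Function.uncurry fun s y => ∑ α ∈ S, eigenfun α x * f α s y) :=
    fun x => hm.comp (g := fun q : (ℝ × ℝ) × ℝ => ∑ α ∈ S, eigenfun α q.1.1 * f α q.1.2 q.2)
      (f := fun z : ℝ × ℝ => ((x, z.1), z.2)) (by fun_prop)
  simp_rw [fun x => noiseNormSq_eq_lintegral (H := H) (T := T) (h2 x),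
    fun α => noiseNormSq_eq_lintegral (H := H) (T := T) (hf α)]
  rw [lintegral_lintegral_swap, ← lintegral_finsetSum' _
    fun α _ => (measurable_spaceNormSq (hf α)).aemeasurable]
  · refine lintegral_congr fun s => ?_
    exact lintegral_spaceNormSq_sum_eigenfun hS fun α => (hf α).comp measurable_prodMk_left
  · exact (measurable_spaceNormSq (f := fun (z : ℝ × ℝ) y => ∑ α ∈ S, eigenfun α z.1 * f α z.2 y)
      hm).aemeasurable

end Parseval

/-! ### The deterministic error estimate -/

section DeterministicError

variable {H T t k h : ℝ} {m n : ℕ} {L : EquationKind}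

/-- The difference of `g ⊗ φ_α` and its average over the cells of the grid, where `g` is the temporal
factor of the kernel. -/
def modeError (L : EquationKind) (t : ℝ) (m n : ℕ) (k h : ℝ) (α : ℕ) (s y : ℝ) : ℝ :=
  timeKernel L t α s * eigenfun α y -
    avgStep m k (timeKernel L t α) s * avgStep n h (eigenfun α) y

lemma measurable_modeError (α : ℕ) : Measurable (Function.uncurry (modeError L t m n k h α)) := by
  unfold modeError Function.uncurry
  fun_prop

lemma noiseNormSq_modeError_le (hH : 0 < H) (hH' : H ≤ 1 / 2) (hk : 0 < k) (hmk : m * k = T)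
    (hn : 0 < n) (hh : h = 1 / n) (ht : t ∈ Icc 0 T) {α : ℕ} (hα : 0 < α) :
    noiseNormSq H T (modeError L t m n k h α) ≤ ENNReal.ofReal (400 * (1 + T) *
      (min (timeRes L k ^ 2) ((α : ℝ) ^ 2)⁻¹ * h ^ (2 * H - 1) +
        min (h ^ (1 + 2 * H)) ((α : ℝ) ^ (-(1 + 2 * H))))) := by
  have hT : 0 ≤ T := ht.1.trans ht.2
  have hα' : (0 : ℝ) < α := by exact_mod_cast hα
  have hn' : (0 : ℝ) < n := by exact_mod_cast hn
  have hpos : 0 < h := by rw [hh]; positivity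
  -- The temporal error is paired with the averaged eigenfunction, whose squared norm is at most `6
  -- h^{2H-1}` uniformly in `α`; this is the source of `h^{H-1/2}` in the rate. In the other term
  -- the factor `α²` of the spatial error is cancelled by the `α^{-2}` of the temporal factor.
  have hdec : modeError L t m n k h α = fun s y =>
      timeKernel L t α s * (eigenfun α y - avgStep n h (eigenfun α) y) +
      (timeKernel L t α s - avgStep m k (timeKernel L t α) s) * avgStep n h (eigenfun α) y := by
    ext s y; unfold modeError; ring
  rw [hdec]
  refine (noiseNormSq_add_le ?_ ?_).trans ?_
  · unfold Function.uncurry; fun_prop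
  · unfold Function.uncurry; fun_prop
  rw [noiseNormSq_mul (u := timeKernel L t α)
      (v := fun y => eigenfun α y - avgStep n h (eigenfun α) y) (by fun_prop) (by fun_prop),
    noiseNormSq_mul (u := fun s => timeKernel L t α s - avgStep m k (timeKernel L t α) s)
      (v := avgStep n h (eigenfun α)) (by fun_prop) (by fun_prop)]
  have h1 := mul_le_mul' (lintegral_timeKernel_sq_le L hα ht)
    (spaceNormSq_eigenfun_sub_avgStep_le hH hH' hn hh hα)
  have h2 := mul_le_mul' (lintegral_timeKernel_sub_avgStep_sq_le L hk hmk hα ht)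
    (spaceNormSq_avgStep_eigenfun_le hH hH' hn hh α)
  refine (add_le_add (mul_le_mul_right h1 _) (mul_le_mul_right h2 _)).trans ?_
  set A := min (timeRes L k ^ 2) ((α : ℝ) ^ 2)⁻¹
  set B := min (h ^ (1 + 2 * H)) ((α : ℝ) ^ (-(1 + 2 * H)))
  have hA : 0 ≤ A := by positivity
  have hB : 0 ≤ B := by positivity
  set R := h ^ (2 * H - 1)
  have hR : 0 ≤ R := by positivity
  rw [show (2 : ℝ≥0∞) = ENNReal.ofReal 2 by simp, ← ENNReal.ofReal_mul (by positivity),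
    ← ENNReal.ofReal_mul (by positivity), ← ENNReal.ofReal_mul (by positivity),
    ← ENNReal.ofReal_mul (by positivity), ← ENNReal.ofReal_add (by positivity) (by positivity)]
  apply ENNReal.ofReal_le_ofReal
  have e : (1 + T) * ((α : ℝ) ^ 2)⁻¹ * (200 * α ^ 2 * B) = 200 * (1 + T) * B := by
    field_simp
  rw [e]
  have hAR : 0 ≤ A * R := by positivity
  nlinarith [mul_nonneg hT hAR]

/-- The partial sums of the difference of the kernel and its cell averages. -/
def partialError (L : EquationKind) (t : ℝ) (m n : ℕ) (k h : ℝ) (N : ℕ) (x s y : ℝ) : ℝ :=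
  ∑ α ∈ Finset.Icc 1 N, eigenfun α x * modeError L t m n k h α s y

/-- The constant in the deterministic error estimate. -/
def errorConst (H T : ℝ) : ℝ := 400 * (1 + T) * (2 + (1 + 2 * H) / (2 * H))

lemma measurable_partialError (N : ℕ) :
    Measurable fun q : (ℝ × ℝ) × ℝ => partialError L t m n k h N q.1.1 q.1.2 q.2 := by
  have h3 : ∀ α, Measurable fun q : (ℝ × ℝ) × ℝ => modeError L t m n k h α q.1.2 q.2 := fun α =>
    (measurable_modeError α).comp (f := fun q : (ℝ × ℝ) × ℝ => (q.1.2, q.2)) (by fun_prop)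
  unfold partialError
  fun_prop

lemma timeRes_pos (hk : 0 < k) : 0 < timeRes L k := by
  cases L
  · exact Real.sqrt_pos.2 hk
  · exact hk

/-- The bound does not depend on `N`, which is what Fatou's lemma will need. -/
lemma lintegral_noiseNormSq_partialError_le (hH : 0 < H) (hH' : H ≤ 1 / 2) (hk : 0 < k)
    (hmk : m * k = T) (hn : 0 < n) (hh : h = 1 / n) (ht : t ∈ Icc 0 T) (N : ℕ) :
    ∫⁻ x in Ioo 0 1, noiseNormSq H T (partialError L t m n k h N x) ≤
      ENNReal.ofReal (errorConst H T * (timeRes L k * h ^ (2 * H - 1) + h ^ (2 * H))) := by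
  have hT : 0 ≤ T := ht.1.trans ht.2
  have hn' : (0 : ℝ) < n := by exact_mod_cast hn
  have hpos : 0 < h := by rw [hh]; positivity
  have hκ := timeRes_pos (L := L) hk
  have hS : ∀ α ∈ Finset.Icc 1 N, 0 < α := fun α hα => (Finset.mem_Icc.1 hα).1
  have h1 := lintegral_noiseNormSq_sum_eigenfun (H := H) (T := T) hS
    (fun α => measurable_modeError (L := L) (t := t) (m := m) (n := n) (k := k) (h := h) α)
  refine h1.le.trans ((Finset.sum_le_sum fun α hα =>
    noiseNormSq_modeError_le hH hH' hk hmk hn hh ht (hS α hα)).trans ?_)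
  rw [← ENNReal.ofReal_sum_of_nonneg (fun α _ => by positivity)]
  apply ENNReal.ofReal_le_ofReal
  rw [← Finset.mul_sum, Finset.sum_add_distrib, ← Finset.sum_mul, errorConst,
    mul_assoc (400 * (1 + T)) (2 + (1 + 2 * H) / (2 * H))]
  refine mul_le_mul_of_nonneg_left ?_ (by positivity)
  -- Exponent `2` sums the temporal errors to `2κ`. Exponent `1 + 2H`, which exceeds `1` because `H
  -- > 0`, sums the spatial ones to `(1 + 2H)/(2H) * h^{2H}`; `errorConst` collects both
  -- coefficients.
  have s1 := sum_min_rpow_le (s := 2) one_lt_two hκ N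
  have s2 := sum_min_rpow_le (s := 1 + 2 * H) (by linarith) hpos N
  have e1 : ∀ α ∈ Finset.Icc 1 N, min (timeRes L k ^ 2) ((α : ℝ) ^ 2)⁻¹ =
      min (timeRes L k ^ (2 : ℝ)) ((α : ℝ) ^ (-2 : ℝ)) := by
    intro α _
    rw [Real.rpow_neg (Nat.cast_nonneg α)]
    norm_num
  rw [← Finset.sum_congr rfl e1, show (2 : ℝ) / (2 - 1) * timeRes L k ^ ((2 : ℝ) - 1) = 2 * timeRes L k by
    norm_num] at s1
  rw [show 1 + 2 * H - 1 = 2 * H by ring] at s2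
  have hr1 : 0 ≤ h ^ (2 * H - 1) := by positivity
  have hr2 : 0 ≤ h ^ (2 * H) := by positivity
  have hc : 0 ≤ (1 + 2 * H) / (2 * H) := by positivity
  have s3 := mul_le_mul_of_nonneg_right s1 hr1
  have s4 : 0 ≤ (1 + 2 * H) / (2 * H) * (timeRes L k * h ^ (2 * H - 1)) := by positivity
  nlinarith [mul_nonneg zero_le_two hr2]

/-- A bound for the square of the norm of the difference of the kernel at `x` and its cell
averages. -/
def kernelError (L : EquationKind) (H T t : ℝ) (m n : ℕ) (k h x : ℝ) : ℝ≥0∞ :=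
  liminf (fun N => noiseNormSq H T (partialError L t m n k h N x)) atTop

@[fun_prop]
lemma measurable_kernelError : Measurable (kernelError L H T t m n k h) :=
  Measurable.liminf fun N => measurable_noiseNormSq (measurable_partialError N)

lemma lintegral_kernelError_le (hH : 0 < H) (hH' : H ≤ 1 / 2) (hk : 0 < k)
    (hmk : m * k = T) (hn : 0 < n) (hh : h = 1 / n) (ht : t ∈ Icc 0 T) :
    ∫⁻ x in Ioo 0 1, kernelError L H T t m n k h x ≤
      ENNReal.ofReal (errorConst H T * (timeRes L k * h ^ (2 * H - 1) + h ^ (2 * H))) := by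
  refine (lintegral_liminf_le fun N => measurable_noiseNormSq (measurable_partialError N)).trans ?_
  refine (liminf_le_liminf (Eventually.of_forall fun N =>
    lintegral_noiseNormSq_partialError_le hH hH' hk hmk hn hh ht N)).trans ?_
  rw [liminf_const]

end DeterministicError

/-! ### Convergence of the eigenfunction expansion of the Green's function -/

section Green

variable {T t k h : ℝ} {m n : ℕ} {L : EquationKind}

lemma two_mul_sin_half_mul_sum_sin (θ : ℝ) (N : ℕ) :
    2 * Real.sin (θ / 2) * ∑ i ∈ Finset.range N, Real.sin ((i + 1) * θ) =
      Real.cos (θ / 2) - Real.cos ((N + 1 / 2) * θ) := by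
  induction N with
  | zero => simp; ring_nf
  | succ N ih =>
    rw [Finset.sum_range_succ, mul_add, ih]
    have e1 : ((N : ℝ) + 1 / 2) * θ = (N + 1) * θ - θ / 2 := by ring
    have e2 : (((N + 1 : ℕ) : ℝ) + 1 / 2) * θ = (N + 1) * θ + θ / 2 := by push_cast; ring
    rw [e1, e2, Real.cos_sub, Real.cos_add]
    ring

/-- Away from multiples of `2π` the sum telescopes after multiplication by `2 sin(θ/2)`; at these
multiples every term is zero. -/
lemma exists_abs_sum_sin_le (θ : ℝ) :
    ∃ b, ∀ N, ‖∑ i ∈ Finset.range N, Real.sin ((i + 1) * θ)‖ ≤ b := by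
  by_cases hθ : Real.sin (θ / 2) = 0
  · obtain ⟨j, hj⟩ := Real.sin_eq_zero_iff.1 hθ
    refine ⟨0, fun N => ?_⟩
    rw [Finset.sum_eq_zero, norm_zero]
    intro i _
    have : ((i : ℝ) + 1) * θ = (((i + 1) * 2 * j : ℤ) : ℝ) * Real.pi := by
      push_cast
      linear_combination (-2 * ((i : ℝ) + 1)) * hj
    rw [this, Real.sin_int_mul_pi]
  · refine ⟨2 / |2 * Real.sin (θ / 2)|, fun N => ?_⟩
    have h0 : 0 < |2 * Real.sin (θ / 2)| := abs_pos.2 (mul_ne_zero two_ne_zero hθ)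
    rw [le_div_iff₀ h0, Real.norm_eq_abs, ← abs_mul, mul_comm, two_mul_sin_half_mul_sum_sin]
    refine (abs_sub _ _).trans ?_
    linarith [Real.abs_cos_le_one (θ / 2), Real.abs_cos_le_one ((N + 1 / 2) * θ)]

/-- The series `∑ sin(jθ) / j` converges. -/
lemma exists_tendsto_sum_sin_div (θ : ℝ) :
    ∃ l, Tendsto (fun N : ℕ => ∑ j ∈ Finset.Icc 1 N, Real.sin (j * θ) / j) atTop (𝓝 l) := by
  obtain ⟨b, hb⟩ := exists_abs_sum_sin_le θ
  have hanti : Antitone fun i : ℕ => 1 / ((i : ℝ) + 1) := fun i j hij => by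
    simp only
    gcongr
  -- Dirichlet's test: the coefficients decrease to zero and the sine sums stay bounded.
  have hc := hanti.cauchySeq_series_mul_of_tendsto_zero_of_bounded
    (tendsto_one_div_add_atTop_nhds_zero_nat (𝕜 := ℝ)) hb
  obtain ⟨l, hl⟩ := cauchySeq_tendsto_of_complete hc
  refine ⟨l, hl.congr fun N => ?_⟩
  rw [Finset.range_eq_Ico, Finset.sum_congr rfl (g := fun i : ℕ =>
    Real.sin (((i + 1 : ℕ) : ℝ) * θ) / ((i + 1 : ℕ) : ℝ)) (fun i _ => by
      simp only [smul_eq_mul]; push_cast; ring),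
    Finset.sum_Ico_add' (fun j : ℕ => Real.sin ((j : ℝ) * θ) / (j : ℝ)) 0 N 1]
  rfl

lemma four_mul_sin_mul_sin_mul_sin (a x y : ℝ) :
    4 * (Real.sin a * Real.sin x * Real.sin y) =
      Real.sin (a + x - y) + Real.sin (a - x + y) - Real.sin (a + x + y) - Real.sin (a - x - y) := by
  simp only [Real.sin_add, Real.sin_sub, Real.cos_add, Real.cos_sub]
  ring

/-- A product of three sines is a signed sum of four, so the series splits into four series of the
form `∑ sin(jθ)/j`. -/
lemma exists_tendsto_green_wave (τ x y : ℝ) :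
    ∃ l, Tendsto (fun N : ℕ => ∑ α ∈ Finset.Icc 1 N,
      timeFactor .wave α τ * eigenfun α x * eigenfun α y) atTop (𝓝 l) := by
  obtain ⟨l1, h1⟩ := exists_tendsto_sum_sin_div (Real.pi * (τ + x - y))
  obtain ⟨l2, h2⟩ := exists_tendsto_sum_sin_div (Real.pi * (τ - x + y))
  obtain ⟨l3, h3⟩ := exists_tendsto_sum_sin_div (Real.pi * (τ + x + y))
  obtain ⟨l4, h4⟩ := exists_tendsto_sum_sin_div (Real.pi * (τ - x - y))
  refine ⟨1 / (2 * Real.pi) * (l1 + l2 - l3 - l4),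
    ((((h1.add h2).sub h3).sub h4).const_mul _).congr fun N => ?_⟩
  rw [← Finset.sum_add_distrib, ← Finset.sum_sub_distrib, ← Finset.sum_sub_distrib, Finset.mul_sum]
  refine Finset.sum_congr rfl fun α hα => ?_
  have hα' : (α : ℝ) ≠ 0 := by
    have := (Finset.mem_Icc.1 hα).1
    positivity
  have h4 := four_mul_sin_mul_sin_mul_sin (α * Real.pi * τ) (α * Real.pi * x) (α * Real.pi * y)
  have hs : √2 * √2 = (2 : ℝ) := Real.mul_self_sqrt (by norm_num)
  have e1 : (α : ℝ) * (Real.pi * (τ + x - y)) =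
    α * Real.pi * τ + α * Real.pi * x - α * Real.pi * y := by ring
  have e2 : (α : ℝ) * (Real.pi * (τ - x + y)) =
    α * Real.pi * τ - α * Real.pi * x + α * Real.pi * y := by ring
  have e3 : (α : ℝ) * (Real.pi * (τ + x + y)) =
    α * Real.pi * τ + α * Real.pi * x + α * Real.pi * y := by ring
  have e4 : (α : ℝ) * (Real.pi * (τ - x - y)) =
    α * Real.pi * τ - α * Real.pi * x - α * Real.pi * y := by ring
  rw [e1, e2, e3, e4, ← add_div, ← sub_div, ← sub_div, ← h4]
  simp only [timeFactor, eigenfun, freq]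
  generalize Real.sin (α * Real.pi * τ) = a
  generalize Real.sin (α * Real.pi * x) = b
  generalize Real.sin (α * Real.pi * y) = c
  field_simp
  linear_combination (-2 * (a * b * c)) * hs

/-- From `e^u ≥ 1 + u` the exponential is at most `1/(α²τ)`, a summable bound for fixed `τ > 0`. -/
lemma exists_tendsto_green_heat {τ : ℝ} (hτ : 0 < τ) (x y : ℝ) :
    ∃ l, Tendsto (fun N : ℕ => ∑ α ∈ Finset.Icc 1 N,
      timeFactor .heat α τ * eigenfun α x * eigenfun α y) atTop (𝓝 l) := by
  have hsum : Summable fun i : ℕ => timeFactor .heat (i + 1) τ * eigenfun (i + 1) x *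
      eigenfun (i + 1) y := by
    have h2 : Summable fun i : ℕ => 2 / τ * (1 / ((i + 1 : ℕ) : ℝ) ^ 2) :=
      ((summable_nat_add_iff 1).2 (Real.summable_one_div_nat_pow.2 one_lt_two)).mul_left _
    refine Summable.of_norm_bounded h2 fun i => ?_
    set α := i + 1
    have hα : (0 : ℝ) < α := by positivity
    have h3 : Real.exp (-(freq α ^ 2) * τ) ≤ 1 / (α ^ 2 * τ) := by
      have h4 : (α : ℝ) ^ 2 * τ ≤ freq α ^ 2 * τ := by
        have := pow_le_pow_left₀ hα.le (le_freq α) 2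
        gcongr
      have h5 := Real.add_one_le_exp (freq α ^ 2 * τ)
      rw [neg_mul, Real.exp_neg, ← one_div]
      apply one_div_le_one_div_of_le (by positivity)
      linarith
    have h6 : |eigenfun α x| * |eigenfun α y| ≤ 2 := by
      have := mul_le_mul (abs_eigenfun_le α x) (abs_eigenfun_le α y) (abs_nonneg _)
        (Real.sqrt_nonneg 2)
      rwa [Real.mul_self_sqrt zero_le_two] at this
    rw [mul_assoc, norm_mul, norm_mul, Real.norm_eq_abs, Real.norm_eq_abs, Real.norm_eq_abs, timeFactor,
      abs_of_pos (Real.exp_pos _)]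
    calc _ ≤ 1 / ((α : ℝ) ^ 2 * τ) * 2 := by gcongr
      _ = _ := by field_simp
  refine ⟨_, hsum.hasSum.tendsto_sum_nat.congr fun N => ?_⟩
  rw [Finset.range_eq_Ico, Finset.sum_Ico_add' (fun α : ℕ => timeFactor .heat α τ * eigenfun α x *
      eigenfun α y) 0 N 1]
  rfl

lemma tendsto_green (L : EquationKind) {τ : ℝ} (hτ : 0 < τ) (x y : ℝ) :
    Tendsto (fun N : ℕ => ∑ α ∈ Finset.Icc 1 N,
      timeFactor L α τ * eigenfun α x * eigenfun α y) atTop (𝓝 (green L τ x y)) := by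
  cases L
  · exact tendsto_nhds_limUnder (exists_tendsto_green_heat hτ x y)
  · exact tendsto_nhds_limUnder (exists_tendsto_green_wave τ x y)

/-- The partial sums of the eigenfunction expansion of the kernel. -/
def kernelSum (L : EquationKind) (t : ℝ) (N : ℕ) (x s y : ℝ) : ℝ :=
  ∑ α ∈ Finset.Icc 1 N, eigenfun α x * (timeKernel L t α s * eigenfun α y)

/-- At `s = t` the heat series is the expansion of a delta function and need not converge; that time
is a null set. -/
lemma tendsto_kernelSum (L : EquationKind) {t s : ℝ} (hs : s ≠ t) (x y : ℝ) :
    Tendsto (fun N => kernelSum L t N x s y) atTop (𝓝 (kernel L t x s y)) := by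
  unfold kernelSum timeKernel kernel
  by_cases h : s ≤ t
  · simp only [if_pos h]
    refine (tendsto_green L (sub_pos.2 (lt_of_le_of_ne h hs)) x y).congr fun N => ?_
    exact Finset.sum_congr rfl fun α _ => by ring
  · simp [h]

lemma measurable_kernel (L : EquationKind) (t x : ℝ) :
    Measurable (Function.uncurry (kernel L t x)) := by
  have hg : Measurable fun z : ℝ × ℝ => green L (t - z.1) x z.2 := by
    refine (StronglyMeasurable.limUnder (l := atTop) (f := fun (N : ℕ) (z : ℝ × ℝ) =>
      ∑ α ∈ Finset.Icc 1 N, timeFactor L α (t - z.1) * eigenfun α x * eigenfun α z.2)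
      fun N => ?_).measurable
    have := continuous_timeFactor L
    exact Continuous.stronglyMeasurable (by fun_prop)
  exact Measurable.ite (measurableSet_le measurable_fst measurable_const) hg measurable_const

lemma measurable_kernelSum (L : EquationKind) (t : ℝ) (N : ℕ) (x : ℝ) :
    Measurable (Function.uncurry (kernelSum L t N x)) := by
  unfold kernelSum Function.uncurry
  fun_prop

lemma ae_fst_ne (t : ℝ) (A : Set (ℝ × ℝ)) :
    ∀ᵐ z ∂((volume : Measure (ℝ × ℝ)).restrict A), z.1 ≠ t := by
  refine ae_restrict_of_ae ?_
  rw [Measure.volume_eq_prod]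
  exact Measure.quasiMeasurePreserving_fst.ae (Measure.ae_ne volume t)

/-- By orthogonality in `y` the tail is a sum of terms of order `α^{-2}` over `α > N`, for every
`x`. -/
lemma lintegral_kernelSum_sub_le (ht : t ∈ Icc 0 T) (x : ℝ) {N M : ℕ} (hN : 0 < N) (hNM : N ≤ M) :
    ∫⁻ z in Ioc 0 T ×ˢ Ioc 0 1,
      ENNReal.ofReal ((kernelSum L t M x z.1 z.2 - kernelSum L t N x z.1 z.2) ^ 2) ≤
      ENNReal.ofReal (2 * (1 + T) * (N : ℝ)⁻¹) := by
  have hT : 0 ≤ T := ht.1.trans ht.2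
  have hdiff : ∀ s y, kernelSum L t M x s y - kernelSum L t N x s y =
      ∑ α ∈ Finset.Ioc N M, eigenfun α y * (eigenfun α x * timeKernel L t α s) := by
    intro s y
    unfold kernelSum
    have : Finset.Icc 1 M = Finset.Icc 1 N ∪ Finset.Ioc N M := by
      ext α; simp only [Finset.mem_Icc, Finset.mem_union, Finset.mem_Ioc]; omega
    rw [this, Finset.sum_union, add_sub_cancel_left]
    · exact Finset.sum_congr rfl fun α _ => by ring
    · rw [Finset.disjoint_left]
      intro α h1 h2
      have := Finset.mem_Icc.1 h1
      have := Finset.mem_Ioc.1 h2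
      omega
  have hS : ∀ α ∈ Finset.Ioc N M, 0 < α := fun α hα => by
    have := Finset.mem_Ioc.1 hα
    omega
  have hm : Measurable fun z : ℝ × ℝ => kernelSum L t M x z.1 z.2 - kernelSum L t N x z.1 z.2 :=
    (measurable_kernelSum L t M x).sub (measurable_kernelSum L t N x)
  rw [Measure.volume_eq_prod, ← Measure.prod_restrict, lintegral_prod _
    (hm.pow_const 2).ennreal_ofReal.aemeasurable, ← restrict_Ioo_eq_restrict_Ioc (a := (0 : ℝ)) (b := 1)]
  have hin : ∀ s, ∫⁻ y in Ioo 0 1,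
      ENNReal.ofReal ((kernelSum L t M x s y - kernelSum L t N x s y) ^ 2) =
      ∑ α ∈ Finset.Ioc N M, ENNReal.ofReal ((eigenfun α x * timeKernel L t α s) ^ 2) := by
    intro s
    have := lintegral_sq_sum_eigenfun (Finset.Ioc N M) hS
      (fun α => eigenfun α x * timeKernel L t α s) zero_le_one
    simpa [hdiff] using this
  simp_rw [hin]
  rw [lintegral_finsetSum' _ fun α _ => by fun_prop, restrict_Ioc_eq_restrict_Icc]
  have hterm : ∀ α ∈ Finset.Ioc N M, ∫⁻ s in Icc 0 T,
      ENNReal.ofReal ((eigenfun α x * timeKernel L t α s) ^ 2) ≤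
      ENNReal.ofReal (2 * (1 + T) * ((α : ℝ) ^ 2)⁻¹) := by
    intro α hα
    calc _ ≤ ∫⁻ s in Icc 0 T, ENNReal.ofReal 2 * ENNReal.ofReal (timeKernel L t α s ^ 2) := by
          refine lintegral_mono fun s => ?_
          rw [← ENNReal.ofReal_mul zero_le_two, mul_pow]
          apply ENNReal.ofReal_le_ofReal
          refine mul_le_mul_of_nonneg_right ?_ (sq_nonneg _)
          have := pow_le_pow_left₀ (abs_nonneg _) (abs_eigenfun_le α x) 2
          rwa [sq_abs, Real.sq_sqrt zero_le_two] at this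
      _ ≤ _ := by
          rw [lintegral_const_mul' _ _ ENNReal.ofReal_ne_top, mul_assoc,
            ENNReal.ofReal_mul zero_le_two]
          exact mul_le_mul_right (lintegral_timeKernel_sq_le L (hS α hα) ht) _
  refine (Finset.sum_le_sum hterm).trans ?_
  rw [← ENNReal.ofReal_sum_of_nonneg (fun α _ => by positivity), ← Finset.mul_sum]
  apply ENNReal.ofReal_le_ofReal
  refine mul_le_mul_of_nonneg_left ?_ (by positivity)
  have := sum_Ioc_inv_sq_le_sub (α := ℝ) hN.ne' hNM
  have h0 : 0 ≤ (M : ℝ)⁻¹ := by positivity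
  linarith

lemma lintegral_kernel_sub_kernelSum_le (ht : t ∈ Icc 0 T) (x : ℝ) {N : ℕ} (hN : 0 < N) :
    ∫⁻ z in Ioc 0 T ×ˢ Ioc 0 1,
      ENNReal.ofReal ((kernel L t x z.1 z.2 - kernelSum L t N x z.1 z.2) ^ 2) ≤
      ENNReal.ofReal (2 * (1 + T) * (N : ℝ)⁻¹) := by
  calc _ ≤ ∫⁻ z in Ioc 0 T ×ˢ Ioc 0 1, liminf (fun M => ENNReal.ofReal
        ((kernelSum L t M x z.1 z.2 - kernelSum L t N x z.1 z.2) ^ 2)) atTop := by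
        refine lintegral_mono_ae ?_
        filter_upwards [ae_fst_ne t _] with z hz
        refine (Tendsto.liminf_eq (ENNReal.tendsto_ofReal ?_)).ge
        exact ((tendsto_kernelSum L hz x z.2).sub_const _).pow 2
    _ ≤ liminf (fun M => ∫⁻ z in Ioc 0 T ×ˢ Ioc 0 1, ENNReal.ofReal
        ((kernelSum L t M x z.1 z.2 - kernelSum L t N x z.1 z.2) ^ 2)) atTop :=
        lintegral_liminf_le fun M => (((measurable_kernelSum L t M x).sub
          (measurable_kernelSum L t N x)).pow_const 2).ennreal_ofReal
    _ ≤ _ := by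
        refine liminf_le_of_frequently_le' (Eventually.frequently ?_)
        filter_upwards [eventually_ge_atTop N] with M hM
        exact lintegral_kernelSum_sub_le ht x hN hM

/-- Convergence in the unweighted `L²` yields integrability of the kernel and allows the limit to be
taken inside cell averages. -/
lemma tendsto_eLpNorm_kernelSum (ht : t ∈ Icc 0 T) (x : ℝ) :
    Tendsto (fun N => eLpNorm (fun z : ℝ × ℝ => kernel L t x z.1 z.2 - kernelSum L t N x z.1 z.2) 2
      (volume.restrict (Ioc 0 T ×ˢ Ioc 0 1))) atTop (𝓝 0) := by
  have hb : Tendsto (fun N : ℕ => ENNReal.ofReal (2 * (1 + T) * (N : ℝ)⁻¹) ^ (1 / 2 : ℝ)) atTop (𝓝 0) := by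
    have h1 : Tendsto (fun N : ℕ => 2 * (1 + T) * (N : ℝ)⁻¹) atTop (𝓝 0) := by
      simpa using (tendsto_inv_atTop_nhds_zero_nat (𝕜 := ℝ)).const_mul (2 * (1 + T))
    have h2 := (ENNReal.continuous_rpow_const (y := 1 / 2)).tendsto 0 |>.comp
      (by simpa using ENNReal.tendsto_ofReal h1)
    simpa [Function.comp_def] using h2
  refine tendsto_of_tendsto_of_tendsto_of_le_of_le' tendsto_const_nhds hb
    (Eventually.of_forall fun _ => zero_le) ?_
  filter_upwards [eventually_gt_atTop 0] with N hN
  rw [eLpNorm_eq_lintegral_rpow_enorm_toReal two_ne_zero ENNReal.ofNat_ne_top]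
  have e : ∫⁻ z in Ioc 0 T ×ˢ Ioc 0 1,
      ‖kernel L t x z.1 z.2 - kernelSum L t N x z.1 z.2‖ₑ ^ (2 : ℝ≥0∞).toReal =
      ∫⁻ z in Ioc 0 T ×ˢ Ioc 0 1,
        ENNReal.ofReal ((kernel L t x z.1 z.2 - kernelSum L t N x z.1 z.2) ^ 2) := by
    refine lintegral_congr fun z => ?_
    rw [Real.enorm_eq_ofReal_abs, ENNReal.ofReal_rpow_of_nonneg (abs_nonneg _) (by simp)]
    simp
  rw [e, ENNReal.toReal_ofNat]
  exact ENNReal.rpow_le_rpow (lintegral_kernel_sub_kernelSum_le ht x hN) (by norm_num)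

end Green

/-! ### Cell averages of the kernel and the Wong–Zakai convolution -/

section CellAverages

variable {H T t k h : ℝ} {m n : ℕ} {L : EquationKind}

/-- The cell `(ik, (i+1)k] × (jh, (j+1)h]` of the grid. -/
def gridCell (k h : ℝ) (i j : ℕ) : Set (ℝ × ℝ) :=
  Ioc (i * k) ((i + 1) * k) ×ˢ Ioc (j * h) ((j + 1) * h)

/-- The average of the kernel over a cell of the grid. -/
def kernelAvg (L : EquationKind) (t k h x : ℝ) (i j : ℕ) : ℝ :=
  1 / (k * h) * ∫ z in gridCell k h i j, kernel L t x z.1 z.2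

lemma measurableSet_gridCell (k h : ℝ) (i j : ℕ) : MeasurableSet (gridCell k h i j) :=
  measurableSet_Ioc.prod measurableSet_Ioc

lemma gridCell_subset (hk : 0 < k) (hmk : m * k = T) (hh : 0 < h) (hnh : n * h = 1) {i j : ℕ}
    (hi : i < m) (hj : j < n) : gridCell k h i j ⊆ Ioc 0 T ×ˢ Ioc 0 1 := by
  refine prod_mono ?_ ?_
  · rw [← hmk]; exact cell_subset hk hi
  · have := cell_subset hh hj
    rwa [hnh] at this

lemma memLp_kernelSum (N : ℕ) (x : ℝ) :
    MemLp (fun z : ℝ × ℝ => kernelSum L t N x z.1 z.2) 2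
      (volume.restrict (Ioc 0 T ×ˢ Ioc 0 1)) := by
  have : IsFiniteMeasure ((volume : Measure (ℝ × ℝ)).restrict (Ioc 0 T ×ˢ Ioc 0 1)) := by
    rw [Measure.volume_eq_prod, ← Measure.prod_restrict]; infer_instance
  refine MemLp.of_bound (measurable_kernelSum L t N x).aestronglyMeasurable
    (∑ α ∈ Finset.Icc 1 N, √2 * (1 * √2)) (Eventually.of_forall fun z => ?_)
  refine (norm_sum_le _ _).trans (Finset.sum_le_sum fun α hα => ?_)
  rw [norm_mul, norm_mul]
  exact mul_le_mul (abs_eigenfun_le α x) (mul_le_mul (abs_timeKernel_le_one L (Finset.mem_Icc.1 hα).1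
    t z.1) (abs_eigenfun_le α z.2) (norm_nonneg _) zero_le_one) (by positivity) (by positivity)

lemma integrableOn_kernel (ht : t ∈ Icc 0 T) (x : ℝ) :
    IntegrableOn (fun z : ℝ × ℝ => kernel L t x z.1 z.2) (Ioc 0 T ×ˢ Ioc 0 1) := by
  have : IsFiniteMeasure ((volume : Measure (ℝ × ℝ)).restrict (Ioc 0 T ×ˢ Ioc 0 1)) := by
    rw [Measure.volume_eq_prod, ← Measure.prod_restrict]; infer_instance
  obtain ⟨N, hN⟩ := ((tendsto_eLpNorm_kernelSum (L := L) ht x).eventually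
    (gt_mem_nhds (zero_lt_one))).exists
  have h1 : MemLp (fun z : ℝ × ℝ => kernel L t x z.1 z.2 - kernelSum L t N x z.1 z.2) 2
      (volume.restrict (Ioc 0 T ×ˢ Ioc 0 1)) :=
    ⟨((measurable_kernel L t x).sub (measurable_kernelSum L t N x)).aestronglyMeasurable,
      hN.trans ENNReal.one_lt_top⟩
  have h2 := (h1.add (memLp_kernelSum (L := L) (t := t) (T := T) N x)).integrable (by norm_num)
  refine h2.congr (Eventually.of_forall fun z => ?_)
  simp

lemma tendsto_setIntegral_kernelSum (ht : t ∈ Icc 0 T) (x : ℝ) {A : Set (ℝ × ℝ)}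
    (hA : A ⊆ Ioc 0 T ×ˢ Ioc 0 1) :
    Tendsto (fun N => ∫ z in A, kernelSum L t N x z.1 z.2) atTop
      (𝓝 (∫ z in A, kernel L t x z.1 z.2)) := by
  have : IsFiniteMeasure ((volume : Measure (ℝ × ℝ)).restrict (Ioc 0 T ×ˢ Ioc 0 1)) := by
    rw [Measure.volume_eq_prod, ← Measure.prod_restrict]; infer_instance
  set μ := (volume : Measure (ℝ × ℝ)).restrict (Ioc 0 T ×ˢ Ioc 0 1) with hμ
  have hle : (volume : Measure (ℝ × ℝ)).restrict A ≤ μ := Measure.restrict_mono hA le_rfl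
  have h1 : Tendsto (fun N => eLpNorm (fun z : ℝ × ℝ => kernelSum L t N x z.1 z.2 -
      kernel L t x z.1 z.2) 1 (volume.restrict A)) atTop (𝓝 0) := by
    have h2 := ENNReal.Tendsto.mul_const (b := μ univ ^ (1 / (1 : ℝ≥0∞).toReal - 1 / (2 : ℝ≥0∞).toReal))
      (tendsto_eLpNorm_kernelSum (L := L) ht x) (Or.inr (by
        refine ENNReal.rpow_ne_top_of_nonneg (by norm_num) (measure_ne_top _ _)))
    rw [zero_mul] at h2
    refine tendsto_of_tendsto_of_tendsto_of_le_of_le tendsto_const_nhds h2 (fun _ => zero_le) fun N => ?_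
    calc _ = eLpNorm (fun z : ℝ × ℝ => kernel L t x z.1 z.2 - kernelSum L t N x z.1 z.2) 1
          (volume.restrict A) := eLpNorm_sub_comm _ _ _ _
      _ ≤ eLpNorm (fun z : ℝ × ℝ => kernel L t x z.1 z.2 - kernelSum L t N x z.1 z.2) 1 μ :=
          eLpNorm_mono_measure _ hle
      _ ≤ _ := eLpNorm_le_eLpNorm_mul_rpow_measure_univ (by norm_num)
          ((measurable_kernel L t x).sub (measurable_kernelSum L t N x)).aestronglyMeasurable
  simp_rw [eLpNorm_one_eq_lintegral_enorm] at h1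
  refine tendsto_integral_of_L1 _ ((integrableOn_kernel ht x).mono_set hA).1 (Eventually.of_forall
    fun N => ?_) h1
  exact (((memLp_kernelSum (L := L) (t := t) (T := T) N x).integrable (by norm_num))).mono_measure hle

/-- Cells are products, so the average of each mode factors into a temporal and a spatial average.
This identifies the partial sums of the averaged kernel with the second part of `modeError`. -/
lemma setIntegral_kernelSum_gridCell (hk : 0 < k) (hh : 0 < h) (N : ℕ) (x : ℝ) (i j : ℕ) :
    1 / (k * h) * ∫ z in gridCell k h i j, kernelSum L t N x z.1 z.2 =
      ∑ α ∈ Finset.Icc 1 N, eigenfun α x *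
        (cellAvg k (timeKernel L t α) i * cellAvg h (eigenfun α) j) := by
  unfold kernelSum
  have hprod : ∀ α : ℕ, ∫ z in gridCell k h i j, timeKernel L t α z.1 * eigenfun α z.2 =
      (∫ s in Ioc (i * k) ((i + 1) * k), timeKernel L t α s) *
        ∫ y in Ioc (j * h) ((j + 1) * h), eigenfun α y := fun α => by
    rw [gridCell, Measure.volume_eq_prod]
    exact setIntegral_prod_mul (timeKernel L t α) (eigenfun α) _ _
  have hint : ∀ α ∈ Finset.Icc 1 N, IntegrableOn
      (fun z : ℝ × ℝ => timeKernel L t α z.1 * eigenfun α z.2) (gridCell k h i j) := fun α hα => by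
    rw [gridCell, Measure.volume_eq_prod, IntegrableOn, ← Measure.prod_restrict]
    exact (integrableOn_timeKernel L (Finset.mem_Icc.1 hα).1 t _ _).mul_prod
      (integrableOn_eigenfun α _ _)
  rw [integral_finsetSum _ fun α hα => (hint α hα).const_mul _, Finset.mul_sum]
  refine Finset.sum_congr rfl fun α hα => ?_
  rw [integral_const_mul, hprod, cellAvg, cellAvg]
  field_simp

lemma tendsto_kernelAvg (ht : t ∈ Icc 0 T) (hk : 0 < k) (hmk : m * k = T) (hh : 0 < h)
    (hnh : n * h = 1) (x : ℝ) {i j : ℕ} (hi : i < m) (hj : j < n) :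
    Tendsto (fun N => ∑ α ∈ Finset.Icc 1 N, eigenfun α x *
        (cellAvg k (timeKernel L t α) i * cellAvg h (eigenfun α) j)) atTop
      (𝓝 (kernelAvg L t k h x i j)) := by
  simp_rw [← setIntegral_kernelSum_gridCell hk hh]
  exact (tendsto_setIntegral_kernelSum ht x (gridCell_subset hk hmk hh hnh hi hj)).const_mul _

lemma measurable_kernelAvg (ht : t ∈ Icc 0 T) (hk : 0 < k) (hmk : m * k = T) (hh : 0 < h)
    (hnh : n * h = 1) {i j : ℕ} (hi : i < m) (hj : j < n) :
    Measurable fun x => kernelAvg L t k h x i j :=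
  measurable_of_tendsto_metrizable (f := fun N x => ∑ α ∈ Finset.Icc 1 N, eigenfun α x *
        (cellAvg k (timeKernel L t α) i * cellAvg h (eigenfun α) j)) (fun N => by fun_prop)
    (tendsto_pi_nhds.2 fun x => tendsto_kernelAvg ht hk hmk hh hnh x hi hj)

/-- The step function on the uniform grid whose values are the cell averages of the kernel. -/
def kernelStep (L : EquationKind) (t x : ℝ) (hk : 0 < k) (hmk : m * k = T) (hh : 0 < h)
    (hnh : n * h = 1) : StepFun T where
  M := m
  N := n
  a i := i * k
  b j := j * h
  c := kernelAvg L t k h x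
  a_zero := by simp
  a_last := hmk
  a_lt i _ := by push_cast; linarith
  b_zero := by simp
  b_last := hnh
  b_lt j _ := by push_cast; linarith

lemma kernelStep_toFun (x : ℝ) (hk : 0 < k) (hmk : m * k = T) (hh : 0 < h)
    (hnh : n * h = 1) {i j : ℕ} (hi : i < m) (hj : j < n) {s y : ℝ}
    (hs : s ∈ Ioc (i * k) ((i + 1) * k)) (hy : y ∈ Ioc (j * h) ((j + 1) * h)) :
    (kernelStep L t x hk hmk hh hnh).toFun s y = kernelAvg L t k h x i j := by
  simp only [StepFun.toFun, kernelStep]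
  push_cast
  rw [Finset.sum_eq_single i, Finset.sum_eq_single j]
  · exact indicator_of_mem (show (s, y) ∈ _ ×ˢ _ from ⟨hs, hy⟩) _
  · intro j' _ hj'
    exact indicator_of_notMem (fun hm => hj' (eq_of_mem_cell hh hm.2 hy)) _
  · simp [hj]
  · intro i' _ hi'
    exact Finset.sum_eq_zero fun j' _ =>
      indicator_of_notMem (fun hm => hi' (eq_of_mem_cell hk hm.1 hs)) _
  · simp [hi]

/-- For `s ≠ t` the partial errors converge pointwise to the kernel minus its cell averages, and the
norm is lower semicontinuous. -/
lemma noiseNormSq_kernel_sub_kernelStep_le (ht : t ∈ Icc 0 T) (hk : 0 < k) (hmk : m * k = T)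
    (hh : 0 < h) (hnh : n * h = 1) (x : ℝ) :
    noiseNormSq H T (fun s y => kernel L t x s y - (kernelStep L t x hk hmk hh hnh).toFun s y) ≤
      kernelError L H T t m n k h x := by
  refine noiseNormSq_le_liminf (fun N => ?_)
    ((measurable_kernel L t x).sub (StepFun.measurable_toFun _)) ?_
  · exact (measurable_partialError N).comp
      (g := fun q : (ℝ × ℝ) × ℝ => partialError L t m n k h N q.1.1 q.1.2 q.2)
      (f := fun z : ℝ × ℝ => ((x, z.1), z.2)) (by fun_prop)
  · rw [← restrict_Ioc_eq_restrict_Icc]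
    filter_upwards [ae_restrict_mem measurableSet_Ioc, ae_restrict_of_ae (Measure.ae_ne volume t)]
      with s hs hst y hy
    obtain ⟨i, hi, hsi⟩ := exists_mem_cell (n := m) hk (s := s) (by rwa [hmk])
    obtain ⟨j, hj, hyj⟩ := exists_mem_cell (n := n) hh (s := y) (by
      rw [hnh]; exact Ioo_subset_Ioc_self hy)
    rw [kernelStep_toFun x hk hmk hh hnh hi hj hsi hyj]
    refine ((tendsto_kernelSum L hst x y).sub
      (tendsto_kernelAvg ht hk hmk hh hnh x hi hj)).congr fun N => ?_
    unfold kernelSum partialError modeError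
    rw [← Finset.sum_sub_distrib]
    refine Finset.sum_congr rfl fun α _ => ?_
    rw [avgStep_of_mem hk _ hi hsi, avgStep_of_mem hh _ hj hyj]
    ring

/-- The Wong–Zakai convolution is the stochastic integral of the cell averages of the kernel. -/
lemma convApprox_eq_integral_kernelStep {Ω : Type*} (W : ℝ → ℝ → Ω → ℝ) (ht : t ∈ Icc 0 T)
    (hk : 0 < T / m) (hmk : m * (T / m) = T) (hh : 0 < (1 / n : ℝ)) (hnh : n * (1 / n : ℝ) = 1)
    (x : ℝ) (ω : Ω) :
    convApprox L T W m n t x ω = (kernelStep L t x hk hmk hh hnh).integral W ω := by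
  let d : ℕ → ℕ → ℝ := fun i j => 1 / ((T / m) * (1 / n)) *
    rectIncr W (i * (T / m)) ((i + 1) * (T / m)) (j * (1 / n)) ((j + 1) * (1 / n)) ω
  let F : ℝ × ℝ → ℝ := fun z => ∑ i ∈ Finset.range m, ∑ j ∈ Finset.range n, d i j *
    (gridCell (T / m) (1 / n) i j).indicator (fun z => kernel L t x z.1 z.2) z
  have hF : ∀ s y, kernel L t x s y * noiseApprox T W m n s y ω = F (s, y) := by
    intro s y
    simp only [noiseApprox, F, Finset.mul_sum]
    refine Finset.sum_congr rfl fun i _ => Finset.sum_congr rfl fun j _ => ?_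
    simp only [gridCell, d, indicator_apply]
    split_ifs <;> ring
  have hi : ∀ i j, IntegrableOn (fun z => d i j * (gridCell (T / m) (1 / n) i j).indicator
      (fun z => kernel L t x z.1 z.2) z) (Ioc 0 T ×ˢ Ioc 0 1) := fun i j =>
    ((integrableOn_kernel ht x).indicator (measurableSet_gridCell _ _ _ _)).const_mul _
  have hFi : IntegrableOn F (Ioc 0 T ×ˢ Ioc 0 1) :=
    integrable_finsetSum _ fun i _ => integrable_finsetSum _ fun j _ => hi i j
  calc convApprox L T W m n t x ω
      = ∫ s in Ioc 0 t, ∫ y in Ioo 0 1, F (s, y) := by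
        unfold convApprox
        refine setIntegral_congr_fun measurableSet_Ioc fun s hs => ?_
        congr 1 with y
        rw [← hF, kernel, if_pos hs.2]
    -- The kernel vanishes for `s > t`, so the time integral extends to `T` even when `t` lies
    -- inside a cell.
    _ = ∫ s in Ioc 0 T, ∫ y in Ioo 0 1, F (s, y) := by
        refine (setIntegral_eq_of_subset_of_forall_sdiff_eq_zero measurableSet_Ioc
          (Ioc_subset_Ioc_right ht.2) fun s hs => ?_).symm
        have hst : ¬ s ≤ t := fun hle => hs.2 ⟨hs.1.1, hle⟩
        have : ∀ y, F (s, y) = 0 := fun y => by rw [← hF, kernel, if_neg hst, zero_mul]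
        simp [this]
    _ = ∫ z in Ioc 0 T ×ˢ Ioc 0 1, F z := by
        rw [restrict_Ioo_eq_restrict_Ioc, Measure.volume_eq_prod, setIntegral_prod _ hFi]
    _ = ∑ i ∈ Finset.range m, ∑ j ∈ Finset.range n,
          d i j * ∫ z in gridCell (T / m) (1 / n) i j, kernel L t x z.1 z.2 := by
        rw [integral_finsetSum _ fun i _ => integrable_finsetSum _ fun j _ => hi i j]
        refine Finset.sum_congr rfl fun i hir => ?_
        rw [integral_finsetSum _ fun j _ => hi i j]
        refine Finset.sum_congr rfl fun j hjr => ?_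
        rw [integral_const_mul, setIntegral_indicator (measurableSet_gridCell _ _ _ _),
          inter_eq_right.2 (gridCell_subset hk hmk hh hnh (Finset.mem_range.1 hir)
            (Finset.mem_range.1 hjr))]
    -- The factor `1/(kh)` passes from the average of the noise to the average of the kernel.
    _ = _ := by
        simp only [StepFun.integral, kernelStep, kernelAvg]
        push_cast
        refine Finset.sum_congr rfl fun i _ => Finset.sum_congr rfl fun j _ => ?_
        simp only [d]
        ring

end CellAverages

/-! ### From pointwise moments to moments of the spatial norm -/

section Moments

/-- If the `q`-th moments of `u x` are bounded by those of a deterministic density `N x`, then so is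
the `q`-th moment of the integral of `u`. -/
lemma lintegral_rpow_lintegral_le {α Ω : Type*} [MeasurableSpace α] [MeasurableSpace Ω]
    {μ : Measure α} [SFinite μ] {P : Measure Ω} [SFinite P] {u : α × Ω → ℝ≥0∞}
    (hu : AEMeasurable u (μ.prod P)) {N : α → ℝ≥0∞} (hN : Measurable N) (hN0 : ∀ x, N x ≠ 0)
    {E c : ℝ≥0∞} (hE : E ≠ ∞) (hNE : ∫⁻ x, N x ∂μ ≤ E) {q : ℝ} (hq : 1 ≤ q)
    (hb : ∀ᵐ x ∂μ, ∫⁻ ω, u (x, ω) ^ q ∂P ≤ c * N x ^ q) :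
    ∫⁻ ω, (∫⁻ x, u (x, ω) ∂μ) ^ q ∂P ≤ c * E ^ q := by
  have hq0 : 0 < q := by linarith
  have hNfin : ∀ᵐ x ∂μ, N x ≠ ∞ :=
    (ae_lt_top hN (hNE.trans_lt hE.lt_top).ne).mono fun x hx => hx.ne
  have hswap : ∀ v : α × Ω → ℝ≥0∞, AEMeasurable v (μ.prod P) →
      ∫⁻ ω, ∫⁻ x, v (x, ω) ∂μ ∂P = ∫⁻ x, ∫⁻ ω, v (x, ω) ∂P ∂μ := fun v hv =>
    (lintegral_lintegral_swap (f := fun x ω => v (x, ω)) hv).symm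
  -- For `q = 1` there is no finite conjugate exponent, and Tonelli suffices.
  rcases hq.eq_or_lt with rfl | hq1
  · simp only [ENNReal.rpow_one] at hb ⊢
    rw [hswap u hu]
    calc _ ≤ ∫⁻ x, c * N x ∂μ := lintegral_mono_ae hb
      _ ≤ _ := by
          rw [lintegral_const_mul _ hN]
          gcongr
  obtain ⟨q', hconj⟩ : ∃ q', q.HolderConjugate q' := ⟨_, Real.HolderConjugate.conjExponent hq1⟩
  have hqq : q / q' = q - 1 := by
    rw [div_eq_iff hconj.symm.pos.ne', hconj.sub_one_mul_conj]
  have hq'0 : 0 < q' := hconj.symm.pos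
  have hqm : 0 < q - 1 := by linarith
  have hprodfin : ∀ᵐ ω ∂P, AEMeasurable (fun x => u (x, ω)) μ := by
    have h1 : AEMeasurable (fun z : Ω × α => u (z.2, z.1)) (P.prod μ) :=
      hu.prod_swap
    filter_upwards [h1.aestronglyMeasurable.prodMk_left] with ω hω using hω.aemeasurable
  -- Hölder with the deterministic weight: `u` is written as `u N^{-1/q'}` times `N^{1/q'}`. After
  -- taking expectations the weighted term is bounded by `c N`, and no Minkowski inequality is
  -- required.
  have hpt : ∀ᵐ ω ∂P, (∫⁻ x, u (x, ω) ∂μ) ^ q ≤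
      (∫⁻ x, u (x, ω) ^ q * (N x ^ (q - 1))⁻¹ ∂μ) * E ^ (q - 1) := by
    filter_upwards [hprodfin] with ω hω
    have hid : ∫⁻ x, u (x, ω) ∂μ =
        ∫⁻ x, ((fun x => u (x, ω) * (N x ^ (1 / q'))⁻¹) * fun x => N x ^ (1 / q')) x ∂μ := by
      refine lintegral_congr_ae ?_
      filter_upwards [hNfin] with x hx
      simp only [Pi.mul_apply]
      rw [mul_assoc, ENNReal.inv_mul_cancel, mul_one]
      · exact (ENNReal.rpow_pos (pos_iff_ne_zero.2 (hN0 x)) hx).ne'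
      · exact ENNReal.rpow_ne_top_of_nonneg (by positivity) hx
    have hH := ENNReal.lintegral_mul_le_Lp_mul_Lq μ hconj
      (f := fun x => u (x, ω) * (N x ^ (1 / q'))⁻¹) (g := fun x => N x ^ (1 / q'))
      (hω.mul (hN.pow_const _).inv.aemeasurable) (hN.pow_const _).aemeasurable
    rw [hid]
    refine (ENNReal.rpow_le_rpow hH hq0.le).trans ?_
    rw [ENNReal.mul_rpow_of_nonneg _ _ hq0.le, ← ENNReal.rpow_mul, ← ENNReal.rpow_mul,
      one_div_mul_cancel hq0.ne', ENNReal.rpow_one]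
    refine mul_le_mul' (le_of_eq ?_) ?_
    · refine lintegral_congr fun x => ?_
      rw [ENNReal.mul_rpow_of_nonneg _ _ hq0.le, ENNReal.inv_rpow, ← ENNReal.rpow_mul,
        show 1 / q' * q = q - 1 by rw [← hqq]; ring]
    · rw [show 1 / q' * q = q - 1 by rw [← hqq]; ring]
      refine ENNReal.rpow_le_rpow (le_trans (le_of_eq ?_) hNE) hqm.le
      refine lintegral_congr fun x => ?_
      rw [← ENNReal.rpow_mul, one_div_mul_cancel hq'0.ne', ENNReal.rpow_one]
  calc _ ≤ ∫⁻ ω, (∫⁻ x, u (x, ω) ^ q * (N x ^ (q - 1))⁻¹ ∂μ) * E ^ (q - 1) ∂P :=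
        lintegral_mono_ae hpt
    _ = (∫⁻ ω, ∫⁻ x, u (x, ω) ^ q * (N x ^ (q - 1))⁻¹ ∂μ ∂P) * E ^ (q - 1) :=
        lintegral_mul_const' _ _ (ENNReal.rpow_ne_top_of_nonneg hqm.le hE)
    _ = (∫⁻ x, ∫⁻ ω, u (x, ω) ^ q * (N x ^ (q - 1))⁻¹ ∂P ∂μ) * E ^ (q - 1) := by
        rw [hswap (fun z => u z ^ q * (N z.1 ^ (q - 1))⁻¹) (by fun_prop)]
    _ ≤ (∫⁻ x, c * N x ∂μ) * E ^ (q - 1) := by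
        refine mul_le_mul_left (lintegral_mono_ae ?_) _
        filter_upwards [hb, hNfin] with x hx hxfin
        have h0 : N x ^ (q - 1) ≠ 0 := (ENNReal.rpow_pos (pos_iff_ne_zero.2 (hN0 x)) hxfin).ne'
        have ht : N x ^ (q - 1) ≠ ∞ := ENNReal.rpow_ne_top_of_nonneg hqm.le hxfin
        rw [lintegral_mul_const' _ _ (ENNReal.inv_ne_top.2 h0)]
        refine (mul_le_mul_left hx _).trans (le_of_eq ?_)
        have : N x ^ q = N x * N x ^ (q - 1) := by
          conv_lhs => rw [show q = 1 + (q - 1) by ring]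
          rw [ENNReal.rpow_add _ _ (hN0 x) hxfin, ENNReal.rpow_one]
        rw [this, mul_assoc, mul_assoc, ENNReal.mul_inv_cancel h0 ht, mul_one]
    _ ≤ _ := by
        rw [lintegral_const_mul _ hN, mul_assoc]
        refine mul_le_mul_right ?_ _
        refine (mul_le_mul_left hNE _).trans (le_of_eq ?_)
        by_cases hE0 : E = 0
        · rw [hE0, zero_mul, ENNReal.zero_rpow_of_pos hq0]
        · conv_rhs => rw [show q = 1 + (q - 1) by ring]
          rw [ENNReal.rpow_add _ _ hE0 hE, ENNReal.rpow_one]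

variable {Ω : Type*} [MeasurableSpace Ω] {P : Measure Ω} {H T t k h : ℝ} {W : ℝ → ℝ → Ω → ℝ}
  {m n : ℕ} {L : EquationKind}

lemma IsFractionalSheet.aestronglyMeasurable_integral_kernelStep [SFinite P]
    (hW : IsFractionalSheet H T P W) (ht : t ∈ Icc 0 T) (hk : 0 < k) (hmk : m * k = T) (hh : 0 < h)
    (hnh : n * h = 1) :
    AEStronglyMeasurable (fun z : ℝ × Ω => (kernelStep L t z.1 hk hmk hh hnh).integral W z.2)
      ((volume.restrict (Ioo (0 : ℝ) 1)).prod P) := by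
  simp only [StepFun.integral, kernelStep]
  refine Finset.aestronglyMeasurable_fun_sum _ fun i hi => Finset.aestronglyMeasurable_fun_sum _
    fun j hj => ?_
  have hi' := Finset.mem_range.1 hi
  have hj' := Finset.mem_range.1 hj
  have hk1 : ∀ l ≤ m, (l : ℝ) * k ∈ Icc 0 T := fun l hl => ⟨by positivity, by
    rw [← hmk]; gcongr⟩
  have hh1 : ∀ l ≤ n, (l : ℝ) * h ∈ Icc (0 : ℝ) 1 := fun l hl => ⟨by positivity, by
    calc (l : ℝ) * h ≤ n * h := by gcongr
      _ = 1 := hnh⟩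
  have hWm : ∀ l ≤ m, ∀ l' ≤ n, AEMeasurable (W (l * k) (l' * h)) P := fun l hl l' hl' =>
    hW.gaussian.aemeasurable (⟨_, hk1 l hl⟩, ⟨_, hh1 l' hl'⟩)
  refine AEStronglyMeasurable.mul ?_ ?_
  · exact ((measurable_kernelAvg ht hk hmk hh hnh hi' hj').comp measurable_fst).aestronglyMeasurable
  · refine AEStronglyMeasurable.comp_snd (f := fun ω => rectIncr W _ _ _ _ ω) ?_
    have h1 := hWm i hi'.le j hj'.le
    have h2 := hWm (i + 1) hi' j hj'.le
    have h3 := hWm i hi'.le (j + 1) hj'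
    have h4 := hWm (i + 1) hi' (j + 1) hj'
    unfold rectIncr
    exact (((h4.sub h3).sub h2).add h1).aestronglyMeasurable

/-- The radicand is `K` times a sum of two squares, and the root of such a sum is at most the sum of
the roots. -/
lemma sqrt_errorBound_le {K κ : ℝ} (hK : 0 ≤ K) (hκ : 0 ≤ κ) (hh : 0 < h) :
    √(K * (κ * h ^ (2 * H - 1) + h ^ (2 * H))) ≤ √K * (h ^ H + √κ * h ^ (H - 1 / 2)) := by
  have e1 : h ^ (2 * H - 1) = (h ^ (H - 1 / 2)) ^ 2 := by
    rw [← Real.rpow_natCast, ← Real.rpow_mul hh.le]; congr 1; push_cast; ring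
  have e2 : h ^ (2 * H) = (h ^ H) ^ 2 := by
    rw [← Real.rpow_natCast, ← Real.rpow_mul hh.le]; congr 1; push_cast; ring
  rw [Real.sqrt_mul hK]
  refine mul_le_mul_of_nonneg_left ?_ (Real.sqrt_nonneg K)
  have ha : 0 ≤ h ^ H := by positivity
  have hb : 0 ≤ h ^ (H - 1 / 2) := by positivity
  refine Real.sqrt_le_iff.2 ⟨by positivity, ?_⟩
  rw [e1, e2]
  nlinarith [Real.sq_sqrt hκ, mul_nonneg ha (mul_nonneg (Real.sqrt_nonneg κ) hb)]

/-- The constant in the error estimate of the Wong–Zakai approximation. -/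
def momentConst (p H T : ℝ) : ℝ := (gaussMoment p).toReal ^ (1 / p) * √(2 * errorConst H T + 1)

lemma IsFractionalSheet.supMoment_le [IsProbabilityMeasure P] (hW : IsFractionalSheet H T P W)
    (hH : 0 < H) (hH' : H ≤ 1 / 2) (hT : 0 < T) {p : ℝ} (hp : 2 ≤ p) (hm : 0 < m) (hn : 0 < n)
    (hkT : k = T / m) (hhn : h = 1 / n) {S : ℝ → ℝ → Ω → ℝ}
    (hS : IsStochasticConvolution L H T P W S) :
    supMoment p T P (fun t x ω => S t x ω - convApprox L T W m n t x ω) ≤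
      ENNReal.ofReal (momentConst p H T * (h ^ H + √(timeRes L k) * h ^ (H - 1 / 2))) := by
  have hm' : (0 : ℝ) < m := by exact_mod_cast hm
  have hn' : (0 : ℝ) < n := by exact_mod_cast hn
  subst hkT hhn
  have hk : 0 < T / m := by positivity
  have hmk : m * (T / m) = T := by field_simp
  have hh : 0 < (1 / n : ℝ) := by positivity
  have hnh : n * (1 / n : ℝ) = 1 := by field_simp
  have hp0 : 0 < p := by linarith
  have hC : 0 ≤ errorConst H T := by unfold errorConst; positivity
  have hκ := timeRes_pos (L := L) hk
  have hhH : 0 < (1 / n : ℝ) ^ (2 * H) := by positivity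
  have hhH1 : 0 < (1 / n : ℝ) ^ (2 * H - 1) := by positivity
  unfold supMoment
  refine iSup₂_le fun t ht => ?_
  obtain ⟨hSm, hSx⟩ := hS t ht
  set μ := (volume : Measure ℝ).restrict (Ioo (0 : ℝ) 1)
  set R := (2 * errorConst H T + 1) *
    (timeRes L (T / m) * (1 / n : ℝ) ^ (2 * H - 1) + (1 / n : ℝ) ^ (2 * H)) with hR
  have hR0 : 0 ≤ R := by positivity
  set u : ℝ × Ω → ℝ := fun z => S t z.1 z.2 - (kernelStep L t z.1 hk hmk hh hnh).integral W z.2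
  have hum : AEStronglyMeasurable u (μ.prod P) :=
    hSm.sub (hW.aestronglyMeasurable_integral_kernelStep ht hk hmk hh hnh)
  -- The weighted Hölder inequality needs a weight that is nowhere zero. Adding `h^{2H}` to `2 *
  -- kernelError` achieves this within the order of the error, and accounts for the `+ 1` in
  -- `momentConst`.
  have hmain := lintegral_rpow_lintegral_le (μ := μ) (P := P) (u := fun z => ‖u z‖ₑ ^ (2 : ℝ))
    (N := fun x => 2 * kernelError L H T t m n (T / m) (1 / n) x +
      ENNReal.ofReal ((1 / n : ℝ) ^ (2 * H)))
    (E := ENNReal.ofReal R) (c := gaussMoment p) (q := p / 2) (hum.enorm.pow_const _) (by fun_prop)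
    (fun x => by simp only [ne_eq, add_eq_zero, ENNReal.ofReal_eq_zero, not_and, not_le]; exact fun _ => hhH)
    ENNReal.ofReal_ne_top ?_ (by linarith) ?_
  · calc (∫⁻ ω, eLpNorm (fun x => S t x ω - convApprox L T W m n t x ω) 2 μ ^ p ∂P) ^ (1 / p)
        = (∫⁻ ω, (∫⁻ x, ‖u (x, ω)‖ₑ ^ (2 : ℝ) ∂μ) ^ (p / 2) ∂P) ^ (1 / p) := by
          congr 1
          refine lintegral_congr fun ω => ?_
          rw [eLpNorm_eq_lintegral_rpow_enorm_toReal two_ne_zero ENNReal.ofNat_ne_top,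
            ← ENNReal.rpow_mul, ENNReal.toReal_ofNat, one_div_mul_eq_div]
          simp only [u, convApprox_eq_integral_kernelStep W ht hk hmk hh hnh]
      _ ≤ (gaussMoment p * ENNReal.ofReal R ^ (p / 2)) ^ (1 / p) :=
          ENNReal.rpow_le_rpow hmain (by positivity)
      _ = ENNReal.ofReal ((gaussMoment p).toReal ^ (1 / p) * √R) := by
          rw [ENNReal.mul_rpow_of_nonneg _ _ (by positivity), ← ENNReal.rpow_mul,
            ENNReal.ofReal_mul (p := (gaussMoment p).toReal ^ (1 / p)) (by positivity),
            Real.sqrt_eq_rpow,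
            ← ENNReal.ofReal_rpow_of_nonneg ENNReal.toReal_nonneg (by positivity),
            ENNReal.ofReal_toReal (gaussMoment_ne_top hp0),
            ← ENNReal.ofReal_rpow_of_nonneg hR0 (by positivity)]
          congr 2
          field_simp
      _ ≤ _ := by
          apply ENNReal.ofReal_le_ofReal
          rw [momentConst, mul_assoc]
          exact mul_le_mul_of_nonneg_left (sqrt_errorBound_le (by positivity) hκ.le hh)
            (by positivity)
  · rw [lintegral_add_right _ measurable_const, lintegral_const_mul _ measurable_kernelError]
    refine (add_le_add_left (mul_le_mul_right
      (lintegral_kernelError_le hH hH' hk hmk hn rfl ht) _) _).trans ?_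
    rw [lintegral_const, show μ univ = 1 by simp [μ], mul_one,
      show (2 : ℝ≥0∞) = ENNReal.ofReal 2 by simp, ← ENNReal.ofReal_mul zero_le_two,
      ← ENNReal.ofReal_add (by positivity) (by positivity)]
    apply ENNReal.ofReal_le_ofReal
    rw [hR]
    nlinarith [mul_pos hκ hhH1]
  · filter_upwards [hSx] with x hx
    have h1 := hW.lintegral_sub_integral_rpow_le hH hH' (measurable_kernel L t x) hx
      (kernelStep L t x hk hmk hh hnh) hp0
    have h2 : ∀ ω, (‖u (x, ω)‖ₑ ^ (2 : ℝ)) ^ (p / 2) =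
        ‖S t x ω - (kernelStep L t x hk hmk hh hnh).integral W ω‖ₑ ^ p := fun ω => by
      rw [← ENNReal.rpow_mul]; congr 1; ring
    simp_rw [h2]
    refine h1.trans ?_
    gcongr
    exact (mul_le_mul_right (noiseNormSq_kernel_sub_kernelStep_le ht hk hmk hh hnh x) _).trans
      le_self_add

end Moments

/-! ### Existence of the stochastic convolution -/

section Existence

variable {Ω : Type*} [MeasurableSpace Ω] {P : Measure Ω} {H T t : ℝ} {W : ℝ → ℝ → Ω → ℝ}
  {L : EquationKind}

/-- The order of choice matters: `h^{2H-1}` may blow up, so `n` is fixed first to make `h^{2H}`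
small, and `m` is then chosen depending on `n`. -/
lemma exists_grid_errorBound_le (hH : 0 < H) (L : EquationKind) {ε : ℝ} (hε : 0 < ε) :
    ∃ m n : ℕ, 0 < m ∧ 0 < n ∧ errorConst H T *
      (timeRes L (T / m) * (1 / n : ℝ) ^ (2 * H - 1) + (1 / n : ℝ) ^ (2 * H)) < ε := by
  have h1 : Tendsto (fun n : ℕ => errorConst H T * (1 / n : ℝ) ^ (2 * H)) atTop (𝓝 0) := by
    have := ((tendsto_one_div_atTop_nhds_zero_nat (𝕜 := ℝ)).rpow_const
      (p := 2 * H) (Or.inr (by positivity))).const_mul (errorConst H T)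
    rwa [Real.zero_rpow (by positivity), mul_zero] at this
  obtain ⟨n, hn, hn0⟩ := ((h1.eventually (gt_mem_nhds hε)).and (eventually_gt_atTop 0)).exists
  have hk : Tendsto (fun m : ℕ => T / (m : ℝ)) atTop (𝓝 0) :=
    tendsto_const_div_atTop_nhds_zero_nat T
  have h2 : Tendsto (fun m : ℕ => timeRes L (T / m)) atTop (𝓝 0) := by
    cases L
    · have := (Real.continuous_sqrt.tendsto 0).comp hk
      rwa [Real.sqrt_zero] at this
    · exact hk
  have h3 : Tendsto (fun m : ℕ => errorConst H T *
      (timeRes L (T / m) * (1 / n : ℝ) ^ (2 * H - 1) + (1 / n : ℝ) ^ (2 * H))) atTop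
      (𝓝 (errorConst H T * (1 / n : ℝ) ^ (2 * H))) := by
    have := ((h2.mul_const ((1 / n : ℝ) ^ (2 * H - 1))).add_const
      ((1 / n : ℝ) ^ (2 * H))).const_mul (errorConst H T)
    rwa [zero_mul, zero_add] at this
  obtain ⟨m, hm, hm0⟩ := ((h3.eventually (gt_mem_nhds hn)).and (eventually_gt_atTop 0)).exists
  exact ⟨m, n, hm0, hn0, hm⟩

/-- A family of integrands that is the limit, in square mean, of a sufficiently fast sequence of
families of step functions has a jointly measurable family of stochastic integrals. -/
lemma IsFractionalSheet.exists_isStochasticIntegral [IsProbabilityMeasure P]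
    (hW : IsFractionalSheet H T P W) (hH : 0 < H) (hH' : H ≤ 1 / 2) {μ : Measure ℝ} [SFinite μ]
    {f : ℝ → ℝ → ℝ → ℝ} (hf : ∀ x, Measurable (Function.uncurry (f x))) {F : ℕ → ℝ → StepFun T}
    (hF : ∀ r, AEStronglyMeasurable (fun z : ℝ × Ω => (F r z.1).integral W z.2) (μ.prod P))
    {e : ℕ → ℝ → ℝ≥0∞} (he : ∀ r, Measurable (e r))
    (hfe : ∀ r x, noiseNormSq H T (fun s y => f x s y - (F r x).toFun s y) ≤ e r x)
    (hsum : ∀ r, (4 * gaussMoment 2 + 1) * ∫⁻ x, e r x ∂μ ≤ 4⁻¹ ^ (r + 1)) :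
    ∃ S : ℝ → Ω → ℝ, AEStronglyMeasurable (fun z : ℝ × Ω => S z.1 z.2) (μ.prod P) ∧
      ∀ᵐ x ∂μ, IsStochasticIntegral H T P W (f x) (S x) := by
  set Y : ℕ → ℝ × Ω → ℝ := fun r z => (F r z.1).integral W z.2
  have h2 : ∀ v : ℝ × Ω → ℝ, eLpNorm v 2 (μ.prod P) = (∫⁻ z, ‖v z‖ₑ ^ (2 : ℝ) ∂μ.prod P) ^ (1 / 2 : ℝ) := by
    intro v
    rw [eLpNorm_eq_lintegral_rpow_enorm_toReal two_ne_zero ENNReal.ofNat_ne_top,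
      ENNReal.toReal_ofNat]
  have hroot : ∀ N : ℕ, ((4⁻¹ : ℝ≥0∞) ^ N) ^ (1 / 2 : ℝ) = 2⁻¹ ^ N := fun N => by
    rw [show (4⁻¹ : ℝ≥0∞) = 2⁻¹ ^ 2 by
      rw [← ENNReal.inv_pow]; norm_num, ← pow_mul, mul_comm, pow_mul, ← ENNReal.rpow_natCast_mul]
    norm_num
  have hle4 : ∀ {N r : ℕ}, N ≤ r → gaussMoment 2 * (2 * ∫⁻ x, e r x ∂μ) ≤ 2⁻¹ * 4⁻¹ ^ (N + 1) := by
    intro N r hr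
    calc _ = 2⁻¹ * (4 * gaussMoment 2 * ∫⁻ x, e r x ∂μ) := by
          rw [show (4 : ℝ≥0∞) = 2 * 2 by norm_num]
          rw [← mul_assoc, ← mul_assoc, ← mul_assoc, ← mul_assoc,
            ENNReal.inv_mul_cancel two_ne_zero ENNReal.ofNat_ne_top]
          ring
      _ ≤ 2⁻¹ * 4⁻¹ ^ (r + 1) := by
          gcongr
          refine le_trans ?_ (hsum r)
          gcongr
          exact le_self_add
      _ ≤ _ := by
          gcongr 2⁻¹ * ?_
          exact pow_le_pow_right_of_le_one' (by simp) (by omega)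
  -- The isometry at each `x`, integrated over `x`, makes the integrals Cauchy on the product space.
  have hdiff : ∀ N r r' : ℕ, N ≤ r → N ≤ r' →
      eLpNorm (Y r - Y r') 2 (μ.prod P) < 2⁻¹ ^ N := by
    intro N r r' hr hr'
    have hm : AEMeasurable (fun z => ‖(Y r - Y r') z‖ₑ ^ (2 : ℝ)) (μ.prod P) :=
      ((hF r).sub (hF r')).enorm.pow_const _
    rw [h2, ← hroot]
    refine ENNReal.rpow_lt_rpow ?_ (by norm_num)
    calc ∫⁻ z, ‖(Y r - Y r') z‖ₑ ^ (2 : ℝ) ∂μ.prod P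
        = ∫⁻ x, ∫⁻ ω, ‖(F r x).integral W ω - (F r' x).integral W ω‖ₑ ^ (2 : ℝ) ∂P ∂μ :=
          lintegral_prod _ hm
      _ ≤ ∫⁻ x, gaussMoment 2 * (2 * e r x + 2 * e r' x) ∂μ := by
          refine lintegral_mono fun x => ?_
          rw [hW.lintegral_integral_sub_rpow hH hH' _ _ two_pos, div_self two_ne_zero,
            ENNReal.rpow_one]
          gcongr
          have h1 : Measurable (Function.uncurry fun s y => f x s y - (F r x).toFun s y) :=
            (hf x).sub (F r x).measurable_toFun
          have h2 : Measurable (Function.uncurry fun s y => f x s y - (F r' x).toFun s y) :=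
            (hf x).sub (F r' x).measurable_toFun
          have h3 : Measurable (Function.uncurry fun s y => -(f x s y - (F r x).toFun s y)) := h1.neg
          refine le_trans (le_of_eq ?_) ((noiseNormSq_add_le (H := H) (T := T) h3 h2).trans ?_)
          · congr 1 with s y; ring
          · rw [noiseNormSq_neg fun s y => f x s y - (F r x).toFun s y]
            gcongr <;> exact hfe _ x
      _ = gaussMoment 2 * (2 * ∫⁻ x, e r x ∂μ) + gaussMoment 2 * (2 * ∫⁻ x, e r' x ∂μ) := by
          rw [lintegral_const_mul _ (by fun_prop), lintegral_add_left (by fun_prop),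
            lintegral_const_mul _ (he r), lintegral_const_mul _ (he r'), mul_add]
      _ ≤ 2⁻¹ * 4⁻¹ ^ (N + 1) + 2⁻¹ * 4⁻¹ ^ (N + 1) := add_le_add (hle4 hr) (hle4 hr')
      _ = 4⁻¹ ^ (N + 1) := by
          rw [← add_mul, ENNReal.inv_two_add_inv_two, one_mul]
      -- The spare factor `4⁻¹` in the hypothesis provides the strict inequality demanded by the
      -- Cauchy criterion.
      _ < 4⁻¹ ^ N := by
          rw [pow_succ]
          conv_rhs => rw [← mul_one (4⁻¹ ^ N)]
          exact (ENNReal.mul_lt_mul_iff_right (pow_ne_zero _ (by simp))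
            (ENNReal.pow_ne_top (by simp))).2 (by simp)
  -- The `Y r` themselves are not known to be square integrable over the product, so completeness is
  -- applied to `Y r - Y 0` and `Y 0` is added back to the limit.
  have hfm : ∀ r, MemLp (Y r - Y 0) 2 (μ.prod P) := fun r =>
    ⟨(hF r).sub (hF 0), (hdiff 0 r 0 (Nat.zero_le _) le_rfl).trans_le (by simp) |>.trans
      ENNReal.one_lt_top⟩
  have hsub : ∀ r r', Y r - Y 0 - (Y r' - Y 0) = Y r - Y r' := fun r r' => by abel
  obtain ⟨Z, hZ, hZlim⟩ := Lp.cauchy_complete_eLpNorm (f := fun r => Y r - Y 0) (by norm_num) hfm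
    (B := fun N => 2⁻¹ ^ N) (by simp [ENNReal.tsum_geometric]) fun N r r' hr hr' => by
      simp only [hsub]; exact hdiff N r r' hr hr'
  have hS : AEStronglyMeasurable (Z + Y 0) (μ.prod P) := hZ.1.add (hF 0)
  have hrate : ∀ r, eLpNorm (Y r - (Z + Y 0)) 2 (μ.prod P) ≤ 2⁻¹ ^ r := by
    intro r
    have h3 : Tendsto (fun r' => 2⁻¹ ^ r + eLpNorm (Y r' - Y 0 - Z) 2 (μ.prod P)) atTop
        (𝓝 (2⁻¹ ^ r + 0)) := tendsto_const_nhds.add hZlim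
    rw [add_zero] at h3
    refine ge_of_tendsto h3 ((eventually_ge_atTop r).mono fun r' hr' => ?_)
    calc _ = eLpNorm ((Y r - Y r') + (Y r' - Y 0 - Z)) 2 (μ.prod P) := by congr 1; abel
      _ ≤ _ := (eLpNorm_add_le ((hF r).sub (hF r')) ((hfm r').1.sub hZ.1) (by norm_num)).trans
          (add_le_add_left (hdiff r r r' le_rfl hr').le _)
  have hgm : ∀ r, AEMeasurable (fun z => ‖(Y r - (Z + Y 0)) z‖ₑ ^ (2 : ℝ)) (μ.prod P) := fun r =>
    ((hF r).sub hS).enorm.pow_const _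
  have hg : ∀ r, ∫⁻ x, ∫⁻ ω, ‖(Y r - (Z + Y 0)) (x, ω)‖ₑ ^ (2 : ℝ) ∂P ∂μ ≤ 4⁻¹ ^ r := by
    intro r
    rw [← lintegral_prod _ (hgm r), ← ENNReal.rpow_le_rpow_iff (z := 1 / 2) (by norm_num), hroot,
      ← h2]
    exact hrate r
  have hgeom : ∑' r : ℕ, (4⁻¹ : ℝ≥0∞) ^ r ≠ ∞ := by
    rw [ENNReal.tsum_geometric, ne_eq, ENNReal.inv_eq_top, tsub_eq_zero_iff_le, not_le]
    simp
  -- Geometric decay of the integrals makes the pointwise sum finite almost everywhere, so the whole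
  -- sequence converges at almost every `x`, not just a subsequence.
  have hlim : ∀ g : ℕ → ℝ → ℝ≥0∞, (∀ r, AEMeasurable (g r) μ) → (∀ r, ∫⁻ x, g r x ∂μ ≤ 4⁻¹ ^ r) →
      ∀ᵐ x ∂μ, Tendsto (fun r => g r x) atTop (𝓝 0) := by
    intro g hgm hg
    have h3 : ∫⁻ x, ∑' r, g r x ∂μ ≠ ∞ := by
      rw [lintegral_tsum hgm]
      exact ((ENNReal.tsum_le_tsum hg).trans_lt hgeom.lt_top).ne
    filter_upwards [ae_lt_top' (AEMeasurable.tsum hgm) h3] with x hx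
    exact ENNReal.tendsto_atTop_zero_of_tsum_ne_top hx.ne
  -- The `+ 1` in the hypothesis bounds the integral of `e r` itself, independently of the size of
  -- the Gaussian moment.
  have hlim1 := hlim e (fun r => (he r).aemeasurable) fun r => by
    calc ∫⁻ x, e r x ∂μ = 1 * ∫⁻ x, e r x ∂μ := (one_mul _).symm
      _ ≤ (4 * gaussMoment 2 + 1) * ∫⁻ x, e r x ∂μ := by gcongr; exact le_add_self
      _ ≤ _ := hsum r
      _ ≤ _ := pow_le_pow_right_of_le_one' (by simp) r.le_succ
  have hlim2 := hlim _ (fun r => (hgm r).lintegral_prod_right') hg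
  refine ⟨fun x ω => (Z + Y 0) (x, ω), hS, ?_⟩
  filter_upwards [hlim1, hlim2, hS.prodMk_left] with x hx1 hx2 hxm
  have hconv : Tendsto (fun r => eLpNorm (fun ω => (Z + Y 0) (x, ω) - (F r x).integral W ω) 2 P)
      atTop (𝓝 0) := by
    have h3 := hx2.ennrpow_const (1 / 2 : ℝ)
    rw [ENNReal.zero_rpow_of_pos (by norm_num)] at h3
    refine h3.congr fun r => ?_
    rw [eLpNorm_eq_lintegral_rpow_enorm_toReal two_ne_zero ENNReal.ofNat_ne_top,
      ENNReal.toReal_ofNat]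
    congr 1
    refine lintegral_congr fun ω => ?_
    rw [← enorm_neg]
    congr 2
    simp [Y]
  refine ⟨(hf x).aemeasurable, ?_, fun r => F r x, ?_, hconv⟩
  · obtain ⟨r, hr⟩ := (hconv.eventually (gt_mem_nhds zero_lt_one)).exists
    have h4 : MemLp (fun ω => (Z + Y 0) (x, ω) - (F r x).integral W ω) 2 P :=
      ⟨hxm.sub (hW.memLp_integral _).1, hr.trans ENNReal.one_lt_top⟩
    refine (h4.add (hW.memLp_integral (F r x))).ae_eq (Eventually.of_forall fun ω => ?_)
    simp
  · exact tendsto_of_tendsto_of_tendsto_of_le_of_le tendsto_const_nhds hx1 (fun _ => zero_le)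
      fun r => hfe r x

lemma IsFractionalSheet.exists_isStochasticConvolution [IsProbabilityMeasure P]
    (hW : IsFractionalSheet H T P W) (hT : 0 < T) (hH : 0 < H) (hH' : H ≤ 1 / 2)
    (L : EquationKind) : ∃ S : ℝ → ℝ → Ω → ℝ, IsStochasticConvolution L H T P W S := by
  set G : ℝ≥0∞ := 4 * gaussMoment 2 + 1
  have hG : G ≠ ∞ := by simp [G, ENNReal.mul_eq_top, gaussMoment_ne_top two_pos]
  have hG0 : G ≠ 0 := by simp [G]
  -- The grids are refined so fast that the error, multiplied by `G`, stays below `4^{-(r+1)}`. They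
  -- do not depend on `t`, because the deterministic estimate is uniform in `t`.
  have hε : ∀ r : ℕ, ∃ m n : ℕ, 0 < m ∧ 0 < n ∧ errorConst H T *
      (timeRes L (T / m) * (1 / n : ℝ) ^ (2 * H - 1) + (1 / n : ℝ) ^ (2 * H)) <
        (G⁻¹ * 4⁻¹ ^ (r + 1)).toReal := fun r => by
    refine exists_grid_errorBound_le hH L (ENNReal.toReal_pos ?_ ?_)
    · simp [hG]
    · exact ENNReal.mul_ne_top (ENNReal.inv_ne_top.2 hG0) (ENNReal.pow_ne_top (by simp))
  choose m n hm hn hmn using hε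
  have hm' : ∀ r, (0 : ℝ) < m r := fun r => by exact_mod_cast hm r
  have hn' : ∀ r, (0 : ℝ) < n r := fun r => by exact_mod_cast hn r
  have hk : ∀ r, 0 < T / m r := fun r => div_pos hT (hm' r)
  have hmk : ∀ r, m r * (T / m r) = T := fun r => mul_div_cancel₀ T (hm' r).ne'
  have hh : ∀ r, 0 < (1 / n r : ℝ) := fun r => one_div_pos.2 (hn' r)
  have hnh : ∀ r, n r * (1 / n r : ℝ) = 1 := fun r => mul_one_div_cancel (hn' r).ne'
  have key : ∀ t ∈ Icc 0 T, ∃ S : ℝ → Ω → ℝ,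
      AEStronglyMeasurable (fun z : ℝ × Ω => S z.1 z.2)
        ((volume.restrict (Ioo (0 : ℝ) 1)).prod P) ∧
      ∀ᵐ x ∂(volume.restrict (Ioo (0 : ℝ) 1)),
        IsStochasticIntegral H T P W (fun s y => kernel L t x s y) (S x) := by
    intro t ht
    refine hW.exists_isStochasticIntegral hH hH' (f := kernel L t) (measurable_kernel L t)
      (F := fun r x => kernelStep L t x (hk r) (hmk r) (hh r) (hnh r))
      (fun r => hW.aestronglyMeasurable_integral_kernelStep ht _ _ _ _)
      (e := fun r => kernelError L H T t (m r) (n r) (T / m r) (1 / n r))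
      (fun r => measurable_kernelError)
      (fun r x => noiseNormSq_kernel_sub_kernelStep_le ht _ _ _ _ x) fun r => ?_
    calc _ ≤ G * (G⁻¹ * 4⁻¹ ^ (r + 1)) := by
          refine mul_le_mul_right ((lintegral_kernelError_le hH hH' (hk r) (hmk r) (hn r) rfl
            ht).trans (ENNReal.ofReal_le_of_le_toReal (hmn r).le)) G
      _ = _ := by rw [← mul_assoc, ENNReal.mul_inv_cancel hG0 hG, one_mul]
  choose! S hS using key
  exact ⟨S, hS⟩

end Existence

end WongZakai

end

/-! ### The theorem -/

theorem theorem3p3 (p T H : ℝ) (hp : 2 ≤ p) (hT : 0 < T) (hH : 0 < H) (hH' : H ≤ 1 / 2) :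
    ∃ C : ℝ, ∀ (Ω : Type*) [MeasurableSpace Ω] (P : Measure Ω) [IsProbabilityMeasure P]
      (W : ℝ → ℝ → Ω → ℝ), WongZakai.IsFractionalSheet H T P W →
      (∀ L : WongZakai.EquationKind,
        ∃ S : ℝ → ℝ → Ω → ℝ, WongZakai.IsStochasticConvolution L H T P W S) ∧
      ∀ m n : ℕ, 0 < m → 0 < n → ∀ k h : ℝ, k = T / m → h = 1 / n →
        (∀ S : ℝ → ℝ → Ω → ℝ,
          WongZakai.IsStochasticConvolution WongZakai.EquationKind.heat H T P W S →
          WongZakai.supMoment p T P (fun t x ω =>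
              S t x ω - WongZakai.convApprox WongZakai.EquationKind.heat T W m n t x ω) ≤
            ENNReal.ofReal (C * (h ^ H + k ^ (1 / 4 : ℝ) * h ^ (H - 1 / 2)))) ∧
        (∀ S : ℝ → ℝ → Ω → ℝ,
          WongZakai.IsStochasticConvolution WongZakai.EquationKind.wave H T P W S →
          WongZakai.supMoment p T P (fun t x ω =>
              S t x ω - WongZakai.convApprox WongZakai.EquationKind.wave T W m n t x ω) ≤
            ENNReal.ofReal (C * (h ^ H + k ^ (1 / 2 : ℝ) * h ^ (H - 1 / 2)))) := by
  refine ⟨WongZakai.momentConst p H T, fun Ω _ P _ W hW =>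
    ⟨hW.exists_isStochasticConvolution hT hH hH', fun m n hm hn k h hk hh => ⟨?_, ?_⟩⟩⟩
  · intro S hS
    have hk0 : 0 ≤ k := by rw [hk]; positivity
    have e : √(WongZakai.timeRes .heat k) = k ^ (1 / 4 : ℝ) := by
      simp only [WongZakai.timeRes]
      rw [Real.sqrt_eq_rpow, Real.sqrt_eq_rpow, ← Real.rpow_mul hk0]
      norm_num
    rw [← e]
    exact hW.supMoment_le hH hH' hT hp hm hn hk hh hS
  · intro S hS
    have e : √(WongZakai.timeRes .wave k) = k ^ (1 / 2 : ℝ) := Real.sqrt_eq_rpow k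
    rw [← e]
    exact hW.supMoment_le hH hH' hT hp hm hn hk hh hS
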